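/- **Conventions.** Let $\beta\in\mathbb R$ and $0<\delta<1$ be fixed and let $\widehat w(\xi)=\int_{\mathbb R}e^{-ix\xi}w(x)\,dx$. For $s\ge 0$ let $H^s=H^s(\mathbb R)$ be the space of complex-valued $w\in L^2(\mathbb R)$ with $\|w\|_{H^s}=\|\langle\xi\rangle^s\widehat w(\xi)\|_{L^2_\xi}<\infty$, $\langle\xi\rangle=(1+\xi^2)^{1/2}$. Put $$\Phi(\xi,\xi_1,\xi_2)=\xi_1^5+\xi_2^5-\xi^5+\beta(\xi_1^3+\xi_2^3-\xi^3).$$ Let $\mathfrak T(k)$ be the set of the $k!$ ordered binary trees with $k$ non-terminal nodes: binary trees $\mathcal T$ together with a chronicle of their growth, in which at the $j$-th step ($1\le j\le k$) one terminal node is turned into a non-terminal one with two children, starting from a single node, the root. An index function on $\mathcal T$ assigns to each node $a$ a number $\xi_a\in\mathbb R$ such that $\xi_b=\xi_{b_1}+\xi_{b_2}$ for every non-terminal node $b$ with children $b_1,b_2$. Integrals over the index functions with value $\xi$ at the root are taken with respect to Lebesgue measure in the $k$ variables $\xi_{b_1}$ ($b$ non-terminal). If $b$ is the node expanded at the $j$-th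 step, put $\xi^{(j)}=\xi_b$, $\mu_j=\Phi(\xi_b,\xi_{b_1},\xi_{b_2})$ and $\tilde\mu_j=\mu_1+\dots+\mu_j$. For a dyadic number $N=2^m>1$ let $C_0=\{|\tilde\mu_1|>N\}$ and $C_j=\{|\tilde\mu_{j+1}|\le(2j+3)^3\max\{|\tilde\mu_1|,|\tilde\mu_j|\}^{1-\delta}\}$ for $j\ge1$. Define, at time $\tau$, $$\widehat{N_0^{(k)}(w)}(\tau,\xi)=-\sum_{\mathcal T\in\mathfrak T(k-1)}\int_{\xi_{\rm root}=\xi}\mathbf 1_{C_0\cap\bigcap_{j=1}^{k-2}C_j^c}\ \prod_{j=1}^{k-1}i\xi^{(j)}\ \frac{e^{i\tau\tilde\mu_{k-1}}}{\prod_{j=1}^{k-1}i\tilde\mu_j}\prod_{a\ \rm terminal}\widehat w(\xi_a)\qquad(k\ge2),$$ $$\widehat{N_1^{(k)}(w)}(\tau,\xi)=-\sum_{\mathcal T\in\mathfrak T(k)}\int_{\xi_{\rm root}=\xi}\mathbf 1_{D_k}\ \prod_{j=1}^{k}i\xi^{(j)}\ \frac{e^{i\tau\tilde\mu_{k}}}{\prod_{j=1}^{k-1}i\tilde\mu_j}\prod_{a\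 \rm terminal}\widehat w(\xi_a)\qquad(k\ge1),$$ where $D_1=C_0^c$ and $D_k=C_0\cap\bigcap_{j=1}^{k-2}C_j^c\cap C_{k-1}$ for $k\ge2$. The *normal form equation* with datum $u_0$ is $$v(t)=u_0+\sum_{k=2}^\infty N_0^{(k)}(v(\tau))\Big|_{\tau=0}^{\tau=t}+\int_0^t\sum_{k=1}^\infty N_1^{(k)}(v(\tau))\,d\tau .$$ A solution in $X=C([-T,T];H^s)$ (with norm $\|v\|_X=\sup_{|t|\le T}\|v(t)\|_{H^s}$) is a $v\in X$ for which, at every time $t\in[-T,T]$, all the integrals converge absolutely for almost every $\xi$ and give Fourier transforms of elements of $H^s$, both series converge in $H^s$, the time integral exists as a Bochner integral in $H^s$, and the equation holds. **Theorem.** Let $s\ge0$ and $r\ge1$. There exist $T=T(r)>0$ and a dyadic $N=N(r)>1$ (which may also depend on the fixed parameters $s,\beta,\delta$) such that for every $u_0\in H^s$ with $\|u_0\|_{H^s}\le r$ the normal form equation has a unique solution $v\in X=C([-T,T];H^s)$. Uniqueness holds in all of $X$; the solution satisfies $\|v\|_X\le2r$; the data-to-solution map $u_0\mapsto v$ is Lipschitz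 continuous from $\{z\in H^s:\|z\|_{H^s}\le r\}$ to $X$; and if $u_0$ is real-valued, then so is $v(t)$ for every $t\in[-T,T]$. -/

import Mathlib

open MeasureTheory FourierTransform
open scoped NNReal ENNReal

noncomputable section

namespace Kawahara

/-! ### The Sobolev space `H^s(ℝ)`, `s ≥ 0` -/

/-- The Fourier transform `ŵ(ξ) = ∫ e^{-ixξ} w(x) dx` of `w ∈ L²(ℝ; ℂ)`. Mathlib's (Plancherel)
transform `𝓕` on `L²` has the kernel `e^{-2πixξ}`, hence the rescaling. -/
def hat (w : Lp ℂ 2 (volume : Measure ℝ)) (ξ : ℝ) : ℂ :=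
  (𝓕 w : Lp ℂ 2 (volume : Measure ℝ)) (ξ / (2 * Real.pi))

/-- The Japanese bracket `⟨ξ⟩ = (1 + ξ²)^{1/2}`. -/
def bracket (ξ : ℝ) : ℝ := Real.sqrt (1 + ξ ^ 2)

/-- The function `ξ ↦ ⟨ξ⟩^s ŵ(ξ)`. -/
def weightedHat (s : ℝ) (w : Lp ℂ 2 (volume : Measure ℝ)) (ξ : ℝ) : ℂ :=
  ((bracket ξ ^ s : ℝ) : ℂ) * hat w ξ

theorem bracket_pos (ξ : ℝ) : 0 < bracket ξ := Real.sqrt_pos.2 (by positivity)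

theorem one_le_bracket (ξ : ℝ) : 1 ≤ bracket ξ := by
  rw [bracket, Real.one_le_sqrt]; nlinarith [sq_nonneg ξ]

theorem continuous_bracket_rpow (s : ℝ) : Continuous fun ξ => bracket ξ ^ s := by
  unfold bracket
  refine Continuous.rpow_const (by fun_prop) fun ξ => Or.inl ?_
  exact (bracket_pos ξ).ne'

theorem quasi_scale {c : ℝ} (hc : c ≠ 0) :
    Measure.QuasiMeasurePreserving (fun ξ : ℝ => c * ξ) volume volume := by
  refine ⟨by fun_prop, ?_⟩
  rw [Real.map_volume_mul_left hc]
  exact Measure.smul_absolutelyContinuous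

theorem two_pi_ne : (2 * Real.pi) ≠ 0 := by positivity

/-- An almost everywhere statement may be rescaled by the factor `1 / (2π)`. -/
theorem ae_scale {p : ℝ → Prop} (h : ∀ᵐ ξ : ℝ, p ξ) : ∀ᵐ ξ : ℝ, p (ξ / (2 * Real.pi)) := by
  have := (quasi_scale (inv_ne_zero two_pi_ne)).ae h
  filter_upwards [this] with ξ hξ
  rwa [div_eq_inv_mul]

theorem memLp_scale {c : ℝ} (hc : c ≠ 0) {f : ℝ → ℂ} (hf : MemLp f 2 volume) :
    MemLp (fun ξ => f (c * ξ)) 2 volume := by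
  have h : MemLp f 2 (Measure.map (fun ξ : ℝ => c * ξ) volume) := by
    rw [Real.map_volume_mul_left hc]
    exact hf.smul_measure ENNReal.ofReal_ne_top
  exact h.comp_of_map (by fun_prop)

theorem hat_add (w z : Lp ℂ 2 (volume : Measure ℝ)) :
    hat (w + z) =ᵐ[volume] fun ξ => hat w ξ + hat z ξ := by
  have h : ∀ᵐ ξ : ℝ, (𝓕 (w + z) : Lp ℂ 2 (volume : Measure ℝ)) ξ
      = (𝓕 w : Lp ℂ 2 (volume : Measure ℝ)) ξ + (𝓕 z : Lp ℂ 2 (volume : Measure ℝ)) ξ := by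
    rw [FourierTransform.fourier_add]
    exact Lp.coeFn_add _ _
  exact ae_scale h

theorem hat_smul (c : ℂ) (w : Lp ℂ 2 (volume : Measure ℝ)) :
    hat (c • w) =ᵐ[volume] fun ξ => c * hat w ξ := by
  have h : ∀ᵐ ξ : ℝ, (𝓕 (c • w) : Lp ℂ 2 (volume : Measure ℝ)) ξ
      = c * (𝓕 w : Lp ℂ 2 (volume : Measure ℝ)) ξ := by
    rw [FourierTransform.fourier_smul]
    exact Lp.coeFn_smul _ _
  exact ae_scale h

theorem weightedHat_add (s : ℝ) (w z : Lp ℂ 2 (volume : Measure ℝ)) :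
    weightedHat s (w + z) =ᵐ[volume] weightedHat s w + weightedHat s z := by
  filter_upwards [hat_add w z] with ξ h
  simp only [weightedHat, h, Pi.add_apply]; ring

theorem weightedHat_smul (s : ℝ) (c : ℂ) (w : Lp ℂ 2 (volume : Measure ℝ)) :
    weightedHat s (c • w) =ᵐ[volume] c • weightedHat s w := by
  filter_upwards [hat_smul c w] with ξ h
  simp only [weightedHat, h, Pi.smul_apply, smul_eq_mul]; ring

/-- `H^s(ℝ)` (for `s ≥ 0`) as a subspace of `L²(ℝ; ℂ)`: all `w` with `⟨ξ⟩^s ŵ(ξ) ∈ L²`. -/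
def sobolevSubmodule (s : ℝ) : Submodule ℂ (Lp ℂ 2 (volume : Measure ℝ)) where
  carrier := {w | MemLp (weightedHat s w) 2 volume}
  add_mem' {w z} hw hz := (memLp_congr_ae (weightedHat_add s w z)).2 (hw.add hz)
  zero_mem' := by
    have h := weightedHat_smul s 0 0
    rw [zero_smul] at h
    refine (memLp_congr_ae h).2 ?_
    rw [zero_smul]
    exact MemLp.zero'
  smul_mem' c w hw := (memLp_congr_ae (weightedHat_smul s c w)).2 (MemLp.const_smul hw c)

/-- The Sobolev space `H^s(ℝ)`, `s ≥ 0`, of complex-valued functions. Its norm (below) is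
`‖w‖_{H^s} = ‖⟨ξ⟩^s ŵ(ξ)‖_{L²_ξ}`, not the norm of `L²`. -/
def Hs (s : ℝ) : Type := sobolevSubmodule s

instance (s : ℝ) : AddCommGroup (Hs s) := inferInstanceAs (AddCommGroup (sobolevSubmodule s))

instance (s : ℝ) : Module ℂ (Hs s) := inferInstanceAs (Module ℂ (sobolevSubmodule s))

/-- An element of `H^s` as an element of `L²`. -/
def Hs.toL2 {s : ℝ} (w : Hs s) : Lp ℂ 2 (volume : Measure ℝ) := Subtype.val w

theorem Hs.memLp {s : ℝ} (w : Hs s) : MemLp (weightedHat s w.toL2) 2 volume := Subtype.property w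

/-- The linear map `w ↦ ⟨ξ⟩^s ŵ(ξ)` from `H^s` to `L²`. -/
def toWeighted (s : ℝ) : Hs s →ₗ[ℂ] Lp ℂ 2 (volume : Measure ℝ) where
  toFun w := MemLp.toLp (weightedHat s w.toL2) w.memLp
  map_add' w z :=
    (MemLp.toLp_congr _ (w.memLp.add z.memLp) (weightedHat_add s w.toL2 z.toL2)).trans
      (MemLp.toLp_add w.memLp z.memLp)
  map_smul' c w :=
    (MemLp.toLp_congr _ (w.memLp.const_smul c) (weightedHat_smul s c w.toL2)).trans
      (MemLp.toLp_const_smul c w.memLp)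

theorem hat_injective {w z : Lp ℂ 2 (volume : Measure ℝ)} (h : hat w =ᵐ[volume] hat z) :
    w = z := by
  have h' : (𝓕 w : Lp ℂ 2 (volume : Measure ℝ)) = 𝓕 z := by
    refine Lp.ext ?_
    filter_upwards [(quasi_scale two_pi_ne).ae h] with ξ hξ
    simpa [hat, two_pi_ne] using hξ
  exact (Lp.fourierTransformₗᵢ ℝ ℂ).injective h'

theorem toWeighted_injective (s : ℝ) : Function.Injective (toWeighted s) := by
  intro w z h
  have h' : weightedHat s w.toL2 =ᵐ[volume] weightedHat s z.toL2 :=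
    (MemLp.toLp_eq_toLp_iff w.memLp z.memLp).1 h
  refine Subtype.ext (hat_injective ?_)
  filter_upwards [h'] with ξ hξ
  have hb : ((bracket ξ ^ s : ℝ) : ℂ) ≠ 0 :=
    Complex.ofReal_ne_zero.2 (Real.rpow_pos_of_pos (bracket_pos ξ) s).ne'
  exact mul_left_cancel₀ hb hξ

/-- `‖w‖_{H^s} = ‖⟨ξ⟩^s ŵ(ξ)‖_{L²_ξ}`. -/
instance (s : ℝ) : NormedAddCommGroup (Hs s) :=
  NormedAddCommGroup.induced (Hs s) (Lp ℂ 2 (volume : Measure ℝ)) (toWeighted s)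
    (toWeighted_injective s)

instance (s : ℝ) : NormedSpace ℂ (Hs s) :=
  NormedSpace.induced ℂ (Hs s) (Lp ℂ 2 (volume : Measure ℝ)) (toWeighted s)

theorem Hs.norm_eq {s : ℝ} (w : Hs s) :
    ‖w‖ = (eLpNorm (weightedHat s w.toL2) 2 volume).toReal :=
  Lp.norm_toLp (weightedHat s w.toL2) w.memLp

theorem toWeighted_surjective {s : ℝ} (hs : 0 ≤ s) : Function.Surjective (toWeighted s) := by
  intro g
  have h1 : MemLp (fun ξ => ((bracket ξ ^ (-s) : ℝ) : ℂ) * g ξ) 2 volume := by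
    refine MemLp.of_le (Lp.memLp g) ?_ (Filter.Eventually.of_forall fun ξ => ?_)
    · exact (Complex.continuous_ofReal.comp (continuous_bracket_rpow (-s))).aestronglyMeasurable.mul
        (Lp.aestronglyMeasurable g)
    · rw [norm_mul, Complex.norm_real, Real.norm_of_nonneg (Real.rpow_nonneg (bracket_pos ξ).le _)]
      exact mul_le_of_le_one_left (norm_nonneg _)
        (Real.rpow_le_one_of_one_le_of_nonpos (one_le_bracket ξ) (by linarith))
  have h2 := memLp_scale two_pi_ne h1
  have h3 : hat (𝓕⁻ (h2.toLp _)) =ᵐ[volume] fun ξ => ((bracket ξ ^ (-s) : ℝ) : ℂ) * g ξ := by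
    have := ae_scale h2.coeFn_toLp
    filter_upwards [this] with ξ hξ
    rw [hat, FourierTransform.fourier_fourierInv_eq, hξ, mul_div_cancel₀ _ two_pi_ne]
  have h4 : weightedHat s (𝓕⁻ (h2.toLp _)) =ᵐ[volume] g := by
    filter_upwards [h3] with ξ hξ
    rw [weightedHat, hξ, ← mul_assoc, ← Complex.ofReal_mul, ← Real.rpow_add (bracket_pos ξ)]
    simp
  let z : Hs s := ⟨𝓕⁻ (h2.toLp _), (memLp_congr_ae h4).2 (Lp.memLp g)⟩
  exact ⟨z, Lp.ext ((MemLp.coeFn_toLp z.memLp).trans h4)⟩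

/-- For `s ≥ 0` the space `H^s` is complete. -/
theorem Hs.completeSpace {s : ℝ} (hs : 0 ≤ s) : CompleteSpace (Hs s) := by
  have hi : Isometry (toWeighted s) :=
    AddMonoidHomClass.isometry_of_norm (toWeighted s) fun _ => rfl
  have hr : IsComplete (Set.range (toWeighted s)) := by
    rw [(toWeighted_surjective hs).range_eq]
    exact completeSpace_iff_isComplete_univ.1 inferInstance
  exact (completeSpace_iff_isComplete_range hi.isUniformInducing).2 hr

/-- `w` takes real values. -/
def Hs.IsReal {s : ℝ} (w : Hs s) : Prop := ∀ᵐ x : ℝ, (w.toL2 x).im = 0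

/-- `g` is (almost everywhere) the Fourier transform of an element of `H^s`. -/
def IsHsHat (s : ℝ) (g : ℝ → ℂ) : Prop := ∃ z : Hs s, hat z.toL2 =ᵐ[volume] g

open Classical in
/-- The element of `H^s` whose Fourier transform is `g`, if there is one (it is then unique). -/
def ofHat (s : ℝ) (g : ℝ → ℂ) : Hs s := if h : IsHsHat s g then h.choose else 0

/-! ### Ordered trees and index functions -/

/-- The modulation function `Φ(ξ, ξ₁, ξ₂)`. -/
def Phi (β ξ ξ₁ ξ₂ : ℝ) : ℝ := ξ₁ ^ 5 + ξ₂ ^ 5 - ξ ^ 5 + β * (ξ₁ ^ 3 + ξ₂ ^ 3 - ξ ^ 3)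

/-- Ordered binary trees with `k` non-terminal (and `k + 1` terminal) nodes, i.e. binary trees
together with the chronicle `T_1, …, T_k` of how they are grown. Starting from the one-node tree,
`(T, a) : OrderedTree (k + 1)` is the tree which grows from `T` when the `a`-th of its `k + 1`
terminal nodes is turned into a non-terminal one with two children. There are `k!` of them.

Terminal nodes are numbered by age: the left child takes over the number `a` of its parent, the
right child gets the new number `k + 1`, all other terminal nodes keep their numbers. -/
def OrderedTree : ℕ → Type
  | 0 => Unit
  | k + 1 => OrderedTree k × Fin (k + 1)

instance OrderedTree.fintype : (k : ℕ) → Fintype (OrderedTree k)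
  | 0 => inferInstanceAs (Fintype Unit)
  | k + 1 =>
    haveI := OrderedTree.fintype k
    inferInstanceAs (Fintype (OrderedTree k × Fin (k + 1)))

theorem OrderedTree.card (k : ℕ) : Fintype.card (OrderedTree k) = k.factorial := by
  induction k with
  | zero => rfl
  | succ k ih =>
    have : Fintype.card (OrderedTree (k + 1)) = Fintype.card (OrderedTree k) * (k + 1) := by
      rw [← Fintype.card_fin (k + 1), ← Fintype.card_prod, Fintype.card_fin]; rfl
    rw [this, ih, Nat.factorial_succ, mul_comm]

/-- The values at the terminal nodes of the index function on `T` that has the value `ξ` at the root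
and the value `η j` at the left child born at the `j`-th growth step (so that the right child has
the value of its parent minus `η j`). Such index functions are thus parametrised by `η ∈ ℝ^k`. -/
def leafFreq : (k : ℕ) → OrderedTree k → ℝ → (Fin k → ℝ) → Fin (k + 1) → ℝ
  | 0, _, ξ, _ => fun _ => ξ
  | k + 1, (T, a), ξ, η =>
    Fin.snoc (α := fun _ => ℝ)
      (Function.update (leafFreq k T ξ (Fin.init η)) a (η (Fin.last k)))
      (leafFreq k T ξ (Fin.init η) a - η (Fin.last k))

/-- The generations of frequencies `(ξ^{(j)}, ξ₁^{(j)}, ξ₂^{(j)})`, `1 ≤ j ≤ k`, of that index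
function: the values at the node which is turned into a non-terminal one at the `j`-th step, and
at its left and right child. The entry with index `i : Fin k` is the generation `j = i + 1`. -/
def genFreq : (k : ℕ) → OrderedTree k → ℝ → (Fin k → ℝ) → Fin k → ℝ × ℝ × ℝ
  | 0, _, _, _ => Fin.elim0
  | k + 1, (T, a), ξ, η =>
    Fin.snoc (α := fun _ => ℝ × ℝ × ℝ) (genFreq k T ξ (Fin.init η))
      (leafFreq k T ξ (Fin.init η) a, η (Fin.last k),
        leafFreq k T ξ (Fin.init η) a - η (Fin.last k))

/-- `μ̃_j = μ_1 + ⋯ + μ_j`, where `μ_i = Φ(ξ^{(i)}, ξ₁^{(i)}, ξ₂^{(i)})` and `1 ≤ j ≤ k`. -/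
def muTilde (β : ℝ) {k : ℕ} (T : OrderedTree k) (ξ : ℝ) (η : Fin k → ℝ) (j : ℕ) : ℝ :=
  ∑ i : Fin k, if (i : ℕ) < j then
    Phi β (genFreq k T ξ η i).1 (genFreq k T ξ η i).2.1 (genFreq k T ξ η i).2.2 else 0

/-- The conditions `C_0 = {|μ̃_1| > N}` and
`C_j = {|μ̃_{j+1}| ≤ (2j+3)^3 max(|μ̃_1|, |μ̃_j|)^{1-δ}}` for `j ≥ 1`. -/
def CondC (β δ N : ℝ) {k : ℕ} (T : OrderedTree k) (ξ : ℝ) (η : Fin k → ℝ) (j : ℕ) : Prop :=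
  if j = 0 then N < |muTilde β T ξ η 1|
  else |muTilde β T ξ η (j + 1)| ≤
    (2 * (j : ℝ) + 3) ^ 3 * (max |muTilde β T ξ η 1| |muTilde β T ξ η j|) ^ (1 - δ)

/-! ### The terms of the normal form equation -/

/-- The region of integration of `N_0^{(k+1)}` (a sum over trees with `k ≥ 1` non-terminal nodes):
`C_0 ∩ C_1^c ∩ ⋯ ∩ C_{k-1}^c`. -/
def region0 (β δ N : ℝ) {k : ℕ} (T : OrderedTree k) (ξ : ℝ) : Set (Fin k → ℝ) :=
  {η | CondC β δ N T ξ η 0 ∧ ∀ j, 1 ≤ j → j + 1 ≤ k → ¬ CondC β δ N T ξ η j}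

/-- The region of integration of `N_1^{(k)}` (a sum over trees with `k ≥ 1` non-terminal nodes):
`C_0^c` for `k = 1`, and `C_0 ∩ C_1^c ∩ ⋯ ∩ C_{k-2}^c ∩ C_{k-1}` for `k ≥ 2`. -/
def region1 (β δ N : ℝ) {k : ℕ} (T : OrderedTree k) (ξ : ℝ) : Set (Fin k → ℝ) :=
  if k = 1 then {η | ¬ CondC β δ N T ξ η 0}
  else {η | CondC β δ N T ξ η 0 ∧ (∀ j, 1 ≤ j → j + 2 ≤ k → ¬ CondC β δ N T ξ η j) ∧
    CondC β δ N T ξ η (k - 1)}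

/-- The integrand without cutoff in which the first `m` phases have been divided out,
`∏_{j=1}^k iξ^{(j)} · e^{iτμ̃_k} / ∏_{j=1}^m iμ̃_j · ∏_a ŵ(ξ_a)`,
the last product being over the terminal nodes `a`. -/
def treeIntegrand (β : ℝ) (m : ℕ) (τ : ℝ) (w : Lp ℂ 2 (volume : Measure ℝ)) {k : ℕ}
    (T : OrderedTree k) (ξ : ℝ) (η : Fin k → ℝ) : ℂ :=
  (∏ j : Fin k, Complex.I * ((genFreq k T ξ η j).1 : ℂ)) *
    (Complex.exp (Complex.I * (τ : ℂ) * (muTilde β T ξ η k : ℂ)) /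
      ∏ j ∈ Finset.Icc 1 m, Complex.I * (muTilde β T ξ η j : ℂ)) *
    ∏ a : Fin (k + 1), hat w (leafFreq k T ξ η a)

/-- The integrand (over `η ∈ ℝ^k`) of the tree `T` in the formula for `N_0^{(k+1)}(w)` at time `τ`
and frequency `ξ`. -/
def integrand0 (β δ N τ : ℝ) (w : Lp ℂ 2 (volume : Measure ℝ)) {k : ℕ} (T : OrderedTree k)
    (ξ : ℝ) : (Fin k → ℝ) → ℂ :=
  (region0 β δ N T ξ).indicator (treeIntegrand β k τ w T ξ)

/-- The integrand (over `η ∈ ℝ^k`) of the tree `T` in the formula for `N_1^{(k)}(w)` at time `τ`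
and frequency `ξ`. -/
def integrand1 (β δ N τ : ℝ) (w : Lp ℂ 2 (volume : Measure ℝ)) {k : ℕ} (T : OrderedTree k)
    (ξ : ℝ) : (Fin k → ℝ) → ℂ :=
  (region1 β δ N T ξ).indicator (treeIntegrand β (k - 1) τ w T ξ)

/-- The Fourier transform of `N_0^{(k)}(w)` at time `τ`, for `k ≥ 2`. -/
def N0hat (β δ N : ℝ) (k : ℕ) (τ : ℝ) (w : Lp ℂ 2 (volume : Measure ℝ)) (ξ : ℝ) : ℂ :=
  -∑ T : OrderedTree (k - 1), ∫ η, integrand0 β δ N τ w T ξ η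

/-- The Fourier transform of `N_1^{(k)}(w)` at time `τ`, for `k ≥ 1`. -/
def N1hat (β δ N : ℝ) (k : ℕ) (τ : ℝ) (w : Lp ℂ 2 (volume : Measure ℝ)) (ξ : ℝ) : ℂ :=
  -∑ T : OrderedTree k, ∫ η, integrand1 β δ N τ w T ξ η

/-- `N_0^{(k)}(w)` at time `τ` as an element of `H^s`, for `k ≥ 2`. -/
def N0 {s : ℝ} (β δ N : ℝ) (k : ℕ) (τ : ℝ) (w : Hs s) : Hs s :=
  ofHat s (N0hat β δ N k τ w.toL2)

/-- `N_1^{(k)}(w)` at time `τ` as an element of `H^s`, for `k ≥ 1`. -/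
def N1 {s : ℝ} (β δ N : ℝ) (k : ℕ) (τ : ℝ) (w : Hs s) : Hs s :=
  ofHat s (N1hat β δ N k τ w.toL2)

/-- `N_0^{(k)}(w)` is well defined in `H^s` at time `τ`: the integrals in its formula converge
absolutely for almost every `ξ` and give the Fourier transform of an element of `H^s`. -/
def N0WellDefined {s : ℝ} (β δ N : ℝ) (k : ℕ) (τ : ℝ) (w : Hs s) : Prop :=
  (∀ T : OrderedTree (k - 1), ∀ᵐ ξ : ℝ, Integrable (integrand0 β δ N τ w.toL2 T ξ)) ∧
    IsHsHat s (N0hat β δ N k τ w.toL2)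

/-- `N_1^{(k)}(w)` is well defined in `H^s` at time `τ`. -/
def N1WellDefined {s : ℝ} (β δ N : ℝ) (k : ℕ) (τ : ℝ) (w : Hs s) : Prop :=
  (∀ T : OrderedTree k, ∀ᵐ ξ : ℝ, Integrable (integrand1 β δ N τ w.toL2 T ξ)) ∧
    IsHsHat s (N1hat β δ N k τ w.toL2)

/-- `v : [-T, T] → H^s` solves the normal form equation
`v(t) = u₀ + ∑_{k ≥ 2} N_0^{(k)}(v(τ))|_{τ=0}^{τ=t} + ∫_0^t ∑_{k ≥ 1} N_1^{(k)}(v(τ)) dτ`,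
all of whose terms make sense: each `N_0^{(k)}(v(t))` and `N_1^{(k)}(v(t))` is well defined, the
two series converge in `H^s` at each time, and the time integral is a Bochner integral in `H^s`.
Values of `v` outside `[-T, T]` play no role. -/
structure SolvesNFE {s : ℝ} (β δ N T : ℝ) (u₀ : Hs s) (v : ℝ → Hs s) : Prop where
  wellDefined0 : ∀ k ≥ 2, ∀ t ∈ Set.Icc (-T) T, N0WellDefined β δ N k t (v t)
  wellDefined1 : ∀ k ≥ 1, ∀ t ∈ Set.Icc (-T) T, N1WellDefined β δ N k t (v t)
  summable0 : ∀ t ∈ Set.Icc (-T) T, Summable fun k : ℕ => N0 β δ N (k + 2) t (v t)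
  summable1 : ∀ t ∈ Set.Icc (-T) T, Summable fun k : ℕ => N1 β δ N (k + 1) t (v t)
  integrable : ∀ t ∈ Set.Icc (-T) T,
    IntervalIntegrable (fun τ => ∑' k : ℕ, N1 β δ N (k + 1) τ (v τ)) volume 0 t
  equation : ∀ t ∈ Set.Icc (-T) T,
    v t = u₀ + ∑' k : ℕ, (N0 β δ N (k + 2) t (v t) - N0 β δ N (k + 2) 0 (v 0))
      + ∫ τ in (0 : ℝ)..t, ∑' k : ℕ, N1 β δ N (k + 1) τ (v τ)

/-- The space `X = C([-T, T]; H^s)` with the norm `sup_{|t| ≤ T} ‖v(t)‖_{H^s}`. -/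
abbrev SolutionSpace (s T : ℝ) : Type := C(Set.Icc (-T) T, Hs s)

end Kawahara

end

/-!
On the Fourier side, every term of the normal form equation is a sum over ordered trees of integrals
`∫ κ(ξ, η) G(ξ, η) dη`, where `κ` is the kernel of the tree (cutoff, derivatives and divided phases)
and `G` is the product of the values `ŵ(ξ_a)` at the terminal nodes, with an oscillating factor of
absolute value one. By the Cauchy–Schwarz inequality in `η`, such an operator is bounded on `L²` by
`sup_ξ (∫ |κ(ξ, η)|² dη)^{1/2}` times the `L²` norm of `G` in all variables
(`eLpNorm_integral_kernel_mul_le`). The latter norm is the product of the norms of the factors,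
because the terminal frequencies are unimodular coordinates (`lintegral_prod_leafFreq`), and the
weight `⟨ξ⟩^s` distributes over the terminal nodes (`bracket_rpow_le_prod`). Everything thus reduces to
pointwise bounds for `∫ |κ|² dη`, which are proved one generation at a time.

The estimate for one generation is `exists_sublevel_bound`:
`ξ² |{x : |α + Φ(ξ, x, ξ - x)| ≤ K}| ≲ (|α| + K)^{3/8} K^{1/4}`, uniformly in `ξ`. With
`x = ξ/2 + y` the phase is a quadratic polynomial in `y²`, and only near its stationary point `y = 0`
is its sublevel set too long; but there `|Φ|` is comparable to `|ξ|⁵`, so that `α`, the sum `μ̃` of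
the phases of the earlier generations, has to be of the same size, and a small power of `|α|` pays for
the loss. A dyadic decomposition (`exists_tail_bound`) turns this into the bound of
`∫ ξ² |α + Φ|^{-11/8}` over `|α + Φ| > M` by `|α|^{3/8} M^{-3/4}`. Hence
`∫ |κ|² |μ̃_1|^{5/8} |μ̃_k|^{5/8} dη` can be bounded by induction on the number `k` of generations:
the weight `|μ̃_k|^{5/8}` is reproduced, and the lower bound `M ≥ (2k+3)³ N^{1-δ}` provided by the
cutoff yields the factor `(k+1)^{-2}` and a negative power of `N`. The accumulated factor `1/(k!)²`
compensates for the number `k!` of trees (`exists_kernel_bound`), and the powers of `N` make both series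
geometric with a small ratio (`exists_termBounds`). The last generation of `N_1`, where the phase is
bounded from above instead, costs exactly the two weights.

Consequently, on the ball of radius `2r` in `H^s`, the boundary terms are Lipschitz with constant `1/8`
and the integrated terms with some constant, so that a contraction argument gives a solution if `T` is
small (`exists_isMildSolution`). Every solution in `C([-T, T]; H^s)` starts at `u₀` and, as long as it
stays in the ball of radius `2r`, in fact stays in the ball of radius `7r/4`; by continuity it never
leaves (`IsMildSolution.norm_le`), which gives uniqueness without any smallness assumption. Finally,
complex conjugation is an isometry of `H^s` that commutes with all terms of the equation
(`treeSum_conjL2`), so by uniqueness a solution with real datum is real.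
-/

noncomputable section

namespace Kawahara

/-! ### Sublevel sets of the modulation function -/

theorem sqrt_sub_sqrt_le (p q : ℝ) : √q - √p ≤ √(q - p) := by
  rcases le_total q p with h | h
  · have := Real.sqrt_le_sqrt h
    have := Real.sqrt_nonneg (q - p)
    linarith
  rcases le_total p 0 with hp | hp
  · have := Real.sqrt_le_sqrt (show q ≤ q - p by linarith)
    rw [Real.sqrt_eq_zero_of_nonpos hp]; linarith
  · rw [sub_le_iff_le_add]
    refine Real.sqrt_le_iff.2 ⟨by positivity, ?_⟩
    nlinarith [Real.sq_sqrt hp, Real.sq_sqrt (sub_nonneg.2 h), Real.sqrt_nonneg p,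
      Real.sqrt_nonneg (q - p), mul_nonneg (Real.sqrt_nonneg p) (Real.sqrt_nonneg (q - p))]

theorem volume_sq_mem_Icc_le (p q : ℝ) :
    volume {y : ℝ | p ≤ y ^ 2 ∧ y ^ 2 ≤ q} ≤ ENNReal.ofReal (2 * √(q - p)) := by
  have hsub : {y : ℝ | p ≤ y ^ 2 ∧ y ^ 2 ≤ q} ⊆ Set.Icc (√p) (√q) ∪ Set.Icc (-√q) (-√p) := by
    rintro y ⟨h1, h2⟩
    have h3 := Real.sqrt_le_sqrt h1
    have h4 := Real.sqrt_le_sqrt h2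
    rw [Real.sqrt_sq_eq_abs] at h3 h4
    rcases abs_cases y with ⟨hy, -⟩ | ⟨hy, -⟩
    · left; constructor <;> linarith
    · right; constructor <;> linarith
  have hpq := sqrt_sub_sqrt_le p q
  calc volume {y : ℝ | p ≤ y ^ 2 ∧ y ^ 2 ≤ q}
      ≤ volume (Set.Icc (√p) (√q)) + volume (Set.Icc (-√q) (-√p)) :=
        (measure_mono hsub).trans (measure_union_le _ _)
    _ = ENNReal.ofReal (√q - √p) + ENNReal.ofReal (√q - √p) := by
        rw [Real.volume_Icc, Real.volume_Icc]; congr 2; ring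
    _ ≤ ENNReal.ofReal (√(q - p)) + ENNReal.ofReal (√(q - p)) := by gcongr
    _ = ENNReal.ofReal (2 * √(q - p)) := by
        rw [← ENNReal.ofReal_add (by positivity) (by positivity)]; congr 1; ring

/-- Completing the square twice: sublevel sets of a monic biquadratic polynomial. -/
theorem volume_biquadratic_le (b c κ : ℝ) :
    volume {y : ℝ | |(y ^ 2) ^ 2 + b * y ^ 2 + c| ≤ κ} ≤ ENNReal.ofReal (4 * √(√(2 * κ))) := by
  set d := b ^ 2 / 4 - c with hd
  have hsub : {y : ℝ | |(y ^ 2) ^ 2 + b * y ^ 2 + c| ≤ κ} ⊆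
      {y : ℝ | √(d - κ) - b / 2 ≤ y ^ 2 ∧ y ^ 2 ≤ √(d + κ) - b / 2} ∪
      {y : ℝ | -√(d + κ) - b / 2 ≤ y ^ 2 ∧ y ^ 2 ≤ -√(d - κ) - b / 2} := by
    intro y hy
    have hy' := abs_le.1 (Set.mem_ofPred_eq ▸ hy)
    have h3 := Real.sqrt_le_sqrt (show d - κ ≤ (y ^ 2 + b / 2) ^ 2 by nlinarith [hy'.1])
    have h4 := Real.sqrt_le_sqrt (show (y ^ 2 + b / 2) ^ 2 ≤ d + κ by nlinarith [hy'.2])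
    rw [Real.sqrt_sq_eq_abs] at h3 h4
    rcases abs_cases (y ^ 2 + b / 2) with ⟨h, -⟩ | ⟨h, -⟩
    · left; constructor <;> linarith
    · right; constructor <;> linarith
  have hdiff : √(d + κ) - √(d - κ) ≤ √(2 * κ) := by
    refine (sqrt_sub_sqrt_le _ _).trans (le_of_eq ?_)
    congr 1; ring
  have h1 := volume_sq_mem_Icc_le (√(d - κ) - b / 2) (√(d + κ) - b / 2)
  have h2 := volume_sq_mem_Icc_le (-√(d + κ) - b / 2) (-√(d - κ) - b / 2)
  refine (measure_mono hsub).trans ((measure_union_le _ _).trans ((add_le_add h1 h2).trans ?_))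
  rw [← ENNReal.ofReal_add (by positivity) (by positivity)]
  refine ENNReal.ofReal_le_ofReal ?_
  have h3 : √(√(d + κ) - b / 2 - (√(d - κ) - b / 2)) ≤ √(√(2 * κ)) :=
    Real.sqrt_le_sqrt (by linarith)
  have h4 : √(-√(d - κ) - b / 2 - (-√(d + κ) - b / 2)) ≤ √(√(2 * κ)) :=
    Real.sqrt_le_sqrt (by linarith)
  linarith

theorem Phi_eq (β ξ y : ℝ) : Phi β ξ (ξ / 2 + y) (ξ - (ξ / 2 + y)) =
    5 * ξ * (y ^ 2 - ξ ^ 2 / 4) * (y ^ 2 + 3 * ξ ^ 2 / 4 + 3 * β / 5) := by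
  unfold Phi; ring

theorem sqrt_sqrt_eq_rpow {x : ℝ} (hx : 0 ≤ x) : √(√x) = x ^ (1 / 4 : ℝ) := by
  rw [Real.sqrt_eq_rpow, Real.sqrt_eq_rpow, ← Real.rpow_mul hx]; norm_num

/-- Away from the stationary point `y = 0` and at high frequency, the phase has derivative of size
`ξ⁴`, so its sublevel sets are short. -/
theorem volume_sublevel_le_of_far {β ξ α K : ℝ} (h1 : 1 + 2 * |β| ≤ |ξ|)
    (h2 : 4 * (|α| + K) ≤ |ξ| ^ 5) :
    volume {y : ℝ | |α + Phi β ξ (ξ / 2 + y) (ξ - (ξ / 2 + y))| ≤ K} ≤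
      ENNReal.ofReal (4 * K / ξ ^ 4) := by
  have hβ := abs_nonneg β
  have hξ1 : 1 ≤ |ξ| := by linarith
  have hξ0 : 0 < |ξ| := by linarith
  have hsq : |ξ| ^ 2 = ξ ^ 2 := sq_abs ξ
  have hbig : 4 * |β| ≤ ξ ^ 2 := by rw [← hsq]; nlinarith
  have hβ1 := neg_abs_le β
  -- The phase is at most `|ξ|⁵ / 4` on the sublevel set, so the factor `y² - ξ² / 4` is at most `ξ² / 10`.
  have hz : ∀ y : ℝ, |α + Phi β ξ (ξ / 2 + y) (ξ - (ξ / 2 + y))| ≤ K → |ξ| / 3 ≤ |y| := by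
    intro y hy
    have hP : |Phi β ξ (ξ / 2 + y) (ξ - (ξ / 2 + y))| ≤ |ξ| ^ 5 / 4 := by
      have := abs_sub_abs_le_abs_sub (Phi β ξ (ξ / 2 + y) (ξ - (ξ / 2 + y))) (-α)
      rw [abs_neg, sub_neg_eq_add, add_comm _ α] at this
      linarith
    rw [Phi_eq, abs_mul, abs_mul, abs_mul, abs_of_pos (show (0 : ℝ) < 5 by norm_num),
      abs_of_nonneg (show 0 ≤ y ^ 2 + 3 * ξ ^ 2 / 4 + 3 * β / 5 by nlinarith [sq_nonneg y])] at hP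
    have hfac : |ξ| ^ 2 / 2 ≤ y ^ 2 + 3 * ξ ^ 2 / 4 + 3 * β / 5 := by
      rw [hsq]; nlinarith [sq_nonneg y]
    have h5 : 5 * |ξ| * |y ^ 2 - ξ ^ 2 / 4| * (|ξ| ^ 2 / 2) ≤ |ξ| ^ 5 / 4 :=
      (mul_le_mul_of_nonneg_left hfac (by positivity)).trans hP
    have h6 : |y ^ 2 - ξ ^ 2 / 4| ≤ |ξ| ^ 2 / 10 := by
      have h7 : |ξ| ^ 3 * |y ^ 2 - ξ ^ 2 / 4| ≤ |ξ| ^ 3 * (|ξ| ^ 2 / 10) := by nlinarith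
      exact le_of_mul_le_mul_left h7 (by positivity)
    have h8 := (abs_le.1 h6).1
    refine abs_le_of_sq_le_sq' ?_ (abs_nonneg y) |>.2
    rw [div_pow, sq_abs y]; nlinarith
  -- The phase is even in `y`. For `y₁`, `y₂` of equal sign, the factor `y₁ + y₂` of the difference of its
  -- values has size at least `|ξ|`, up to a constant.
  have hdist : ∀ y₁ y₂ : ℝ, |α + Phi β ξ (ξ / 2 + y₁) (ξ - (ξ / 2 + y₁))| ≤ K →
      |α + Phi β ξ (ξ / 2 + y₂) (ξ - (ξ / 2 + y₂))| ≤ K → 0 ≤ y₁ * y₂ →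
      |y₁ - y₂| ≤ 2 * K / ξ ^ 4 := by
    intro y₁ y₂ k1 k2 hs
    have m1 := hz _ k1
    have m2 := hz _ k2
    have hsum : 2 * |ξ| / 3 ≤ |y₁ + y₂| := by
      have : |y₁ + y₂| = |y₁| + |y₂| := by
        rw [abs_add_eq_add_abs_iff]
        rcases le_total 0 y₁ with a | a <;> rcases le_total 0 y₂ with b | b
        · exact Or.inl ⟨a, b⟩
        · have : y₁ * y₂ = 0 := le_antisymm (mul_nonpos_of_nonneg_of_nonpos a b) hs
          rcases mul_eq_zero.1 this with h | h
          · rw [h, abs_zero] at m1; linarith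
          · rw [h, abs_zero] at m2; linarith
        · have : y₁ * y₂ = 0 := le_antisymm (mul_nonpos_of_nonpos_of_nonneg a b) hs
          rcases mul_eq_zero.1 this with h | h
          · rw [h, abs_zero] at m1; linarith
          · rw [h, abs_zero] at m2; linarith
        · exact Or.inr ⟨a, b⟩
      rw [this]; linarith
    have hd := (abs_sub _ _).trans (add_le_add k1 k2)
    rw [Phi_eq, Phi_eq, show (α + 5 * ξ * (y₁ ^ 2 - ξ ^ 2 / 4) *
        (y₁ ^ 2 + 3 * ξ ^ 2 / 4 + 3 * β / 5)) - (α + 5 * ξ * (y₂ ^ 2 - ξ ^ 2 / 4) *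
        (y₂ ^ 2 + 3 * ξ ^ 2 / 4 + 3 * β / 5)) = 5 * ξ * (y₁ - y₂) * (y₁ + y₂) *
        (y₁ ^ 2 + y₂ ^ 2 + ξ ^ 2 / 2 + 3 * β / 5) by ring, abs_mul, abs_mul, abs_mul, abs_mul,
      abs_of_pos (show (0 : ℝ) < 5 by norm_num),
      abs_of_nonneg (show 0 ≤ y₁ ^ 2 + y₂ ^ 2 + ξ ^ 2 / 2 + 3 * β / 5 by
        nlinarith [sq_nonneg y₁, sq_nonneg y₂])] at hd
    have hfac : |ξ| ^ 2 / 2 ≤ y₁ ^ 2 + y₂ ^ 2 + ξ ^ 2 / 2 + 3 * β / 5 := by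
      have e1 : (|ξ| / 3) ^ 2 ≤ y₁ ^ 2 := by rw [← sq_abs y₁]; gcongr
      have e2 : (|ξ| / 3) ^ 2 ≤ y₂ ^ 2 := by rw [← sq_abs y₂]; gcongr
      nlinarith
    have hd' : 5 * |ξ| * |y₁ - y₂| * (2 * |ξ| / 3) * (|ξ| ^ 2 / 2) ≤ K + K :=
      le_trans (by gcongr) hd
    have h4 : |ξ| ^ 4 = ξ ^ 4 := by rw [show (4 : ℕ) = 2 * 2 by norm_num, pow_mul, pow_mul, hsq]
    have hpos : 0 < ξ ^ 4 := by rw [← h4]; positivity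
    rw [le_div_iff₀ hpos, ← h4]
    nlinarith [mul_nonneg (abs_nonneg (y₁ - y₂)) (pow_nonneg hξ0.le 4)]
  set S := {y : ℝ | |α + Phi β ξ (ξ / 2 + y) (ξ - (ξ / 2 + y))| ≤ K} with hS
  have hhalf : ∀ H : Set ℝ, (∀ y₁ ∈ H, ∀ y₂ ∈ H, 0 ≤ y₁ * y₂) →
      volume (S ∩ H) ≤ ENNReal.ofReal (2 * K / ξ ^ 4) := by
    intro H hH
    refine (Real.volume_le_diam _).trans (Metric.ediam_le fun x hx y hy => ?_)
    rw [edist_dist, Real.dist_eq]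
    exact ENNReal.ofReal_le_ofReal (hdist x y hx.1 hy.1 (hH x hx.2 y hy.2))
  rcases lt_or_ge K 0 with hK | hK
  · have : S = ∅ := Set.eq_empty_of_forall_notMem fun y hy =>
      absurd ((abs_nonneg _).trans hy) (not_le.2 hK)
    rw [this]; simp
  calc volume S ≤ volume (S ∩ Set.Ici 0) + volume (S ∩ Set.Iic 0) := by
        refine (measure_mono ?_).trans (measure_union_le _ _)
        intro y hy
        rcases le_total 0 y with h | h
        · exact Or.inl ⟨hy, h⟩
        · exact Or.inr ⟨hy, h⟩
    _ ≤ ENNReal.ofReal (2 * K / ξ ^ 4) + ENNReal.ofReal (2 * K / ξ ^ 4) :=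
        add_le_add (hhalf _ fun _ a _ b => mul_nonneg a b)
          (hhalf _ fun _ a _ b => mul_nonneg_of_nonpos_of_nonpos a b)
    _ = ENNReal.ofReal (4 * K / ξ ^ 4) := by
        rw [← ENNReal.ofReal_add (by positivity) (by positivity)]; congr 1; ring

/-- At any nonzero frequency the phase is `5ξ` times a monic quartic polynomial, which gives the
exponent `1/4`. -/
theorem volume_sublevel_le (β α K : ℝ) {ξ : ℝ} (hξ : ξ ≠ 0) (hK : 0 ≤ K) :
    volume {y : ℝ | |α + Phi β ξ (ξ / 2 + y) (ξ - (ξ / 2 + y))| ≤ K} ≤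
      ENNReal.ofReal (4 * (K / |ξ|) ^ (1 / 4 : ℝ)) := by
  have hξ0 : 0 < |ξ| := abs_pos.2 hξ
  set b := ξ ^ 2 / 2 + 3 * β / 5
  set c := α / (5 * ξ) - ξ ^ 2 / 4 * (3 * ξ ^ 2 / 4 + 3 * β / 5)
  have hset : {y : ℝ | |α + Phi β ξ (ξ / 2 + y) (ξ - (ξ / 2 + y))| ≤ K} =
      {y : ℝ | |(y ^ 2) ^ 2 + b * y ^ 2 + c| ≤ K / (5 * |ξ|)} := by
    ext y
    have : α + Phi β ξ (ξ / 2 + y) (ξ - (ξ / 2 + y)) =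
        5 * ξ * ((y ^ 2) ^ 2 + b * y ^ 2 + c) := by
      rw [Phi_eq]; simp only [b, c]; field_simp; ring
    simp only [Set.mem_ofPred_eq]
    rw [this, abs_mul, abs_mul, abs_of_pos (show (0 : ℝ) < 5 by norm_num),
      le_div_iff₀ (by positivity), mul_comm]
  rw [hset]
  refine (volume_biquadratic_le b c _).trans (ENNReal.ofReal_le_ofReal ?_)
  rw [sqrt_sqrt_eq_rpow (by positivity)]
  gcongr ?_ * ?_ ^ _
  rw [mul_div_assoc', div_le_div_iff₀ (by positivity) hξ0]
  nlinarith [mul_nonneg hK hξ0.le]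

/-- The sublevel estimate. The factor `(|α| + K)^{3/8}` accounts for the stationary point
`ξ₁ = ξ₂ = ξ / 2`, near which `α + Φ` can only be small if `|α|` is comparable to `|ξ|⁵`. -/
theorem exists_sublevel_bound (β : ℝ) : ∃ C : ℝ, 1 ≤ C ∧ ∀ ξ α K : ℝ, 1 ≤ K →
    ENNReal.ofReal (ξ ^ 2) * volume {x : ℝ | |α + Phi β ξ x (ξ - x)| ≤ K} ≤
      ENNReal.ofReal (C * ((|α| + K) ^ (3 / 8 : ℝ) * K ^ (1 / 4 : ℝ))) := by
  set X := 1 + 2 * |β| with hX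
  have hX1 : 1 ≤ X := by have := abs_nonneg β; linarith
  refine ⟨16 * X ^ 2, by nlinarith, fun ξ α K hK => ?_⟩
  have hK0 : 0 < K := by linarith
  have hA : 1 ≤ |α| + K := by have := abs_nonneg α; linarith
  rcases eq_or_ne ξ 0 with rfl | hξ
  · simp
  have hξ0 : 0 < |ξ| := abs_pos.2 hξ
  have hvol : volume {x : ℝ | |α + Phi β ξ x (ξ - x)| ≤ K} =
      volume {y : ℝ | |α + Phi β ξ (ξ / 2 + y) (ξ - (ξ / 2 + y))| ≤ K} :=
    (measure_preimage_add volume (ξ / 2) {x : ℝ | |α + Phi β ξ x (ξ - x)| ≤ K}).symm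
  rw [hvol]
  -- This bound is good enough unless `|ξ|⁵` is much larger than `|α| + K`.
  have hgen : ENNReal.ofReal (ξ ^ 2) *
      volume {y : ℝ | |α + Phi β ξ (ξ / 2 + y) (ξ - (ξ / 2 + y))| ≤ K} ≤
      ENNReal.ofReal (4 * |ξ| ^ (7 / 4 : ℝ) * K ^ (1 / 4 : ℝ)) := by
    refine (mul_le_mul_right (volume_sublevel_le β α K hξ hK0.le) _).trans ?_
    rw [← ENNReal.ofReal_mul (by positivity)]
    refine ENNReal.ofReal_le_ofReal (le_of_eq ?_)
    have : |ξ| ^ (7 / 4 : ℝ) * |ξ| ^ (1 / 4 : ℝ) = ξ ^ 2 := by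
      rw [← Real.rpow_add hξ0, ← sq_abs]; norm_num
    rw [Real.div_rpow hK0.le hξ0.le, ← this]
    field_simp
  have hA38 : 1 ≤ (|α| + K) ^ (3 / 8 : ℝ) := Real.one_le_rpow hA (by norm_num)
  -- Low frequencies: the power of `|ξ|` is bounded.
  rcases lt_or_ge |ξ| X with h1 | h1
  · refine hgen.trans (ENNReal.ofReal_le_ofReal ?_)
    have h2 : |ξ| ^ (7 / 4 : ℝ) ≤ X ^ 2 := by
      calc |ξ| ^ (7 / 4 : ℝ) ≤ X ^ (7 / 4 : ℝ) := by gcongr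
        _ ≤ X ^ (2 : ℝ) := Real.rpow_le_rpow_of_exponent_le hX1 (by norm_num)
        _ = X ^ 2 := by norm_num
    calc 4 * |ξ| ^ (7 / 4 : ℝ) * K ^ (1 / 4 : ℝ) ≤ 16 * X ^ 2 * (1 * K ^ (1 / 4 : ℝ)) := by
          rw [one_mul]; gcongr; nlinarith
      _ ≤ _ := by gcongr
  have hξ1 : 1 ≤ |ξ| := hX1.trans h1
  -- If `|ξ|⁵` dominates, the sublevel set avoids the stationary point; otherwise `|ξ|^{7/4}` is paid for
  -- by `(|α| + K)^{3/8}`, since `7/4 ≤ 5 · 3/8`.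
  rcases le_or_gt (4 * (|α| + K)) (|ξ| ^ 5) with h2 | h2
  · refine (mul_le_mul_right (volume_sublevel_le_of_far h1 h2) _).trans ?_
    rw [← ENNReal.ofReal_mul (by positivity)]
    refine ENNReal.ofReal_le_ofReal ?_
    have e1 : K ^ (3 / 8 : ℝ) * K ^ (3 / 8 : ℝ) * K ^ (1 / 4 : ℝ) = K := by
      rw [← Real.rpow_add hK0, ← Real.rpow_add hK0]; norm_num
    have e2 : K ^ (3 / 8 : ℝ) ≤ ξ ^ 2 := by
      calc K ^ (3 / 8 : ℝ) ≤ (|ξ| ^ 5) ^ (3 / 8 : ℝ) := by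
            gcongr; have := abs_nonneg α; linarith
        _ = |ξ| ^ (15 / 8 : ℝ) := by
            rw [← Real.rpow_natCast, ← Real.rpow_mul hξ0.le]; norm_num
        _ ≤ |ξ| ^ (2 : ℝ) := Real.rpow_le_rpow_of_exponent_le hξ1 (by norm_num)
        _ = ξ ^ 2 := by rw [← sq_abs]; norm_num
    have e3 : K ^ (3 / 8 : ℝ) ≤ (|α| + K) ^ (3 / 8 : ℝ) := by
      gcongr; have := abs_nonneg α; linarith
    have hξ2 : 0 < ξ ^ 2 := by positivity
    calc ξ ^ 2 * (4 * K / ξ ^ 4) = 4 / ξ ^ 2 * K := by field_simp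
      _ = 4 / ξ ^ 2 * (K ^ (3 / 8 : ℝ) * K ^ (3 / 8 : ℝ) * K ^ (1 / 4 : ℝ)) := by rw [e1]
      _ ≤ 4 / ξ ^ 2 * (ξ ^ 2 * (|α| + K) ^ (3 / 8 : ℝ) * K ^ (1 / 4 : ℝ)) := by gcongr
      _ = 4 * ((|α| + K) ^ (3 / 8 : ℝ) * K ^ (1 / 4 : ℝ)) := by field_simp
      _ ≤ _ := by gcongr; nlinarith
  · refine hgen.trans (ENNReal.ofReal_le_ofReal ?_)
    have h3 : |ξ| ^ (7 / 4 : ℝ) ≤ 4 * (|α| + K) ^ (3 / 8 : ℝ) := by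
      calc |ξ| ^ (7 / 4 : ℝ) ≤ |ξ| ^ (15 / 8 : ℝ) :=
            Real.rpow_le_rpow_of_exponent_le hξ1 (by norm_num)
        _ = (|ξ| ^ 5) ^ (3 / 8 : ℝ) := by
            rw [← Real.rpow_natCast, ← Real.rpow_mul hξ0.le]; norm_num
        _ ≤ (4 * (|α| + K)) ^ (3 / 8 : ℝ) := by gcongr
        _ = 4 ^ (3 / 8 : ℝ) * (|α| + K) ^ (3 / 8 : ℝ) :=
            Real.mul_rpow (by norm_num) (by linarith)
        _ ≤ 4 ^ (1 : ℝ) * (|α| + K) ^ (3 / 8 : ℝ) := by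
            gcongr <;> norm_num
        _ = _ := by norm_num
    calc 4 * |ξ| ^ (7 / 4 : ℝ) * K ^ (1 / 4 : ℝ)
        ≤ 4 * (4 * (|α| + K) ^ (3 / 8 : ℝ)) * K ^ (1 / 4 : ℝ) := by gcongr
      _ = 16 * 1 * ((|α| + K) ^ (3 / 8 : ℝ) * K ^ (1 / 4 : ℝ)) := by ring
      _ ≤ _ := by gcongr; nlinarith

/-- Dyadic decomposition over the size of `F = α + Φ`: the negative power `|F|^{-p}` is integrable
where `|F| > M`, with the weight `ξ²` and uniformly in `ξ`. -/
theorem exists_tail_bound (β : ℝ) {p : ℝ} (hp : 5 / 8 < p) : ∃ C : ℝ, 1 ≤ C ∧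
    ∀ ξ α A M : ℝ, 1 ≤ A → |α| ≤ A → 1 ≤ M →
      ENNReal.ofReal (ξ ^ 2) * ∫⁻ x, {x | M < |α + Phi β ξ x (ξ - x)|}.indicator
        (fun x => ENNReal.ofReal (|α + Phi β ξ x (ξ - x)| ^ (-p))) x ≤
      ENNReal.ofReal (C * (A ^ (3 / 8 : ℝ) * M ^ (5 / 8 - p))) := by
  obtain ⟨C, hC1, hC⟩ := exists_sublevel_bound β
  set q : ℝ := 2 ^ (5 / 8 - p) with hq
  have hq0 : 0 < q := by positivity
  have hq1 : q < 1 := Real.rpow_lt_one_of_one_lt_of_neg (by norm_num) (by linarith)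
  refine ⟨C * 4 * (1 - q)⁻¹, ?_, fun ξ α A M hA hαA hM => ?_⟩
  · have : 1 ≤ (1 - q)⁻¹ := (one_le_inv₀ (by linarith)).2 (by linarith)
    nlinarith
  have hM0 : 0 < M := by linarith
  set F : ℝ → ℝ := fun x => α + Phi β ξ x (ξ - x) with hF
  have hFm : Measurable F := by
    have : Continuous F := by simp only [hF, Phi]; fun_prop
    exact this.measurable
  have hS : ∀ K : ℝ, MeasurableSet {x | |F x| ≤ K} := fun K =>
    measurableSet_le hFm.abs measurable_const
  have hpt : ∀ x, {x | M < |F x|}.indicator (fun x => ENNReal.ofReal (|F x| ^ (-p))) x ≤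
      ∑' i : ℕ, {x | |F x| ≤ 2 ^ (i + 1) * M}.indicator
        (fun _ => ENNReal.ofReal ((2 ^ i * M) ^ (-p))) x := by
    intro x
    by_cases hx : M < |F x|
    · obtain ⟨i, hi1, hi2⟩ := exists_nat_pow_near (show 1 ≤ |F x| / M by
        rw [one_le_div hM0]; exact hx.le) (one_lt_two)
      rw [le_div_iff₀ hM0] at hi1
      rw [div_lt_iff₀ hM0] at hi2
      refine le_trans ?_ (ENNReal.le_tsum i)
      rw [Set.indicator_of_mem (show x ∈ {x | M < |F x|} from hx),
        Set.indicator_of_mem (show x ∈ {x | |F x| ≤ 2 ^ (i + 1) * M} from hi2.le)]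
      exact ENNReal.ofReal_le_ofReal
        (Real.rpow_le_rpow_of_nonpos (by positivity) hi1 (by linarith))
    · rw [Set.indicator_of_notMem (by exact hx)]; exact zero_le
  have hterm : ∀ i : ℕ, ENNReal.ofReal (ξ ^ 2) *
      ∫⁻ x, {x | |F x| ≤ 2 ^ (i + 1) * M}.indicator
        (fun _ => ENNReal.ofReal ((2 ^ i * M) ^ (-p))) x ≤
      ENNReal.ofReal (C * 4 * (A ^ (3 / 8 : ℝ) * M ^ (5 / 8 - p))) * ENNReal.ofReal q ^ i := by
    intro i
    have h2i : (1 : ℝ) ≤ 2 ^ i := one_le_pow₀ (by norm_num)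
    set L : ℝ := 2 ^ i * M with hL
    have hL1 : 1 ≤ L := by nlinarith
    have hL0 : 0 < L := by linarith
    have hL2 : (2 : ℝ) ^ (i + 1) * M = 2 * L := by rw [pow_succ]; ring
    rw [lintegral_indicator (hS _), setLIntegral_const, mul_left_comm, hL2]
    refine (mul_le_mul_right (hC ξ α (2 * L) (by linarith)) _).trans ?_
    rw [← ENNReal.ofReal_mul (by positivity), ← ENNReal.ofReal_pow hq0.le,
      ← ENNReal.ofReal_mul (by positivity)]
    refine ENNReal.ofReal_le_ofReal ?_
    have e1 : (|α| + 2 * L) ^ (3 / 8 : ℝ) ≤ 3 ^ (3 / 8 : ℝ) * (A ^ (3 / 8 : ℝ) * L ^ (3 / 8 : ℝ)) := by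
      rw [← Real.mul_rpow (by linarith) hL0.le, ← Real.mul_rpow (by norm_num) (by positivity)]
      gcongr
      nlinarith
    have e2 : (2 * L) ^ (1 / 4 : ℝ) = 2 ^ (1 / 4 : ℝ) * L ^ (1 / 4 : ℝ) :=
      Real.mul_rpow (by norm_num) hL0.le
    have e3 : (3 : ℝ) ^ (3 / 8 : ℝ) * 2 ^ (1 / 4 : ℝ) ≤ 4 := by
      calc (3 : ℝ) ^ (3 / 8 : ℝ) * 2 ^ (1 / 4 : ℝ) ≤ 4 ^ (3 / 8 : ℝ) * 4 ^ (1 / 4 : ℝ) := by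
            gcongr <;> norm_num
        _ = 4 ^ (5 / 8 : ℝ) := by rw [← Real.rpow_add (by norm_num)]; norm_num
        _ ≤ 4 ^ (1 : ℝ) := by gcongr <;> norm_num
        _ = 4 := by norm_num
    have e4 : L ^ (-p) * (L ^ (3 / 8 : ℝ) * L ^ (1 / 4 : ℝ)) = M ^ (5 / 8 - p) * q ^ i := by
      rw [← Real.rpow_add hL0, ← Real.rpow_add hL0, hL, hq, Real.mul_rpow (by positivity) hM0.le,
        ← Real.rpow_natCast, ← Real.rpow_natCast, ← Real.rpow_mul (by norm_num),
        ← Real.rpow_mul (by norm_num), mul_comm]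
      ring_nf
    calc L ^ (-p) * (C * ((|α| + 2 * L) ^ (3 / 8 : ℝ) * (2 * L) ^ (1 / 4 : ℝ)))
        ≤ L ^ (-p) * (C * (3 ^ (3 / 8 : ℝ) * (A ^ (3 / 8 : ℝ) * L ^ (3 / 8 : ℝ)) *
          (2 ^ (1 / 4 : ℝ) * L ^ (1 / 4 : ℝ)))) := by rw [e2]; gcongr
      _ = C * (3 ^ (3 / 8 : ℝ) * 2 ^ (1 / 4 : ℝ)) * A ^ (3 / 8 : ℝ) *
          (L ^ (-p) * (L ^ (3 / 8 : ℝ) * L ^ (1 / 4 : ℝ))) := by ring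
      _ ≤ C * 4 * A ^ (3 / 8 : ℝ) * (M ^ (5 / 8 - p) * q ^ i) := by rw [e4]; gcongr
      _ = _ := by ring
  calc ENNReal.ofReal (ξ ^ 2) *
        ∫⁻ x, {x | M < |F x|}.indicator (fun x => ENNReal.ofReal (|F x| ^ (-p))) x
      ≤ ENNReal.ofReal (ξ ^ 2) * ∫⁻ x, ∑' i : ℕ, {x | |F x| ≤ 2 ^ (i + 1) * M}.indicator
        (fun _ => ENNReal.ofReal ((2 ^ i * M) ^ (-p))) x :=
        mul_le_mul_right (lintegral_mono hpt) _
    _ = ∑' i : ℕ, ENNReal.ofReal (ξ ^ 2) * ∫⁻ x, {x | |F x| ≤ 2 ^ (i + 1) * M}.indicator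
        (fun _ => ENNReal.ofReal ((2 ^ i * M) ^ (-p))) x := by
        rw [lintegral_tsum fun i => (measurable_const.indicator (hS _)).aemeasurable,
          ENNReal.tsum_mul_left]
    _ ≤ ∑' i : ℕ, ENNReal.ofReal (C * 4 * (A ^ (3 / 8 : ℝ) * M ^ (5 / 8 - p))) *
        ENNReal.ofReal q ^ i := ENNReal.tsum_le_tsum hterm
    _ = _ := by
        rw [ENNReal.tsum_mul_left, ENNReal.tsum_geometric, ← ENNReal.ofReal_one,
          ← ENNReal.ofReal_sub _ hq0.le, ← ENNReal.ofReal_inv_of_pos (by linarith),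
          ← ENNReal.ofReal_mul (by positivity)]
        congr 1; ring

/-! ### Growing a tree by one generation -/

/-- The tree that grows from `T` when its `a`-th terminal node is given two children. -/
def OrderedTree.grow {k : ℕ} (T : OrderedTree k) (a : Fin (k + 1)) : OrderedTree (k + 1) := (T, a)

theorem OrderedTree.exists_eq_grow {k : ℕ} (T : OrderedTree (k + 1)) :
    ∃ (T' : OrderedTree k) (a : Fin (k + 1)), T = T'.grow a := ⟨T.1, T.2, rfl⟩

section Growth

variable {k : ℕ}

theorem leafFreq_snoc_castSucc (T : OrderedTree k) (a : Fin (k + 1)) (ξ : ℝ) (η : Fin k → ℝ)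
    (x : ℝ) (b : Fin (k + 1)) :
    leafFreq (k + 1) (T.grow a) ξ (Fin.snoc (α := fun _ => ℝ) η x) b.castSucc =
      Function.update (leafFreq k T ξ η) a x b := by
  simp [leafFreq, OrderedTree.grow]

theorem leafFreq_snoc_last (T : OrderedTree k) (a : Fin (k + 1)) (ξ : ℝ) (η : Fin k → ℝ) (x : ℝ) :
    leafFreq (k + 1) (T.grow a) ξ (Fin.snoc (α := fun _ => ℝ) η x) (Fin.last (k + 1)) =
      leafFreq k T ξ η a - x := by
  simp [leafFreq, OrderedTree.grow]

theorem genFreq_snoc_castSucc (T : OrderedTree k) (a : Fin (k + 1)) (ξ : ℝ) (η : Fin k → ℝ)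
    (x : ℝ) (j : Fin k) :
    genFreq (k + 1) (T.grow a) ξ (Fin.snoc (α := fun _ => ℝ) η x) j.castSucc = genFreq k T ξ η j := by
  simp [genFreq, OrderedTree.grow]

theorem genFreq_snoc_last (T : OrderedTree k) (a : Fin (k + 1)) (ξ : ℝ) (η : Fin k → ℝ) (x : ℝ) :
    genFreq (k + 1) (T.grow a) ξ (Fin.snoc (α := fun _ => ℝ) η x) (Fin.last k) =
      (leafFreq k T ξ η a, x, leafFreq k T ξ η a - x) := by
  simp [genFreq, OrderedTree.grow]

theorem muTilde_snoc_of_le (β : ℝ) (T : OrderedTree k) (a : Fin (k + 1)) (ξ : ℝ) (η : Fin k → ℝ)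
    (x : ℝ) {j : ℕ} (hj : j ≤ k) :
    muTilde β (T.grow a) ξ (Fin.snoc (α := fun _ => ℝ) η x) j = muTilde β T ξ η j := by
  unfold muTilde
  rw [Fin.sum_univ_castSucc, if_neg (by simpa using hj), add_zero]
  simp only [genFreq_snoc_castSucc, Fin.val_castSucc]

theorem muTilde_snoc_last (β : ℝ) (T : OrderedTree k) (a : Fin (k + 1)) (ξ : ℝ) (η : Fin k → ℝ)
    (x : ℝ) :
    muTilde β (T.grow a) ξ (Fin.snoc (α := fun _ => ℝ) η x) (k + 1) =
      muTilde β T ξ η k + Phi β (leafFreq k T ξ η a) x (leafFreq k T ξ η a - x) := by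
  unfold muTilde
  rw [Fin.sum_univ_castSucc, if_pos (by simp)]
  simp only [genFreq_snoc_castSucc, Fin.val_castSucc, genFreq_snoc_last]
  congr 1
  refine Finset.sum_congr rfl fun i _ => ?_
  rw [if_pos (by omega), if_pos i.2]

theorem condC_snoc (β δ N : ℝ) (T : OrderedTree k) (a : Fin (k + 1)) (ξ : ℝ) (η : Fin k → ℝ)
    (x : ℝ) {j : ℕ} (hj : j + 1 ≤ k) :
    CondC β δ N (T.grow a) ξ (Fin.snoc (α := fun _ => ℝ) η x) j ↔
      CondC β δ N T ξ η j := by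
  unfold CondC
  rw [muTilde_snoc_of_le β T a ξ η x hj, muTilde_snoc_of_le β T a ξ η x (show j ≤ k by omega),
    muTilde_snoc_of_le β T a ξ η x (show 1 ≤ k by omega)]

/-- The right-hand side of the condition `C_k`, in terms of the first `k` generations. -/
def threshold (β δ : ℝ) (T : OrderedTree k) (ξ : ℝ) (η : Fin k → ℝ) : ℝ :=
  (2 * (k : ℝ) + 3) ^ 3 * (max |muTilde β T ξ η 1| |muTilde β T ξ η k|) ^ (1 - δ)

theorem condC_snoc_last (β δ N : ℝ) (T : OrderedTree k) (a : Fin (k + 1)) (ξ : ℝ) (η : Fin k → ℝ)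
    (x : ℝ) (hk : 1 ≤ k) :
    CondC β δ N (T.grow a) ξ (Fin.snoc (α := fun _ => ℝ) η x) k ↔
      |muTilde β T ξ η k + Phi β (leafFreq k T ξ η a) x (leafFreq k T ξ η a - x)| ≤
        threshold β δ T ξ η := by
  unfold CondC threshold
  rw [if_neg (by omega), muTilde_snoc_last, muTilde_snoc_of_le β T a ξ η x le_rfl,
    muTilde_snoc_of_le β T a ξ η x hk]

theorem mem_region0_snoc (β δ N : ℝ) (T : OrderedTree k) (a : Fin (k + 1)) (ξ : ℝ) (η : Fin k → ℝ)
    (x : ℝ) (hk : 1 ≤ k) :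
    Fin.snoc (α := fun _ => ℝ) η x ∈ region0 β δ N (T.grow a) ξ ↔
      η ∈ region0 β δ N T ξ ∧ threshold β δ T ξ η <
        |muTilde β T ξ η k + Phi β (leafFreq k T ξ η a) x (leafFreq k T ξ η a - x)| := by
  rw [← not_le, ← condC_snoc_last β δ N T a ξ η x hk]
  constructor
  · rintro ⟨h0, h⟩
    exact ⟨⟨(condC_snoc β δ N T a ξ η x (by omega)).1 h0, fun j h1 h2 hj =>
      h j h1 (by omega) ((condC_snoc β δ N T a ξ η x (by omega)).2 hj)⟩, h k hk le_rfl⟩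
  · rintro ⟨⟨h0, h⟩, hl⟩
    refine ⟨(condC_snoc β δ N T a ξ η x (by omega)).2 h0, fun j h1 h2 hj => ?_⟩
    rcases Nat.lt_or_ge j k with hjk | hjk
    · exact h j h1 (by omega) ((condC_snoc β δ N T a ξ η x (by omega)).1 hj)
    · obtain rfl : j = k := by omega
      exact hl hj

theorem mem_region1_snoc (β δ N : ℝ) (T : OrderedTree k) (a : Fin (k + 1)) (ξ : ℝ) (η : Fin k → ℝ)
    (x : ℝ) (hk : 1 ≤ k) :
    Fin.snoc (α := fun _ => ℝ) η x ∈ region1 β δ N (T.grow a) ξ ↔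
      η ∈ region0 β δ N T ξ ∧
        |muTilde β T ξ η k + Phi β (leafFreq k T ξ η a) x (leafFreq k T ξ η a - x)| ≤
          threshold β δ T ξ η := by
  rw [← condC_snoc_last β δ N T a ξ η x hk]
  unfold region1
  rw [if_neg (by omega)]
  constructor
  · rintro ⟨h0, h, hl⟩
    exact ⟨⟨(condC_snoc β δ N T a ξ η x (by omega)).1 h0, fun j h1 h2 hj =>
      h j h1 (by omega) ((condC_snoc β δ N T a ξ η x (by omega)).2 hj)⟩, hl⟩
  · rintro ⟨⟨h0, h⟩, hl⟩
    exact ⟨(condC_snoc β δ N T a ξ η x (by omega)).2 h0, fun j h1 h2 hj =>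
      h j h1 (by omega) ((condC_snoc β δ N T a ξ η x (by omega)).1 hj), hl⟩

end Growth

/-! ### Measurability -/

theorem continuous_leafFreq : ∀ (k : ℕ) (T : OrderedTree k) (a : Fin (k + 1)),
    Continuous fun p : ℝ × (Fin k → ℝ) => leafFreq k T p.1 p.2 a
  | 0, _, _ => continuous_fst
  | k + 1, (T, a), b => by
    have ih : ∀ c, Continuous fun p : ℝ × (Fin (k + 1) → ℝ) =>
        leafFreq k T p.1 (Fin.init p.2) c := fun c =>
      (continuous_leafFreq k T c).comp (f := fun p : ℝ × (Fin (k + 1) → ℝ) => (p.1, Fin.init p.2))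
        (by unfold Fin.init; fun_prop)
    refine Fin.lastCases ?_ (fun b => ?_) b
    · simp only [leafFreq, Fin.snoc_last]
      exact (ih a).sub (by fun_prop)
    · simp only [leafFreq, Fin.snoc_castSucc]
      rcases eq_or_ne b a with rfl | h
      · simp only [Function.update_self]; fun_prop
      · simp only [Function.update_of_ne h]; exact ih b

theorem continuous_genFreq : ∀ (k : ℕ) (T : OrderedTree k) (j : Fin k),
    Continuous fun p : ℝ × (Fin k → ℝ) => genFreq k T p.1 p.2 j
  | 0, _, j => j.elim0
  | k + 1, (T, a), j => by
    have hi : Continuous fun p : ℝ × (Fin (k + 1) → ℝ) => (p.1, Fin.init p.2) := by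
      unfold Fin.init; fun_prop
    have hl : Continuous fun p : ℝ × (Fin (k + 1) → ℝ) => leafFreq k T p.1 (Fin.init p.2) a :=
      (continuous_leafFreq k T a).comp hi
    refine Fin.lastCases ?_ (fun b => ?_) j
    · simp only [genFreq, Fin.snoc_last]
      exact hl.prodMk ((by fun_prop : Continuous fun p : ℝ × (Fin (k + 1) → ℝ) =>
        p.2 (Fin.last k)).prodMk (hl.sub (by fun_prop)))
    · simp only [genFreq, Fin.snoc_castSucc]
      exact (continuous_genFreq k T b).comp hi

theorem continuous_muTilde (β : ℝ) {k : ℕ} (T : OrderedTree k) (j : ℕ) :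
    Continuous fun p : ℝ × (Fin k → ℝ) => muTilde β T p.1 p.2 j := by
  unfold muTilde Phi
  refine continuous_finsetSum _ fun i _ => ?_
  have := continuous_genFreq k T i
  split_ifs <;> fun_prop

theorem measurableSet_condC (β δ N : ℝ) {k : ℕ} (T : OrderedTree k) (j : ℕ) :
    MeasurableSet {p : ℝ × (Fin k → ℝ) | CondC β δ N T p.1 p.2 j} := by
  unfold CondC
  have h : ∀ j, Measurable fun p : ℝ × (Fin k → ℝ) => muTilde β T p.1 p.2 j :=
    fun j => (continuous_muTilde β T j).measurable
  split_ifs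
  · exact measurableSet_lt measurable_const (h 1).abs
  · exact measurableSet_le (h _).abs ((((h 1).abs.max (h j).abs).pow_const _).const_mul _)

theorem measurableSet_region0 (β δ N : ℝ) {k : ℕ} (T : OrderedTree k) :
    MeasurableSet {p : ℝ × (Fin k → ℝ) | p.2 ∈ region0 β δ N T p.1} := by
  have h : {p : ℝ × (Fin k → ℝ) | p.2 ∈ region0 β δ N T p.1} =
      {p | CondC β δ N T p.1 p.2 0} ∩
      ⋂ j : ℕ, ⋂ (_ : 1 ≤ j), ⋂ (_ : j + 1 ≤ k), {p | CondC β δ N T p.1 p.2 j}ᶜ := by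
    ext p
    simp only [Set.mem_inter_iff, Set.mem_iInter]
    exact Iff.rfl
  rw [h]
  exact (measurableSet_condC β δ N T 0).inter <| .iInter fun j => .iInter fun _ => .iInter fun _ =>
    (measurableSet_condC β δ N T j).compl

theorem measurableSet_region1 (β δ N : ℝ) {k : ℕ} (T : OrderedTree k) :
    MeasurableSet {p : ℝ × (Fin k → ℝ) | p.2 ∈ region1 β δ N T p.1} := by
  unfold region1
  split_ifs with hk
  · exact (measurableSet_condC β δ N T 0).compl
  have h : {p : ℝ × (Fin k → ℝ) | p.2 ∈ {η | CondC β δ N T p.1 η 0 ∧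
      (∀ j, 1 ≤ j → j + 2 ≤ k → ¬ CondC β δ N T p.1 η j) ∧ CondC β δ N T p.1 η (k - 1)}} =
      {p | CondC β δ N T p.1 p.2 0} ∩
      ((⋂ j : ℕ, ⋂ (_ : 1 ≤ j), ⋂ (_ : j + 2 ≤ k), {p | CondC β δ N T p.1 p.2 j}ᶜ) ∩
      {p | CondC β δ N T p.1 p.2 (k - 1)}) := by
    ext p
    simp only [Set.mem_inter_iff, Set.mem_iInter]
    exact Iff.rfl
  rw [h]
  exact (measurableSet_condC β δ N T 0).inter <| MeasurableSet.inter
    (.iInter fun j => .iInter fun _ => .iInter fun _ => (measurableSet_condC β δ N T j).compl)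
    (measurableSet_condC β δ N T _)

theorem lintegral_snoc {k : ℕ} {f : (Fin (k + 1) → ℝ) → ℝ≥0∞} (hf : Measurable f) :
    ∫⁻ η, f η = ∫⁻ η : Fin k → ℝ, ∫⁻ x, f (Fin.snoc (α := fun _ => ℝ) η x) := by
  have h := (volume_preserving_piFinSuccAbove (fun _ : Fin (k + 1) => ℝ) (Fin.last k)).symm
  rw [← h.lintegral_comp hf, Measure.volume_eq_prod, lintegral_prod_symm]
  · refine lintegral_congr fun η => lintegral_congr fun x => congrArg f ?_
    simp [MeasurableEquiv.piFinSuccAbove, Fin.insertNthEquiv]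
  · exact (hf.comp h.measurable).aemeasurable

/-! ### The kernel of a tree -/

/-- The integrand of a tree without the cutoff, the oscillation and the terminal nodes:
`∏_{j=1}^k iξ^{(j)} / ∏_{j=1}^m iμ̃_j`. -/
def treeKernel (β : ℝ) (m : ℕ) {k : ℕ} (T : OrderedTree k) (ξ : ℝ) (η : Fin k → ℝ) : ℂ :=
  (∏ j : Fin k, Complex.I * ((genFreq k T ξ η j).1 : ℂ)) /
    ∏ j ∈ Finset.Icc 1 m, Complex.I * (muTilde β T ξ η j : ℂ)

/-- The square of the absolute value of `treeKernel`. -/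
def kernelSq (β : ℝ) (m : ℕ) {k : ℕ} (T : OrderedTree k) (ξ : ℝ) (η : Fin k → ℝ) : ℝ :=
  (∏ j : Fin k, (genFreq k T ξ η j).1 ^ 2) * ∏ j ∈ Finset.Icc 1 m, (muTilde β T ξ η j ^ 2)⁻¹

theorem norm_treeKernel_sq (β : ℝ) (m : ℕ) {k : ℕ} (T : OrderedTree k) (ξ : ℝ) (η : Fin k → ℝ) :
    ‖treeKernel β m T ξ η‖ ^ 2 = kernelSq β m T ξ η := by
  simp [treeKernel, kernelSq, div_eq_mul_inv, mul_pow, Finset.prod_pow]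
  rw [← Finset.abs_prod, ← Finset.abs_prod, sq_abs, sq_abs]

theorem kernelSq_nonneg (β : ℝ) (m : ℕ) {k : ℕ} (T : OrderedTree k) (ξ : ℝ) (η : Fin k → ℝ) :
    0 ≤ kernelSq β m T ξ η := by
  rw [← norm_treeKernel_sq]; positivity

theorem measurable_treeKernel (β : ℝ) (m : ℕ) {k : ℕ} (T : OrderedTree k) :
    Measurable fun p : ℝ × (Fin k → ℝ) => treeKernel β m T p.1 p.2 := by
  unfold treeKernel
  refine Measurable.div ?_ ?_
  · refine Finset.measurable_prod _ fun j _ => ?_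
    have := (continuous_genFreq k T j).fst.measurable
    fun_prop
  · refine Finset.measurable_prod _ fun j _ => ?_
    have := (continuous_muTilde β T j).measurable
    fun_prop

theorem measurable_kernelSq (β : ℝ) (m : ℕ) {k : ℕ} (T : OrderedTree k) :
    Measurable fun p : ℝ × (Fin k → ℝ) => kernelSq β m T p.1 p.2 := by
  simp_rw [← norm_treeKernel_sq]
  exact (measurable_treeKernel β m T).norm.pow_const 2

section Growth

variable {k : ℕ}

theorem kernelSq_snoc_of_le (β : ℝ) {m : ℕ} (T : OrderedTree k) (a : Fin (k + 1)) (ξ : ℝ)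
    (η : Fin k → ℝ) (x : ℝ) (hm : m ≤ k) :
    kernelSq β m (T.grow a) ξ (Fin.snoc (α := fun _ => ℝ) η x) =
      leafFreq k T ξ η a ^ 2 * kernelSq β m T ξ η := by
  unfold kernelSq
  rw [Fin.prod_univ_castSucc]
  simp only [genFreq_snoc_castSucc, genFreq_snoc_last]
  have h : ∀ j ∈ Finset.Icc 1 m, (muTilde β (T.grow a) ξ (Fin.snoc (α := fun _ => ℝ) η x) j ^ 2)⁻¹ =
      (muTilde β T ξ η j ^ 2)⁻¹ := fun j hj => by
    rw [muTilde_snoc_of_le β T a ξ η x ((Finset.mem_Icc.1 hj).2.trans hm)]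
  rw [Finset.prod_congr rfl h]
  ring

theorem kernelSq_snoc_last (β : ℝ) (T : OrderedTree k) (a : Fin (k + 1)) (ξ : ℝ)
    (η : Fin k → ℝ) (x : ℝ) :
    kernelSq β (k + 1) (T.grow a) ξ (Fin.snoc (α := fun _ => ℝ) η x) =
      leafFreq k T ξ η a ^ 2 * kernelSq β k T ξ η *
        ((muTilde β T ξ η k + Phi β (leafFreq k T ξ η a) x (leafFreq k T ξ η a - x)) ^ 2)⁻¹ := by
  have := kernelSq_snoc_of_le β T a ξ η x (le_refl k)
  rw [← this]
  unfold kernelSq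
  rw [Finset.prod_Icc_succ_top (by omega), muTilde_snoc_last, mul_assoc]

end Growth

/-! ### Bounds for the kernels, uniformly in the frequency at the root -/

theorem lt_abs_muTilde_one {β δ N : ℝ} {k : ℕ} {T : OrderedTree k} {ξ : ℝ}
    {η : Fin k → ℝ} (h : η ∈ region0 β δ N T ξ) : N < |muTilde β T ξ η 1| := by
  have := h.1
  rwa [CondC, if_pos rfl] at this

theorem one_le_abs_muTilde_last {β δ N : ℝ} (hδ : δ < 1) (hN : 1 < N) {k : ℕ} (hk : 1 ≤ k)
    {T : OrderedTree k} {ξ : ℝ} {η : Fin k → ℝ} (h : η ∈ region0 β δ N T ξ) :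
    1 ≤ |muTilde β T ξ η k| := by
  have h1 := lt_abs_muTilde_one h
  rcases hk.eq_or_lt with rfl | hk
  · linarith
  have h2 := h.2 (k - 1) (by omega) (by omega)
  rw [CondC, if_neg (by omega), not_le, Nat.sub_add_cancel (by omega)] at h2
  refine le_trans ?_ h2.le
  have e1 : 1 ≤ (max |muTilde β T ξ η 1| |muTilde β T ξ η (k - 1)|) ^ (1 - δ) :=
    Real.one_le_rpow (le_max_of_le_left (by linarith)) (by linarith)
  have e2 : (1 : ℝ) ≤ (2 * ((k - 1 : ℕ) : ℝ) + 3) ^ 3 :=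
    one_le_pow₀ (by have := Nat.cast_nonneg (α := ℝ) (k - 1); linarith)
  nlinarith

theorem lintegral_fin_zero (c : ℝ≥0∞) : ∫⁻ _ : Fin 0 → ℝ, c = c := by
  rw [lintegral_const, volume_pi, Measure.pi_of_empty]; simp

/-- The squared kernel of `N_0` with the weight `|μ̃_1|^{5/8} |μ̃_k|^{5/8}`, which pays for the losses
in the next generation. -/
def weightedKernelSq (β : ℝ) {k : ℕ} (T : OrderedTree k) (ξ : ℝ) (η : Fin k → ℝ) : ℝ :=
  kernelSq β k T ξ η * |muTilde β T ξ η 1| ^ (5 / 8 : ℝ) * |muTilde β T ξ η k| ^ (5 / 8 : ℝ)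

theorem measurable_weightedKernelSq (β : ℝ) {k : ℕ} (T : OrderedTree k) :
    Measurable fun p : ℝ × (Fin k → ℝ) => weightedKernelSq β T p.1 p.2 :=
  ((measurable_kernelSq β k T).mul ((continuous_muTilde β T 1).measurable.abs.pow_const _)).mul
    ((continuous_muTilde β T k).measurable.abs.pow_const _)

theorem measurable_indicator_section {k : ℕ} {S : ℝ → Set (Fin k → ℝ)}
    (hS : MeasurableSet {p : ℝ × (Fin k → ℝ) | p.2 ∈ S p.1}) {f : ℝ → (Fin k → ℝ) → ℝ}
    (hf : Measurable fun p : ℝ × (Fin k → ℝ) => f p.1 p.2) (ξ : ℝ) :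
    Measurable ((S ξ).indicator fun η => ENNReal.ofReal (f ξ η)) :=
  (ENNReal.measurable_ofReal.comp (hf.comp measurable_prodMk_left)).indicator
    (measurable_prodMk_left hS)

theorem inv_sq_mul_rpow (F : ℝ) (hF : 0 < |F|) :
    (F ^ 2)⁻¹ * |F| ^ (5 / 8 : ℝ) = |F| ^ (-(11 / 8) : ℝ) := by
  rw [← sq_abs, ← Real.rpow_natCast, ← Real.rpow_neg hF.le, ← Real.rpow_add hF]; norm_num

theorem inv_sq_mul_rpow_mul_rpow (F : ℝ) (hF : 0 < |F|) :
    (F ^ 2)⁻¹ * |F| ^ (5 / 8 : ℝ) * |F| ^ (5 / 8 : ℝ) = |F| ^ (-(3 / 4) : ℝ) := by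
  rw [inv_sq_mul_rpow F hF, ← Real.rpow_add hF]; norm_num

theorem muTilde_zero (β : ℝ) {k : ℕ} (T : OrderedTree k) (ξ : ℝ) (η : Fin k → ℝ) :
    muTilde β T ξ η 0 = 0 := by
  simp [muTilde]

theorem muTilde_snoc_one (β : ℝ) (T : OrderedTree 0) (a : Fin 1) (ξ : ℝ) (η : Fin 0 → ℝ) (x : ℝ) :
    muTilde β (T.grow a) ξ (Fin.snoc (α := fun _ => ℝ) η x) 1 = 0 + Phi β ξ x (ξ - x) := by
  rw [muTilde_snoc_last, muTilde_zero]; rfl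

/-- The first generation: the weight `|μ̃_1|^{5/8 + 5/8}` turns `|μ̃_1|^{-2}` into `|μ̃_1|^{-3/4}`, which is
still integrable over `|μ̃_1| > N`. -/
theorem weightedKernelSq_base {β C : ℝ} (hC : ∀ ξ α A M : ℝ, 1 ≤ A → |α| ≤ A → 1 ≤ M →
      ENNReal.ofReal (ξ ^ 2) * ∫⁻ x, {x | M < |α + Phi β ξ x (ξ - x)|}.indicator
        (fun x => ENNReal.ofReal (|α + Phi β ξ x (ξ - x)| ^ (-(3 / 4) : ℝ))) x ≤
      ENNReal.ofReal (C * (A ^ (3 / 8 : ℝ) * M ^ (5 / 8 - 3 / 4 : ℝ))))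
    {N : ℝ} (hN : 1 < N) (δ : ℝ) (T : OrderedTree 1) (ξ : ℝ) :
    ∫⁻ η, (region0 β δ N T ξ).indicator (fun η => ENNReal.ofReal (weightedKernelSq β T ξ η)) η ≤
      ENNReal.ofReal (C * N ^ (-(1 / 8) : ℝ)) := by
  obtain ⟨T, a, rfl⟩ := T.exists_eq_grow
  rw [lintegral_snoc (measurable_indicator_section (measurableSet_region0 β δ N _)
    (measurable_weightedKernelSq β _) ξ)]
  have h : ∀ (η : Fin 0 → ℝ) (x : ℝ), (region0 β δ N (T.grow a) ξ).indicator
      (fun η => ENNReal.ofReal (weightedKernelSq β (T.grow a) ξ η))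
        (Fin.snoc (α := fun _ => ℝ) η x) =
      ENNReal.ofReal (ξ ^ 2) * {x | N < |0 + Phi β ξ x (ξ - x)|}.indicator
        (fun x => ENNReal.ofReal (|0 + Phi β ξ x (ξ - x)| ^ (-(3 / 4) : ℝ))) x := by
    intro η x
    have hmem : Fin.snoc (α := fun _ => ℝ) η x ∈ region0 β δ N (T.grow a) ξ ↔
        N < |0 + Phi β ξ x (ξ - x)| := by
      rw [← muTilde_snoc_one β T a ξ η x]
      constructor
      · exact lt_abs_muTilde_one
      · intro h
        refine ⟨by rwa [CondC, if_pos rfl], fun j _ _ => by omega⟩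
    by_cases hx : N < |0 + Phi β ξ x (ξ - x)|
    · rw [Set.indicator_of_mem (hmem.2 hx), Set.indicator_of_mem (by exact hx),
        ← ENNReal.ofReal_mul (by positivity), weightedKernelSq, kernelSq_snoc_last, muTilde_zero,
        ← inv_sq_mul_rpow_mul_rpow _ (by linarith), muTilde_snoc_one]
      congr 1
      simp only [kernelSq, leafFreq]
      simp
      ring
    · rw [Set.indicator_of_notMem (mt hmem.1 hx), Set.indicator_of_notMem (by exact hx), mul_zero]
  simp_rw [h]
  rw [lintegral_fin_zero, lintegral_const_mul' _ _ ENNReal.ofReal_ne_top]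
  refine (hC ξ 0 1 N le_rfl (by simp) hN.le).trans (le_of_eq ?_)
  norm_num

/-- The gain `|μ̃_{k+1}|^{-3/4}` in one generation: it beats the number `k + 1` of ways to grow the
tree, twice, and still leaves a negative power of `N`. -/
theorem threshold_rpow_le {β δ N : ℝ} (hδ : δ < 1) (hN : 1 < N) {k : ℕ}
    {T : OrderedTree k} {ξ : ℝ} {η : Fin k → ℝ} (h : η ∈ region0 β δ N T ξ) :
    1 ≤ threshold β δ T ξ η ∧ threshold β δ T ξ η ^ (-(3 / 4) : ℝ) ≤
      N ^ (-((1 - δ) / 8)) / ((k : ℝ) + 1) ^ 2 := by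
  have h1 := lt_abs_muTilde_one h
  have hk := Nat.cast_nonneg (α := ℝ) k
  have hN0 : 0 < N := by linarith
  have hlow : (2 * (k : ℝ) + 3) ^ 3 * N ^ (1 - δ) ≤ threshold β δ T ξ η := by
    unfold threshold
    gcongr
    exact le_max_of_le_left h1.le
  have e1 : 1 ≤ N ^ (1 - δ) := Real.one_le_rpow hN.le (by linarith)
  have e2 : (1 : ℝ) ≤ (2 * (k : ℝ) + 3) ^ 3 := one_le_pow₀ (by linarith)
  refine ⟨le_trans (by nlinarith) hlow, ?_⟩
  calc threshold β δ T ξ η ^ (-(3 / 4) : ℝ)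
      ≤ ((2 * (k : ℝ) + 3) ^ 3 * N ^ (1 - δ)) ^ (-(3 / 4) : ℝ) :=
        Real.rpow_le_rpow_of_nonpos (by positivity) hlow (by norm_num)
    _ = (2 * (k : ℝ) + 3) ^ (-(9 / 4) : ℝ) * N ^ ((1 - δ) * -(3 / 4)) := by
        rw [Real.mul_rpow (by positivity) (by positivity), ← Real.rpow_natCast,
          ← Real.rpow_mul (by positivity), ← Real.rpow_mul hN0.le]
        norm_num
    _ ≤ (2 * (k : ℝ) + 3) ^ (-2 : ℝ) * N ^ (-((1 - δ) / 8)) := by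
        gcongr ?_ ^ ?_ * ?_ ^ ?_
        · linarith
        · norm_num
        · exact hN.le
        · nlinarith
    _ ≤ ((k : ℝ) + 1) ^ (-2 : ℝ) * N ^ (-((1 - δ) / 8)) := by
        gcongr ?_ * _
        exact Real.rpow_le_rpow_of_nonpos (by positivity) (by linarith) (by norm_num)
    _ = _ := by
        rw [Real.rpow_neg (by positivity)]; norm_num [div_eq_mul_inv, mul_comm]

/-- The induction step, by integration over the last frequency. The new weight turns `|μ̃_{k+1}|^{-2}`
into `|μ̃_{k+1}|^{-11/8}`, and its integral consumes `|μ̃_k|^{3/8}`, which the old weight covers. -/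
theorem weightedKernelSq_step {β C : ℝ} (hC1 : 1 ≤ C)
    (hC : ∀ ξ α A M : ℝ, 1 ≤ A → |α| ≤ A → 1 ≤ M →
      ENNReal.ofReal (ξ ^ 2) * ∫⁻ x, {x | M < |α + Phi β ξ x (ξ - x)|}.indicator
        (fun x => ENNReal.ofReal (|α + Phi β ξ x (ξ - x)| ^ (-(11 / 8) : ℝ))) x ≤
      ENNReal.ofReal (C * (A ^ (3 / 8 : ℝ) * M ^ (5 / 8 - 11 / 8 : ℝ))))
    {δ N : ℝ} (hδ : δ < 1) (hN : 1 < N) {k : ℕ} (hk : 1 ≤ k) (T : OrderedTree k)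
    (a : Fin (k + 1)) (ξ : ℝ) :
    ∫⁻ η, (region0 β δ N (T.grow a) ξ).indicator
        (fun η => ENNReal.ofReal (weightedKernelSq β (T.grow a) ξ η)) η ≤
      ENNReal.ofReal (C * (N ^ (-((1 - δ) / 8)) / ((k : ℝ) + 1) ^ 2)) *
        ∫⁻ η, (region0 β δ N T ξ).indicator
          (fun η => ENNReal.ofReal (weightedKernelSq β T ξ η)) η := by
  rw [lintegral_snoc (measurable_indicator_section (measurableSet_region0 β δ N _)
    (measurable_weightedKernelSq β _) ξ), ← lintegral_const_mul' _ _ ENNReal.ofReal_ne_top]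
  refine lintegral_mono fun η => ?_
  by_cases hη : η ∈ region0 β δ N T ξ
  swap
  · have : ∀ x, (region0 β δ N (T.grow a) ξ).indicator
        (fun η => ENNReal.ofReal (weightedKernelSq β (T.grow a) ξ η))
          (Fin.snoc (α := fun _ => ℝ) η x) = 0 := fun x =>
      Set.indicator_of_notMem (fun h => hη ((mem_region0_snoc β δ N T a ξ η x hk).1 h).1) _
    simp [this]
  set l := leafFreq k T ξ η a with hl
  set α := muTilde β T ξ η k with hα
  set M := threshold β δ T ξ η with hM
  obtain ⟨hM1, hM2⟩ := threshold_rpow_le hδ hN hη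
  have hα1 : 1 ≤ |α| := one_le_abs_muTilde_last hδ hN hk hη
  have hW : 0 ≤ kernelSq β k T ξ η * |muTilde β T ξ η 1| ^ (5 / 8 : ℝ) :=
    mul_nonneg (kernelSq_nonneg _ _ _ _ _) (by positivity)
  have h : ∀ x, (region0 β δ N (T.grow a) ξ).indicator
      (fun η => ENNReal.ofReal (weightedKernelSq β (T.grow a) ξ η))
        (Fin.snoc (α := fun _ => ℝ) η x) =
      ENNReal.ofReal (kernelSq β k T ξ η * |muTilde β T ξ η 1| ^ (5 / 8 : ℝ)) *
        (ENNReal.ofReal (l ^ 2) * {x | M < |α + Phi β l x (l - x)|}.indicator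
          (fun x => ENNReal.ofReal (|α + Phi β l x (l - x)| ^ (-(11 / 8) : ℝ))) x) := by
    intro x
    have hmem := mem_region0_snoc β δ N T a ξ η x hk
    by_cases hx : M < |α + Phi β l x (l - x)|
    · rw [Set.indicator_of_mem (hmem.2 ⟨hη, hx⟩), Set.indicator_of_mem (by exact hx),
        ← ENNReal.ofReal_mul (by positivity), ← ENNReal.ofReal_mul hW, weightedKernelSq,
        kernelSq_snoc_last, muTilde_snoc_last, muTilde_snoc_of_le β T a ξ η x hk,
        ← inv_sq_mul_rpow _ (by linarith)]
      congr 1; ring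
    · rw [Set.indicator_of_notMem (fun h => hx (hmem.1 h).2),
        Set.indicator_of_notMem (by exact hx), mul_zero, mul_zero]
  simp_rw [h]
  rw [lintegral_const_mul' _ _ ENNReal.ofReal_ne_top, lintegral_const_mul' _ _ ENNReal.ofReal_ne_top,
    Set.indicator_of_mem hη]
  refine (mul_le_mul_right (hC l α |α| M hα1 le_rfl hM1) _).trans ?_
  rw [← ENNReal.ofReal_mul hW, ← ENNReal.ofReal_mul (by positivity)]
  refine ENNReal.ofReal_le_ofReal ?_
  have e1 : |α| ^ (3 / 8 : ℝ) ≤ |α| ^ (5 / 8 : ℝ) := by gcongr; norm_num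
  have e2 : M ^ (5 / 8 - 11 / 8 : ℝ) ≤ N ^ (-((1 - δ) / 8)) / ((k : ℝ) + 1) ^ 2 := by
    norm_num at hM2 ⊢; exact hM2
  have hM0 : 0 ≤ M := by linarith
  calc kernelSq β k T ξ η * |muTilde β T ξ η 1| ^ (5 / 8 : ℝ) *
        (C * (|α| ^ (3 / 8 : ℝ) * M ^ (5 / 8 - 11 / 8 : ℝ)))
      ≤ kernelSq β k T ξ η * |muTilde β T ξ η 1| ^ (5 / 8 : ℝ) *
        (C * (|α| ^ (5 / 8 : ℝ) * (N ^ (-((1 - δ) / 8)) / ((k : ℝ) + 1) ^ 2))) := by gcongr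
    _ = _ := by unfold weightedKernelSq; ring

theorem kernelSq_le_weightedKernelSq {β δ N : ℝ} (hδ : δ < 1) (hN : 1 < N) {k : ℕ} (hk : 1 ≤ k)
    {T : OrderedTree k} {ξ : ℝ} {η : Fin k → ℝ} (h : η ∈ region0 β δ N T ξ) :
    kernelSq β k T ξ η ≤ weightedKernelSq β T ξ η := by
  have h1 := lt_abs_muTilde_one h
  have h2 := one_le_abs_muTilde_last hδ hN hk h
  have e1 : 1 ≤ |muTilde β T ξ η 1| ^ (5 / 8 : ℝ) := Real.one_le_rpow (by linarith) (by norm_num)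
  have e2 : 1 ≤ |muTilde β T ξ η k| ^ (5 / 8 : ℝ) := Real.one_le_rpow h2 (by norm_num)
  have h0 := kernelSq_nonneg β k T ξ η
  unfold weightedKernelSq
  rw [mul_assoc]
  nlinarith [mul_le_mul e1 e2 zero_le_one (by linarith)]

/-- The last generation of `N_1`, in which the phase is not divided out but bounded by the
threshold. -/
theorem kernelSq_region1_step {β C : ℝ} (hC1 : 1 ≤ C) (hC : ∀ ξ α K : ℝ, 1 ≤ K →
      ENNReal.ofReal (ξ ^ 2) * volume {x : ℝ | |α + Phi β ξ x (ξ - x)| ≤ K} ≤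
        ENNReal.ofReal (C * ((|α| + K) ^ (3 / 8 : ℝ) * K ^ (1 / 4 : ℝ))))
    {δ N : ℝ} (hδ₀ : 0 < δ) (hδ : δ < 1) (hN : 1 < N) {k : ℕ} (hk : 1 ≤ k) (T : OrderedTree k)
    (a : Fin (k + 1)) (ξ : ℝ) :
    ∫⁻ η, (region1 β δ N (T.grow a) ξ).indicator
        (fun η => ENNReal.ofReal (kernelSq β k (T.grow a) ξ η)) η ≤
      ENNReal.ofReal (2 * C * (2 * (k : ℝ) + 3) ^ 2) *
        ∫⁻ η, (region0 β δ N T ξ).indicator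
          (fun η => ENNReal.ofReal (weightedKernelSq β T ξ η)) η := by
  rw [lintegral_snoc (measurable_indicator_section (measurableSet_region1 β δ N _)
    (measurable_kernelSq β k _) ξ), ← lintegral_const_mul' _ _ ENNReal.ofReal_ne_top]
  refine lintegral_mono fun η => ?_
  by_cases hη : η ∈ region0 β δ N T ξ
  swap
  · have : ∀ x, (region1 β δ N (T.grow a) ξ).indicator
        (fun η => ENNReal.ofReal (kernelSq β k (T.grow a) ξ η))
          (Fin.snoc (α := fun _ => ℝ) η x) = 0 := fun x =>
      Set.indicator_of_notMem (fun h => hη ((mem_region1_snoc β δ N T a ξ η x hk).1 h).1) _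
    simp [this]
  set l := leafFreq k T ξ η a with hl
  set α := muTilde β T ξ η k with hα
  set M := threshold β δ T ξ η with hM
  set m := muTilde β T ξ η 1 with hm
  obtain ⟨hM1, -⟩ := threshold_rpow_le hδ hN hη
  have hα1 : 1 ≤ |α| := one_le_abs_muTilde_last hδ hN hk hη
  have hm1 : 1 ≤ |m| := hN.le.trans (lt_abs_muTilde_one hη).le
  have hW := kernelSq_nonneg β k T ξ η
  have hmeas : MeasurableSet {x | |α + Phi β l x (l - x)| ≤ M} := by
    refine measurableSet_le (Continuous.measurable ?_).abs measurable_const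
    unfold Phi; fun_prop
  have h : ∀ x, (region1 β δ N (T.grow a) ξ).indicator
      (fun η => ENNReal.ofReal (kernelSq β k (T.grow a) ξ η))
        (Fin.snoc (α := fun _ => ℝ) η x) =
      {x | |α + Phi β l x (l - x)| ≤ M}.indicator
        (fun _ => ENNReal.ofReal (kernelSq β k T ξ η) * ENNReal.ofReal (l ^ 2)) x := by
    intro x
    have hmem := mem_region1_snoc β δ N T a ξ η x hk
    by_cases hx : |α + Phi β l x (l - x)| ≤ M
    · rw [Set.indicator_of_mem (hmem.2 ⟨hη, hx⟩), Set.indicator_of_mem (by exact hx),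
        ← ENNReal.ofReal_mul hW, kernelSq_snoc_of_le _ _ _ _ _ _ le_rfl, mul_comm]
    · rw [Set.indicator_of_notMem (fun h => hx (hmem.1 h).2), Set.indicator_of_notMem (by exact hx)]
  simp_rw [h]
  rw [lintegral_indicator hmeas, setLIntegral_const, mul_assoc, Set.indicator_of_mem hη]
  refine (mul_le_mul_right (hC l α M hM1) _).trans ?_
  rw [← ENNReal.ofReal_mul hW, ← ENNReal.ofReal_mul (by positivity)]
  refine ENNReal.ofReal_le_ofReal ?_
  have hk0 := Nat.cast_nonneg (α := ℝ) k
  set n : ℝ := 2 * (k : ℝ) + 3 with hn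
  have hn1 : 1 ≤ n := by linarith
  set S := n ^ 3 * (|m| * |α|) with hS
  have hmα : 1 ≤ |m| * |α| := by nlinarith
  have hn3 : 1 ≤ n ^ 3 := one_le_pow₀ hn1
  -- Both `M` and `|α|` are at most `(2k+3)³ |μ̃_1| |μ̃_k|`; the power `3/8 + 1/4 = 5/8` of this is the weight.
  have hMS : M ≤ S := by
    have hmax : max |m| |α| ≤ |m| * |α| := max_le (by nlinarith) (by nlinarith)
    have hmax1 : 1 ≤ max |m| |α| := le_max_of_le_left hm1
    simp only [hM, threshold, hS]
    gcongr
    calc (max |m| |α|) ^ (1 - δ) ≤ (max |m| |α|) ^ (1 : ℝ) := by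
          gcongr
          linarith
      _ ≤ _ := by rwa [Real.rpow_one]
  have hαS : |α| ≤ S := by
    simp only [hS]; nlinarith [mul_le_mul hn3 hmα zero_le_one (by linarith)]
  have hS0 : 0 < S := by linarith
  have hM0 : 0 < M := by linarith
  have key : (|α| + M) ^ (3 / 8 : ℝ) * M ^ (1 / 4 : ℝ) ≤
      2 * n ^ 2 * (|m| ^ (5 / 8 : ℝ) * |α| ^ (5 / 8 : ℝ)) := by
    calc (|α| + M) ^ (3 / 8 : ℝ) * M ^ (1 / 4 : ℝ)
        ≤ (2 * S) ^ (3 / 8 : ℝ) * S ^ (1 / 4 : ℝ) := by gcongr; linarith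
      _ = 2 ^ (3 / 8 : ℝ) * S ^ (5 / 8 : ℝ) := by
          rw [Real.mul_rpow (by norm_num) hS0.le, mul_assoc, ← Real.rpow_add hS0]; norm_num
      _ ≤ 2 ^ (1 : ℝ) * S ^ (5 / 8 : ℝ) := by gcongr <;> norm_num
      _ = 2 * (n ^ (15 / 8 : ℝ) * (|m| ^ (5 / 8 : ℝ) * |α| ^ (5 / 8 : ℝ))) := by
          rw [hS, Real.mul_rpow (by positivity) (by positivity),
            Real.mul_rpow (by positivity) (by positivity), ← Real.rpow_natCast n 3,
            ← Real.rpow_mul (by positivity)]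
          norm_num
      _ ≤ 2 * (n ^ (2 : ℝ) * (|m| ^ (5 / 8 : ℝ) * |α| ^ (5 / 8 : ℝ))) := by
          gcongr
          norm_num
      _ = _ := by rw [Real.rpow_two]; ring
  calc kernelSq β k T ξ η * (C * ((|α| + M) ^ (3 / 8 : ℝ) * M ^ (1 / 4 : ℝ)))
      ≤ kernelSq β k T ξ η * (C * (2 * n ^ 2 * (|m| ^ (5 / 8 : ℝ) * |α| ^ (5 / 8 : ℝ)))) := by
        gcongr
    _ = _ := by unfold weightedKernelSq; ring

theorem kernelSq_region1_base {β C : ℝ} (hC1 : 1 ≤ C) (hC : ∀ ξ α K : ℝ, 1 ≤ K →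
      ENNReal.ofReal (ξ ^ 2) * volume {x : ℝ | |α + Phi β ξ x (ξ - x)| ≤ K} ≤
        ENNReal.ofReal (C * ((|α| + K) ^ (3 / 8 : ℝ) * K ^ (1 / 4 : ℝ))))
    {δ N : ℝ} (hN : 1 < N) (T : OrderedTree 1) (ξ : ℝ) :
    ∫⁻ η, (region1 β δ N T ξ).indicator (fun η => ENNReal.ofReal (kernelSq β 0 T ξ η)) η ≤
      ENNReal.ofReal (C * N) := by
  obtain ⟨T, a, rfl⟩ := T.exists_eq_grow
  rw [lintegral_snoc (measurable_indicator_section (measurableSet_region1 β δ N _)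
    (measurable_kernelSq β 0 _) ξ)]
  have hmeas : MeasurableSet {x | |0 + Phi β ξ x (ξ - x)| ≤ N} := by
    refine measurableSet_le (Continuous.measurable ?_).abs measurable_const
    unfold Phi; fun_prop
  have h : ∀ (η : Fin 0 → ℝ) (x : ℝ), (region1 β δ N (T.grow a) ξ).indicator
      (fun η => ENNReal.ofReal (kernelSq β 0 (T.grow a) ξ η))
        (Fin.snoc (α := fun _ => ℝ) η x) =
      {x | |0 + Phi β ξ x (ξ - x)| ≤ N}.indicator (fun _ => ENNReal.ofReal (ξ ^ 2)) x := by
    intro η x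
    have hmem : Fin.snoc (α := fun _ => ℝ) η x ∈ region1 β δ N (T.grow a) ξ ↔
        |0 + Phi β ξ x (ξ - x)| ≤ N := by
      rw [← muTilde_snoc_one β T a ξ η x]
      unfold region1
      rw [if_pos rfl, ← not_lt]
      have : CondC β δ N (T.grow a) ξ (Fin.snoc (α := fun _ => ℝ) η x) 0 ↔
          N < |muTilde β (T.grow a) ξ (Fin.snoc (α := fun _ => ℝ) η x) 1| := by
        rw [CondC, if_pos rfl]
      exact not_congr this
    by_cases hx : |0 + Phi β ξ x (ξ - x)| ≤ N
    · rw [Set.indicator_of_mem (hmem.2 hx), Set.indicator_of_mem (by exact hx),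
        kernelSq_snoc_of_le _ _ _ _ _ _ le_rfl]
      congr 1
      simp [kernelSq, leafFreq]
    · rw [Set.indicator_of_notMem (mt hmem.1 hx), Set.indicator_of_notMem (by exact hx)]
  simp_rw [h]
  rw [lintegral_fin_zero, lintegral_indicator hmeas, setLIntegral_const]
  refine (hC ξ 0 N hN.le).trans (ENNReal.ofReal_le_ofReal ?_)
  have hN0 : 0 < N := by linarith
  rw [abs_zero, zero_add, ← Real.rpow_add hN0]
  gcongr
  calc N ^ (3 / 8 + 1 / 4 : ℝ) ≤ N ^ (1 : ℝ) := by
        gcongr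
        · exact hN.le
        · norm_num
    _ = N := Real.rpow_one N

/-- The kernel estimates. The factor `1 / (k!)²` is the square of what is needed in order to sum over
the `k!` ordered trees. -/
theorem exists_kernel_bound (β : ℝ) {δ : ℝ} (hδ₀ : 0 < δ) (hδ : δ < 1) : ∃ B : ℝ, 1 ≤ B ∧
    ∀ N : ℝ, 1 < N → ∀ k : ℕ,
      (∀ (T : OrderedTree (k + 1)) (ξ : ℝ), ∫⁻ η, (region0 β δ N T ξ).indicator
        (fun η => ENNReal.ofReal (kernelSq β (k + 1) T ξ η)) η ≤
          ENNReal.ofReal ((B * N ^ (-((1 - δ) / 8))) ^ (k + 1) / ((k + 1).factorial : ℝ) ^ 2)) ∧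
      (∀ (T : OrderedTree (k + 1)) (ξ : ℝ), ∫⁻ η, (region1 β δ N T ξ).indicator
        (fun η => ENNReal.ofReal (kernelSq β k T ξ η)) η ≤
          ENNReal.ofReal (B * (2 * (k : ℝ) + 3) ^ 2 * N *
            ((B * N ^ (-((1 - δ) / 8))) ^ k / (k.factorial : ℝ) ^ 2))) := by
  obtain ⟨C₁, h1, hC₁⟩ := exists_tail_bound β (show (5 / 8 : ℝ) < 3 / 4 by norm_num)
  obtain ⟨C₂, h2, hC₂⟩ := exists_tail_bound β (show (5 / 8 : ℝ) < 11 / 8 by norm_num)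
  obtain ⟨C₃, h3, hC₃⟩ := exists_sublevel_bound β
  refine ⟨C₁ + C₂ + 2 * C₃, by linarith, fun N hN => ?_⟩
  set B := C₁ + C₂ + 2 * C₃ with hB
  have hN0 : 0 < N := by linarith
  set ν := N ^ (-((1 - δ) / 8)) with hν
  have hν0 : 0 < ν := by positivity
  have hP : ∀ k : ℕ, ∀ (T : OrderedTree (k + 1)) (ξ : ℝ), ∫⁻ η, (region0 β δ N T ξ).indicator
      (fun η => ENNReal.ofReal (weightedKernelSq β T ξ η)) η ≤
        ENNReal.ofReal ((B * ν) ^ (k + 1) / ((k + 1).factorial : ℝ) ^ 2) := by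
    intro k
    induction k with
    | zero =>
      intro T ξ
      refine (weightedKernelSq_base hC₁ hN δ T ξ).trans (ENNReal.ofReal_le_ofReal ?_)
      have : N ^ (-(1 / 8) : ℝ) ≤ ν := by
        rw [hν]
        gcongr
        · exact hN.le
        · linarith
      simp only [zero_add, pow_one, Nat.factorial_one, Nat.cast_one, one_pow, div_one]
      gcongr
      linarith
    | succ k ih =>
      intro T ξ
      obtain ⟨T, a, rfl⟩ := T.exists_eq_grow
      refine (weightedKernelSq_step h2 hC₂ hδ hN (by omega) T a ξ).trans
        ((mul_le_mul_right (ih T ξ) _).trans ?_)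
      rw [← ENNReal.ofReal_mul (by positivity)]
      refine ENNReal.ofReal_le_ofReal ?_
      rw [Nat.factorial_succ (k + 1)]
      calc C₂ * (ν / (((k + 1 : ℕ) : ℝ) + 1) ^ 2) *
            ((B * ν) ^ (k + 1) / ((k + 1).factorial : ℝ) ^ 2)
          ≤ B * (ν / (((k + 1 : ℕ) : ℝ) + 1) ^ 2) *
            ((B * ν) ^ (k + 1) / ((k + 1).factorial : ℝ) ^ 2) := by
            gcongr; linarith
        _ = _ := by
            have := Nat.factorial_pos (k + 1)
            push_cast
            field_simp
            ring
  intro k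
  constructor
  · intro T ξ
    refine (lintegral_mono fun η => ?_).trans (hP k T ξ)
    by_cases hη : η ∈ region0 β δ N T ξ
    · rw [Set.indicator_of_mem hη, Set.indicator_of_mem hη]
      exact ENNReal.ofReal_le_ofReal (kernelSq_le_weightedKernelSq hδ hN (by omega) hη)
    · rw [Set.indicator_of_notMem hη]; exact zero_le
  · intro T ξ
    rcases k with _ | k
    · refine (kernelSq_region1_base h3 hC₃ hN T ξ).trans (ENNReal.ofReal_le_ofReal ?_)
      norm_num
      nlinarith
    · obtain ⟨T, a, rfl⟩ := T.exists_eq_grow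
      refine (kernelSq_region1_step h3 hC₃ hδ₀ hδ hN (by omega) T a ξ).trans
        ((mul_le_mul_right (hP k T ξ) _).trans ?_)
      rw [← ENNReal.ofReal_mul (by positivity)]
      refine ENNReal.ofReal_le_ofReal ?_
      gcongr ?_ * _
      calc 2 * C₃ * (2 * ((k + 1 : ℕ) : ℝ) + 3) ^ 2
          ≤ B * (2 * ((k + 1 : ℕ) : ℝ) + 3) ^ 2 * 1 := by rw [mul_one]; gcongr; linarith
        _ ≤ _ := by gcongr

/-! ### Integration over index functions -/

theorem lintegral_convolution {f g : ℝ → ℝ≥0∞} (hf : Measurable f) (hg : Measurable g) :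
    ∫⁻ y, ∫⁻ x, f x * g (y - x) = (∫⁻ x, f x) * ∫⁻ x, g x := by
  rw [lintegral_lintegral_swap (by fun_prop)]
  calc ∫⁻ x, ∫⁻ y, f x * g (y - x) = ∫⁻ x, f x * ∫⁻ y, g y := by
        refine lintegral_congr fun x => ?_
        rw [lintegral_const_mul _ (by fun_prop), lintegral_sub_right_eq_self g x]
    _ = _ := lintegral_mul_const _ hf

/-- The terminal nodes of a tree are linear coordinates of unit Jacobian on the space of index
functions. -/
theorem lintegral_prod_leafFreq : ∀ (k : ℕ) (T : OrderedTree k) (g : Fin (k + 1) → ℝ → ℝ≥0∞),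
    (∀ b, Measurable (g b)) →
    ∫⁻ ξ, ∫⁻ η, ∏ b, g b (leafFreq k T ξ η b) = ∏ b, ∫⁻ x, g b x
  | 0, T, g, _ => by
    simp only [leafFreq, lintegral_fin_zero]
    simp
  | k + 1, T, g, hg => by
    obtain ⟨T, a, rfl⟩ := T.exists_eq_grow
    -- The last expansion replaces the terminal node `a` by two nodes with the same sum. Integrating over
    -- the new frequency gives the tree `T` with the convolution of the two factors at `a`.
    set c : ℝ → ℝ≥0∞ := fun y => ∫⁻ x, g a.castSucc x * g (Fin.last (k + 1)) (y - x) with hc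
    set h : Fin (k + 1) → ℝ → ℝ≥0∞ := Function.update (fun b => g b.castSucc) a c with hh
    have hcm : Measurable c := by
      have h1 := hg a.castSucc
      have h2 := hg (Fin.last (k + 1))
      have : Measurable fun p : ℝ × ℝ => g a.castSucc p.2 * g (Fin.last (k + 1)) (p.1 - p.2) := by
        fun_prop
      exact this.lintegral_prod_right'
    have hhm : ∀ b, Measurable (h b) := by
      intro b
      rcases eq_or_ne b a with rfl | hb
      · rw [hh, Function.update_self]; exact hcm
      · rw [hh, Function.update_of_ne hb]; exact hg _
    have hin : ∀ (ξ : ℝ), ∫⁻ η, ∏ b, g b (leafFreq (k + 1) (T.grow a) ξ η b) =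
        ∫⁻ η, ∏ b, h b (leafFreq k T ξ η b) := by
      intro ξ
      rw [lintegral_snoc]
      swap
      · refine Finset.measurable_prod _ fun b _ => (hg b).comp ?_
        exact (continuous_leafFreq (k + 1) (T.grow a) b).measurable.comp measurable_prodMk_left
      refine lintegral_congr fun η => ?_
      have h1 : ∀ x, ∏ b, g b (leafFreq (k + 1) (T.grow a) ξ (Fin.snoc (α := fun _ => ℝ) η x) b) =
          (∏ b ∈ Finset.univ.erase a, g b.castSucc (leafFreq k T ξ η b)) *
            (g a.castSucc x * g (Fin.last (k + 1)) (leafFreq k T ξ η a - x)) := by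
        intro x
        rw [Fin.prod_univ_castSucc, leafFreq_snoc_last,
          ← Finset.mul_prod_erase _ _ (Finset.mem_univ a)]
        simp only [leafFreq_snoc_castSucc, Function.update_self]
        rw [Finset.prod_congr rfl fun b hb => by
          rw [Function.update_of_ne (Finset.ne_of_mem_erase hb)]]
        ring
      simp_rw [h1]
      have h2 := hg a.castSucc
      have h3 := hg (Fin.last (k + 1))
      rw [lintegral_const_mul _ (by fun_prop), ← Finset.mul_prod_erase _ _ (Finset.mem_univ a), hh,
        Function.update_self, mul_comm]
      congr 1
      refine Finset.prod_congr rfl fun b hb => ?_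
      rw [Function.update_of_ne (Finset.ne_of_mem_erase hb)]
    simp_rw [hin]
    rw [lintegral_prod_leafFreq k T h hhm, ← Finset.mul_prod_erase _ _ (Finset.mem_univ a),
      Fin.prod_univ_castSucc, ← Finset.mul_prod_erase _ _ (Finset.mem_univ a), hh,
      Function.update_self, lintegral_convolution (hg _) (hg _)]
    rw [Finset.prod_congr rfl fun b hb => by
      rw [Function.update_of_ne (Finset.ne_of_mem_erase hb)]]
    ring

theorem eLpNorm_two_sq {α : Type*} [MeasurableSpace α] {μ : Measure α} (f : α → ℂ) :
    eLpNorm f 2 μ ^ 2 = ∫⁻ x, ‖f x‖ₑ ^ 2 ∂μ := by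
  rw [eLpNorm_eq_lintegral_rpow_enorm_toReal two_ne_zero ENNReal.ofNat_ne_top,
    ← ENNReal.rpow_natCast, ← ENNReal.rpow_mul]
  norm_num

theorem eLpNorm_prod_leafFreq {k : ℕ} (T : OrderedTree k) (f : Fin (k + 1) → ℝ → ℂ)
    (hf : ∀ b, Measurable (f b)) :
    eLpNorm (fun p : ℝ × (Fin k → ℝ) => ∏ b, f b (leafFreq k T p.1 p.2 b)) 2
      (volume.prod volume) = ∏ b, eLpNorm (f b) 2 volume := by
  refine (ENNReal.pow_right_strictMono two_ne_zero).injective ?_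
  rw [← Finset.prod_pow, eLpNorm_two_sq]
  simp_rw [eLpNorm_two_sq]
  rw [← lintegral_prod_leafFreq k T _ fun b => (hf b).enorm.pow_const 2, lintegral_prod]
  · simp only [enorm_eq_nnnorm, nnnorm_prod, ENNReal.ofNNReal_finsetProd, Finset.prod_pow]
  · refine Measurable.aemeasurable (Measurable.pow_const (Measurable.enorm ?_) 2)
    exact Finset.measurable_prod _ fun b _ =>
      (hf b).comp (continuous_leafFreq k T b).measurable

theorem bracket_le_mul (x y : ℝ) : bracket y ≤ 2 * (bracket x * bracket (y - x)) := by
  unfold bracket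
  rw [← Real.sqrt_mul (by positivity)]
  refine Real.sqrt_le_iff.2 ⟨by positivity, ?_⟩
  rw [mul_pow, Real.sq_sqrt (by positivity)]
  nlinarith [sq_nonneg (x - (y - x)), sq_nonneg (x * (y - x)), sq_nonneg x, sq_nonneg (y - x)]

theorem bracket_le_prod : ∀ (k : ℕ) (T : OrderedTree k) (ξ : ℝ) (η : Fin k → ℝ),
    bracket ξ ≤ 2 ^ k * ∏ b, bracket (leafFreq k T ξ η b)
  | 0, T, ξ, η => by simp [leafFreq]
  | k + 1, T, ξ, η => by
    obtain ⟨T, a, rfl⟩ := T.exists_eq_grow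
    obtain ⟨η, x, rfl⟩ : ∃ (η' : Fin k → ℝ) (x : ℝ), η = Fin.snoc (α := fun _ => ℝ) η' x :=
      ⟨Fin.init η, η (Fin.last k), (Fin.snoc_init_self η).symm⟩
    refine (bracket_le_prod k T ξ η).trans ?_
    rw [Fin.prod_univ_castSucc (n := k + 1), leafFreq_snoc_last,
      ← Finset.mul_prod_erase _ (fun b => bracket (leafFreq k T ξ η b)) (Finset.mem_univ a),
      ← Finset.mul_prod_erase (f := fun b : Fin (k + 1) => bracket (leafFreq (k + 1) (T.grow a) ξ
        (Fin.snoc (α := fun _ => ℝ) η x) b.castSucc)) _ (Finset.mem_univ a)]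
    simp only [leafFreq_snoc_castSucc, Function.update_self]
    have hcongr : ∏ b ∈ Finset.univ.erase a, bracket (Function.update (leafFreq k T ξ η) a x b) =
        ∏ b ∈ Finset.univ.erase a, bracket (leafFreq k T ξ η b) :=
      Finset.prod_congr rfl fun b hb => by rw [Function.update_of_ne (Finset.ne_of_mem_erase hb)]
    rw [hcongr]
    have hP : 0 ≤ ∏ b ∈ Finset.univ.erase a, bracket (leafFreq k T ξ η b) :=
      Finset.prod_nonneg fun b _ => (bracket_pos _).le
    have := bracket_le_mul x (leafFreq k T ξ η a)
    calc _ ≤ 2 ^ k * ((2 * (bracket x * bracket (leafFreq k T ξ η a - x))) *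
          ∏ b ∈ Finset.univ.erase a, bracket (leafFreq k T ξ η b)) := by gcongr
      _ = _ := by ring

theorem bracket_rpow_le_prod {s : ℝ} (hs : 0 ≤ s) {k : ℕ} (T : OrderedTree k) (ξ : ℝ)
    (η : Fin k → ℝ) :
    bracket ξ ^ s ≤ (2 ^ s) ^ k * ∏ b, bracket (leafFreq k T ξ η b) ^ s := by
  calc bracket ξ ^ s ≤ (2 ^ k * ∏ b, bracket (leafFreq k T ξ η b)) ^ s :=
        Real.rpow_le_rpow (bracket_pos ξ).le (bracket_le_prod k T ξ η) hs
    _ = _ := by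
        rw [Real.mul_rpow (by positivity) (Finset.prod_nonneg fun b _ => (bracket_pos _).le),
          Real.finsetProd_rpow _ _ fun b _ => (bracket_pos _).le, ← Real.rpow_natCast,
          ← Real.rpow_natCast, ← Real.rpow_mul (by norm_num), ← Real.rpow_mul (by norm_num),
          mul_comm s]

/-! ### Integral operators with square integrable kernels -/

section CauchySchwarz

variable {α : Type*} [MeasurableSpace α] {μ : Measure α} {κ G : ℝ × α → ℂ} {A : ℝ≥0∞}

theorem sq_lintegral_mul_le (hκ : Measurable κ) (hG : Measurable G)
    (hA : ∀ ξ, ∫⁻ η, ‖κ (ξ, η)‖ₑ ^ 2 ∂μ ≤ A ^ 2) (ξ : ℝ) :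
    (∫⁻ η, ‖κ (ξ, η) * G (ξ, η)‖ₑ ∂μ) ^ 2 ≤ A ^ 2 * ∫⁻ η, ‖G (ξ, η)‖ₑ ^ 2 ∂μ := by
  have h := ENNReal.lintegral_mul_le_Lp_mul_Lq μ Real.HolderConjugate.two_two
    (f := fun η => ‖κ (ξ, η)‖ₑ) (g := fun η => ‖G (ξ, η)‖ₑ)
    (hκ.comp measurable_prodMk_left).enorm.aemeasurable
    (hG.comp measurable_prodMk_left).enorm.aemeasurable
  simp only [Pi.mul_apply, ENNReal.rpow_two] at h
  simp only [enorm_mul]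
  calc _ ≤ ((∫⁻ η, ‖κ (ξ, η)‖ₑ ^ 2 ∂μ) ^ (1 / 2 : ℝ) *
        (∫⁻ η, ‖G (ξ, η)‖ₑ ^ 2 ∂μ) ^ (1 / 2 : ℝ)) ^ 2 := by gcongr
    _ = (∫⁻ η, ‖κ (ξ, η)‖ₑ ^ 2 ∂μ) * ∫⁻ η, ‖G (ξ, η)‖ₑ ^ 2 ∂μ := by
        rw [mul_pow, ← ENNReal.rpow_natCast, ← ENNReal.rpow_natCast, ← ENNReal.rpow_mul,
          ← ENNReal.rpow_mul]
        norm_num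
    _ ≤ _ := by gcongr; exact hA ξ

theorem ae_integrable_kernel_mul [SFinite μ] (hκ : Measurable κ) (hG : Measurable G)
    (hA : ∀ ξ, ∫⁻ η, ‖κ (ξ, η)‖ₑ ^ 2 ∂μ ≤ A ^ 2) (hAtop : A ≠ ∞)
    (hG2 : eLpNorm G 2 (volume.prod μ) ≠ ∞) :
    ∀ᵐ ξ : ℝ, Integrable (fun η => κ (ξ, η) * G (ξ, η)) μ := by
  have h1 : ∫⁻ ξ, ∫⁻ η, ‖G (ξ, η)‖ₑ ^ 2 ∂μ ≠ ∞ := by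
    rw [← lintegral_prod _ (hG.enorm.pow_const 2).aemeasurable, ← eLpNorm_two_sq]
    exact ENNReal.pow_ne_top hG2
  filter_upwards [ae_lt_top (hG.enorm.pow_const 2).lintegral_prod_right' h1] with ξ hξ
  refine ⟨((hκ.mul hG).comp measurable_prodMk_left).aestronglyMeasurable, ?_⟩
  have h2 := (sq_lintegral_mul_le hκ hG hA ξ).trans_lt
    (ENNReal.mul_lt_top (ENNReal.pow_lt_top hAtop.lt_top) hξ)
  exact (ENNReal.pow_lt_top_iff.1 h2).resolve_right two_ne_zero

theorem eLpNorm_integral_kernel_mul_le [SFinite μ] (hκ : Measurable κ) (hG : Measurable G)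
    (hA : ∀ ξ, ∫⁻ η, ‖κ (ξ, η)‖ₑ ^ 2 ∂μ ≤ A ^ 2) :
    eLpNorm (fun ξ => ∫ η, κ (ξ, η) * G (ξ, η) ∂μ) 2 volume ≤
      A * eLpNorm G 2 (volume.prod μ) := by
  refine (ENNReal.pow_le_pow_left_iff two_ne_zero).1 ?_
  rw [mul_pow, eLpNorm_two_sq, eLpNorm_two_sq,
    lintegral_prod _ (hG.enorm.pow_const 2).aemeasurable,
    ← lintegral_const_mul _ (hG.enorm.pow_const 2).lintegral_prod_right']
  refine lintegral_mono fun ξ => le_trans ?_ (sq_lintegral_mul_le hκ hG hA ξ)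
  gcongr
  exact enorm_integral_le_lintegral_enorm _

theorem stronglyMeasurable_integral_kernel_mul [SFinite μ]
    (hκ : Measurable κ) (hG : Measurable G) :
    StronglyMeasurable fun ξ => ∫ η, κ (ξ, η) * G (ξ, η) ∂μ :=
  (hκ.mul hG).stronglyMeasurable.integral_prod_right'

end CauchySchwarz

/-! ### The densities of the terminal nodes -/

/-- The factor `⟨ξ⟩^s e^{iτμ̃_k} ∏_a ŵ(ξ_a)` that multiplies the kernel of a tree. -/
def leafDensity (s β τ : ℝ) (w : Lp ℂ 2 (volume : Measure ℝ)) {k : ℕ} (T : OrderedTree k)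
    (p : ℝ × (Fin k → ℝ)) : ℂ :=
  ((bracket p.1 ^ s : ℝ) : ℂ) * (Complex.exp (Complex.I * (τ : ℂ) * (muTilde β T p.1 p.2 k : ℂ)) *
    ∏ a : Fin (k + 1), hat w (leafFreq k T p.1 p.2 a))

theorem measurable_hat (w : Lp ℂ 2 (volume : Measure ℝ)) : Measurable (hat w) :=
  (Lp.stronglyMeasurable _).measurable.comp (by fun_prop)

theorem measurable_weightedHat (s : ℝ) (w : Lp ℂ 2 (volume : Measure ℝ)) :
    Measurable (weightedHat s w) :=
  (Complex.measurable_ofReal.comp (continuous_bracket_rpow s).measurable).mul (measurable_hat w)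

theorem measurable_leafDensity (s β τ : ℝ) (w : Lp ℂ 2 (volume : Measure ℝ)) {k : ℕ}
    (T : OrderedTree k) : Measurable (leafDensity s β τ w T) := by
  unfold leafDensity
  refine Measurable.mul ?_ (Measurable.mul ?_ ?_)
  · exact Complex.measurable_ofReal.comp
      ((continuous_bracket_rpow s).measurable.comp measurable_fst)
  · have := (continuous_muTilde β T k).measurable
    fun_prop
  · exact Finset.measurable_prod _ fun b _ =>
      (measurable_hat w).comp (continuous_leafFreq k T b).measurable

theorem norm_exp_I_mul_mul (τ μ : ℝ) : ‖Complex.exp (Complex.I * (τ : ℂ) * (μ : ℂ))‖ = 1 := by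
  rw [mul_assoc, ← Complex.ofReal_mul, mul_comm]
  exact Complex.norm_exp_ofReal_mul_I _

theorem norm_leafDensity_sub_le {s : ℝ} (hs : 0 ≤ s) (β τ : ℝ)
    (w z : Lp ℂ 2 (volume : Measure ℝ)) {k : ℕ} (T : OrderedTree k) (p : ℝ × (Fin k → ℝ)) :
    ‖leafDensity s β τ w T p - leafDensity s β τ z T p‖ ≤
      (2 ^ s) ^ k * ‖∏ a : Fin (k + 1), weightedHat s w (leafFreq k T p.1 p.2 a) -
        ∏ a : Fin (k + 1), weightedHat s z (leafFreq k T p.1 p.2 a)‖ := by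
  have h1 : ∀ v, ∏ a : Fin (k + 1), weightedHat s v (leafFreq k T p.1 p.2 a) =
      ((∏ a : Fin (k + 1), bracket (leafFreq k T p.1 p.2 a) ^ s : ℝ) : ℂ) *
        ∏ a : Fin (k + 1), hat v (leafFreq k T p.1 p.2 a) := by
    intro v
    simp only [weightedHat, Finset.prod_mul_distrib, Complex.ofReal_prod]
  rw [h1, h1, leafDensity, leafDensity, ← mul_sub, ← mul_sub, ← mul_sub, norm_mul, norm_mul,
    norm_mul, norm_exp_I_mul_mul, one_mul, Complex.norm_real, Complex.norm_real,
    Real.norm_of_nonneg (Real.rpow_nonneg (bracket_pos _).le _),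
    Real.norm_of_nonneg (Finset.prod_nonneg fun b _ => Real.rpow_nonneg (bracket_pos _).le _),
    ← mul_assoc]
  gcongr
  exact bracket_rpow_le_prod hs T p.1 p.2

theorem norm_leafDensity_le {s : ℝ} (hs : 0 ≤ s) (β τ : ℝ)
    (w : Lp ℂ 2 (volume : Measure ℝ)) {k : ℕ} (T : OrderedTree k) (p : ℝ × (Fin k → ℝ)) :
    ‖leafDensity s β τ w T p‖ ≤
      (2 ^ s) ^ k * ‖∏ a : Fin (k + 1), weightedHat s w (leafFreq k T p.1 p.2 a)‖ := by
  have h1 : ∏ a : Fin (k + 1), weightedHat s w (leafFreq k T p.1 p.2 a) =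
      ((∏ a : Fin (k + 1), bracket (leafFreq k T p.1 p.2 a) ^ s : ℝ) : ℂ) *
        ∏ a : Fin (k + 1), hat w (leafFreq k T p.1 p.2 a) := by
    simp only [weightedHat, Finset.prod_mul_distrib, Complex.ofReal_prod]
  rw [h1, leafDensity, norm_mul, norm_mul,
    norm_mul, norm_exp_I_mul_mul, one_mul, Complex.norm_real, Complex.norm_real,
    Real.norm_of_nonneg (Real.rpow_nonneg (bracket_pos _).le _),
    Real.norm_of_nonneg (Finset.prod_nonneg fun b _ => Real.rpow_nonneg (bracket_pos _).le _),
    ← mul_assoc]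
  gcongr
  exact bracket_rpow_le_prod hs T p.1 p.2

theorem enorm_Hs {s : ℝ} (w : Hs s) :
    eLpNorm (weightedHat s w.toL2) 2 volume = ENNReal.ofReal ‖w‖ := by
  rw [Hs.norm_eq, ENNReal.ofReal_toReal w.memLp.eLpNorm_ne_top]

theorem toL2_sub {s : ℝ} (w z : Hs s) : (w - z).toL2 = w.toL2 - z.toL2 := rfl

theorem eLpNorm_weightedHat_sub {s : ℝ} (w z : Hs s) :
    eLpNorm (fun ξ => weightedHat s w.toL2 ξ - weightedHat s z.toL2 ξ) 2 volume =
      ENNReal.ofReal ‖w - z‖ := by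
  rw [← enorm_Hs]
  refine eLpNorm_congr_ae ?_
  have h1 := weightedHat_add s (w.toL2 - z.toL2) z.toL2
  rw [sub_add_cancel] at h1
  filter_upwards [h1] with ξ hξ
  rw [hξ, toL2_sub, Pi.add_apply, add_sub_cancel_right]

theorem eLpNorm_leafDensity_le {s : ℝ} (hs : 0 ≤ s) (β τ : ℝ) (w : Hs s) {k : ℕ}
    (T : OrderedTree k) :
    eLpNorm (leafDensity s β τ w.toL2 T) 2 (volume.prod volume) ≤
      ENNReal.ofReal ((2 ^ s) ^ k * ‖w‖ ^ (k + 1)) := by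
  refine (eLpNorm_le_mul_eLpNorm_of_ae_le_mul
    (Filter.Eventually.of_forall (norm_leafDensity_le hs β τ w.toL2 T)) 2).trans ?_
  rw [eLpNorm_prod_leafFreq T _ fun _ => measurable_weightedHat s _,
    Finset.prod_const, enorm_Hs, ← ENNReal.ofReal_pow (norm_nonneg w),
    ← ENNReal.ofReal_mul (by positivity), Finset.card_univ, Fintype.card_fin]

/-- Telescoping a difference of products. Sums of norms are used instead of maxima because they are
easier to measure in `L²`. -/
theorem norm_prod_sub_prod_le {n : ℕ} (x y : Fin n → ℂ) :
    ‖∏ i, x i - ∏ i, y i‖ ≤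
      ∑ i, ∏ j, if j = i then ‖x i - y i‖ else ‖x j‖ + ‖y j‖ := by
  have h := (MultilinearMap.mkPiAlgebra ℂ (Fin n) ℂ).norm_image_sub_le_of_bound' zero_le_one
    (fun m => by simp) x y
  simp only [MultilinearMap.mkPiAlgebra_apply, one_mul] at h
  refine h.trans (Finset.sum_le_sum fun i _ => Finset.prod_le_prod (fun j _ => ?_) fun j _ => ?_)
  · split_ifs <;> positivity
  · split_ifs
    · exact le_rfl
    · exact max_le_add_of_nonneg (norm_nonneg _) (norm_nonneg _)

/-- The density of the terminal nodes is a multilinear function of the datum, hence Lipschitz on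
bounded sets; the constant grows only geometrically in `k`, up to the number `k + 1` of factors. -/
theorem eLpNorm_leafDensity_sub_le {s : ℝ} (hs : 0 ≤ s) (β τ : ℝ) {w z : Hs s} {R : ℝ}
    (hw : ‖w‖ ≤ R) (hz : ‖z‖ ≤ R) {k : ℕ} (T : OrderedTree k) :
    eLpNorm (leafDensity s β τ w.toL2 T - leafDensity s β τ z.toL2 T) 2 (volume.prod volume) ≤
      ENNReal.ofReal ((2 ^ s) ^ k * (((k : ℝ) + 1) * (2 * R) ^ k * ‖w - z‖)) := by
  set f := weightedHat s w.toL2 with hf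
  set g := weightedHat s z.toL2 with hg
  have hfm : Measurable f := measurable_weightedHat s _
  have hgm : Measurable g := measurable_weightedHat s _
  have hR : 0 ≤ R := (norm_nonneg w).trans hw
  let F : Fin (k + 1) → Fin (k + 1) → ℝ → ℂ := fun i j x =>
    if j = i then ((‖f x - g x‖ : ℝ) : ℂ) else ((‖f x‖ + ‖g x‖ : ℝ) : ℂ)
  have hFm : ∀ i j, Measurable (F i j) := by
    intro i j
    by_cases h : j = i
    · simp only [F, if_pos h]
      exact Complex.measurable_ofReal.comp (hfm.sub hgm).norm
    · simp only [F, if_neg h]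
      exact Complex.measurable_ofReal.comp (hfm.norm.add hgm.norm)
  have hP : ∀ i, Measurable fun p : ℝ × (Fin k → ℝ) => ∏ j, F i j (leafFreq k T p.1 p.2 j) :=
    fun i => Finset.measurable_prod _ fun j _ =>
      (hFm i j).comp (continuous_leafFreq k T j).measurable
  have hpt : ∀ p : ℝ × (Fin k → ℝ),
      ‖(leafDensity s β τ w.toL2 T - leafDensity s β τ z.toL2 T) p‖ ≤
      (2 ^ s) ^ k * ‖∑ i, ∏ j, F i j (leafFreq k T p.1 p.2 j)‖ := by
    intro p
    refine (norm_leafDensity_sub_le hs β τ w.toL2 z.toL2 T p).trans ?_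
    gcongr
    refine (norm_prod_sub_prod_le _ _).trans (le_of_eq ?_)
    have e : ∑ i, ∏ j, F i j (leafFreq k T p.1 p.2 j) = ((∑ i, ∏ j,
        (if j = i then ‖f (leafFreq k T p.1 p.2 i) - g (leafFreq k T p.1 p.2 i)‖ else
          ‖f (leafFreq k T p.1 p.2 j)‖ + ‖g (leafFreq k T p.1 p.2 j)‖) : ℝ) : ℂ) := by
      rw [Complex.ofReal_sum]
      refine Finset.sum_congr rfl fun i _ => ?_
      rw [Complex.ofReal_prod]
      refine Finset.prod_congr rfl fun j _ => ?_
      by_cases h : j = i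
      · simp [F, h]
      · simp [F, h]
    rw [e, Complex.norm_real, Real.norm_of_nonneg]
    refine Finset.sum_nonneg fun i _ => Finset.prod_nonneg fun j _ => ?_
    split_ifs <;> positivity
  refine (eLpNorm_le_mul_eLpNorm_of_ae_le_mul (Filter.Eventually.of_forall hpt) 2).trans ?_
  rw [ENNReal.ofReal_mul (by positivity)]
  gcongr
  have hterm : ∀ i, eLpNorm (fun p : ℝ × (Fin k → ℝ) => ∏ j, F i j (leafFreq k T p.1 p.2 j)) 2
      (volume.prod volume) ≤ ENNReal.ofReal ((2 * R) ^ k * ‖w - z‖) := by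
    intro i
    rw [eLpNorm_prod_leafFreq T _ (hFm i), ← Finset.mul_prod_erase _ _ (Finset.mem_univ i), mul_comm,
      ENNReal.ofReal_mul (by positivity)]
    refine mul_le_mul' ?_ (le_of_eq ?_)
    · calc ∏ j ∈ Finset.univ.erase i, eLpNorm (F i j) 2 volume
          ≤ ∏ j ∈ Finset.univ.erase i, ENNReal.ofReal (2 * R) := by
            refine Finset.prod_le_prod' fun j hj => ?_
            have : F i j = fun x => ((‖f x‖ : ℝ) : ℂ) + ((‖g x‖ : ℝ) : ℂ) := by
              funext x
              simp only [F, if_neg (Finset.ne_of_mem_erase hj)]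
              push_cast; ring
            rw [this]
            refine (eLpNorm_add_le (Complex.measurable_ofReal.comp hfm.norm).aestronglyMeasurable
              (Complex.measurable_ofReal.comp hgm.norm).aestronglyMeasurable one_le_two).trans ?_
            rw [two_mul, ENNReal.ofReal_add hR hR]
            refine add_le_add ?_ ?_
            · refine le_trans (le_of_eq ?_) ((enorm_Hs w).trans_le (ENNReal.ofReal_le_ofReal hw))
              exact eLpNorm_congr_norm_ae (Filter.Eventually.of_forall fun x => by simp [hf])
            · refine le_trans (le_of_eq ?_) ((enorm_Hs z).trans_le (ENNReal.ofReal_le_ofReal hz))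
              exact eLpNorm_congr_norm_ae (Filter.Eventually.of_forall fun x => by simp [hg])
        _ = ENNReal.ofReal ((2 * R) ^ k) := by
            rw [Finset.prod_const, Finset.card_erase_of_mem (Finset.mem_univ i), Finset.card_univ,
              Fintype.card_fin, Nat.add_sub_cancel, ENNReal.ofReal_pow (by positivity)]
    · rw [← eLpNorm_weightedHat_sub]
      exact eLpNorm_congr_norm_ae (Filter.Eventually.of_forall fun x => by simp [F, hf, hg])
  have hsum : (fun p : ℝ × (Fin k → ℝ) => ∑ i, ∏ j, F i j (leafFreq k T p.1 p.2 j)) =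
      ∑ i, fun p : ℝ × (Fin k → ℝ) => ∏ j, F i j (leafFreq k T p.1 p.2 j) := by
    funext p; simp
  rw [hsum]
  refine (eLpNorm_sum_le (fun i _ => (hP i).aestronglyMeasurable) one_le_two).trans
    ((Finset.sum_le_sum fun i _ => hterm i).trans (le_of_eq ?_))
  rw [Finset.sum_const, Finset.card_univ, Fintype.card_fin, nsmul_eq_mul, mul_assoc,
    ENNReal.ofReal_mul (p := (k : ℝ) + 1) (by positivity), ← Nat.cast_succ, ENNReal.ofReal_natCast]

/-- Strong continuity in time. -/
theorem tendsto_eLpNorm_leafDensity_sub {s : ℝ} (hs : 0 ≤ s) (β τ₀ : ℝ) (w : Hs s) {k : ℕ}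
    (T : OrderedTree k) :
    Filter.Tendsto (fun τ => eLpNorm (leafDensity s β τ w.toL2 T - leafDensity s β τ₀ w.toL2 T) 2
      (volume.prod volume)) (nhds τ₀) (nhds 0) := by
  set g : ℝ × (Fin k → ℝ) → ℂ := leafDensity s β τ₀ w.toL2 T with hg
  have hgm : Measurable g := measurable_leafDensity s β τ₀ w.toL2 T
  have hnorm : ∀ τ p, ‖leafDensity s β τ w.toL2 T p‖ₑ = ‖g p‖ₑ := by
    intro τ p
    rw [hg, enorm_eq_iff_norm_eq]
    simp only [leafDensity, norm_mul, norm_exp_I_mul_mul]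
  have hgtop : ∫⁻ p, ‖g p‖ₑ ^ 2 ∂(volume.prod volume) ≠ ∞ := by
    rw [← eLpNorm_two_sq]
    exact ENNReal.pow_ne_top ((eLpNorm_leafDensity_le hs β τ₀ w T).trans_lt
      ENNReal.ofReal_lt_top).ne
  have hsq : Filter.Tendsto (fun τ => ∫⁻ p, ‖(leafDensity s β τ w.toL2 T - g) p‖ₑ ^ 2
      ∂(volume.prod volume)) (nhds τ₀) (nhds (∫⁻ _ : ℝ × (Fin k → ℝ), 0 ∂(volume.prod volume))) := by
    refine tendsto_lintegral_filter_of_dominated_convergence (fun p => 2 ^ 2 * ‖g p‖ₑ ^ 2)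
      (Filter.Eventually.of_forall fun τ =>
        ((measurable_leafDensity s β τ w.toL2 T).sub hgm).enorm.pow_const 2)
      (Filter.Eventually.of_forall fun τ => Filter.Eventually.of_forall fun p => ?_)
      ?_ (Filter.Eventually.of_forall fun p => ?_)
    · rw [← mul_pow, two_mul]
      gcongr
      refine (enorm_sub_le).trans ?_
      rw [hnorm]
    · rw [lintegral_const_mul _ (hgm.enorm.pow_const 2)]
      exact ENNReal.mul_ne_top (by norm_num) hgtop
    · have hc : Continuous fun τ => ‖(leafDensity s β τ w.toL2 T - g) p‖ₑ ^ 2 := by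
        simp only [Pi.sub_apply, leafDensity]
        refine (ENNReal.continuous_pow 2).comp (Continuous.enorm ?_)
        fun_prop
      have := hc.tendsto τ₀
      rwa [show ‖(leafDensity s β τ₀ w.toL2 T - g) p‖ₑ ^ 2 = 0 by simp [hg]] at this
  rw [lintegral_zero] at hsq
  have h := ((ENNReal.continuous_rpow_const (y := (1 / 2 : ℝ))).tendsto 0).comp hsq
  rw [ENNReal.zero_rpow_of_pos (by norm_num)] at h
  refine h.congr fun τ => ?_
  rw [Function.comp_apply, ← eLpNorm_two_sq, ← ENNReal.rpow_natCast, ← ENNReal.rpow_mul]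
  norm_num

/-! ### Sums over trees as maps of `H^s` -/

theorem isHsHat_of_memLp {s : ℝ} (hs : 0 ≤ s) {g : ℝ → ℂ}
    (h : MemLp (fun ξ => ((bracket ξ ^ s : ℝ) : ℂ) * g ξ) 2 volume) : IsHsHat s g := by
  obtain ⟨z, hz⟩ := toWeighted_surjective hs (h.toLp _)
  refine ⟨z, ?_⟩
  have h' : weightedHat s z.toL2 =ᵐ[volume] fun ξ => ((bracket ξ ^ s : ℝ) : ℂ) * g ξ :=
    (MemLp.toLp_eq_toLp_iff z.memLp h).1 hz
  filter_upwards [h'] with ξ hξ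
  have hb : ((bracket ξ ^ s : ℝ) : ℂ) ≠ 0 :=
    Complex.ofReal_ne_zero.2 (Real.rpow_pos_of_pos (bracket_pos ξ) s).ne'
  exact mul_left_cancel₀ hb hξ

theorem hat_ofHat {s : ℝ} {g : ℝ → ℂ} (h : IsHsHat s g) :
    hat (ofHat s g).toL2 =ᵐ[volume] g := by
  rw [ofHat, dif_pos h]
  exact h.choose_spec

theorem ofReal_norm_ofHat {s : ℝ} {g : ℝ → ℂ} (h : IsHsHat s g) :
    ENNReal.ofReal ‖ofHat s g‖ =
      eLpNorm (fun ξ => ((bracket ξ ^ s : ℝ) : ℂ) * g ξ) 2 volume := by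
  rw [← enorm_Hs]
  refine eLpNorm_congr_ae ?_
  filter_upwards [hat_ofHat h] with ξ hξ
  rw [weightedHat, hξ]

theorem ofReal_norm_ofHat_sub {s : ℝ} {g h : ℝ → ℂ} (hg : IsHsHat s g) (hh : IsHsHat s h) :
    ENNReal.ofReal ‖ofHat s g - ofHat s h‖ =
      eLpNorm (fun ξ => ((bracket ξ ^ s : ℝ) : ℂ) * g ξ - ((bracket ξ ^ s : ℝ) : ℂ) * h ξ) 2
        volume := by
  rw [← eLpNorm_weightedHat_sub]
  refine eLpNorm_congr_ae ?_
  filter_upwards [hat_ofHat hg, hat_ofHat hh] with ξ h1 h2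
  rw [weightedHat, weightedHat, h1, h2]

/-- The oscillation and the terminal nodes of the integrand of a tree. -/
def leafProduct (β τ : ℝ) (w : Lp ℂ 2 (volume : Measure ℝ)) {k : ℕ} (T : OrderedTree k)
    (p : ℝ × (Fin k → ℝ)) : ℂ :=
  Complex.exp (Complex.I * (τ : ℂ) * (muTilde β T p.1 p.2 k : ℂ)) *
    ∏ a : Fin (k + 1), hat w (leafFreq k T p.1 p.2 a)

/-- The sum over all trees with `k` non-terminal nodes, with general kernels. -/
def treeSum {k : ℕ} (κ : OrderedTree k → ℝ × (Fin k → ℝ) → ℂ) (β τ : ℝ)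
    (w : Lp ℂ 2 (volume : Measure ℝ)) (ξ : ℝ) : ℂ :=
  -∑ T : OrderedTree k, ∫ η, κ T (ξ, η) * leafProduct β τ w T (ξ, η)

section TreeSum

variable {k : ℕ} {κ : OrderedTree k → ℝ × (Fin k → ℝ) → ℂ} {A s : ℝ}

theorem weight_mul_treeSum (β τ : ℝ) (w : Lp ℂ 2 (volume : Measure ℝ)) (ξ : ℝ) :
    ((bracket ξ ^ s : ℝ) : ℂ) * treeSum κ β τ w ξ =
      -∑ T : OrderedTree k, ∫ η, κ T (ξ, η) * leafDensity s β τ w T (ξ, η) := by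
  rw [treeSum, mul_neg, Finset.mul_sum]
  congr 1
  refine Finset.sum_congr rfl fun T _ => ?_
  rw [← integral_const_mul]
  congr 1
  funext η
  rw [leafDensity, leafProduct]; ring

theorem ae_integrable_treeKernel_mul (hs : 0 ≤ s) (hκ : ∀ T, Measurable (κ T))
    (hA : ∀ T ξ, ∫⁻ η, ‖κ T (ξ, η)‖ₑ ^ 2 ≤ ENNReal.ofReal A ^ 2) (β τ : ℝ) (w : Hs s)
    (T : OrderedTree k) :
    ∀ᵐ ξ : ℝ, Integrable fun η => κ T (ξ, η) * leafDensity s β τ w.toL2 T (ξ, η) :=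
  ae_integrable_kernel_mul (hκ T) (measurable_leafDensity s β τ w.toL2 T) (hA T)
    ENNReal.ofReal_ne_top ((eLpNorm_leafDensity_le hs β τ w T).trans_lt ENNReal.ofReal_lt_top).ne

theorem ae_integrable_treeKernel_mul_leafProduct (hs : 0 ≤ s) (hκ : ∀ T, Measurable (κ T))
    (hA : ∀ T ξ, ∫⁻ η, ‖κ T (ξ, η)‖ₑ ^ 2 ≤ ENNReal.ofReal A ^ 2) (β τ : ℝ) (w : Hs s)
    (T : OrderedTree k) :
    ∀ᵐ ξ : ℝ, Integrable fun η => κ T (ξ, η) * leafProduct β τ w.toL2 T (ξ, η) := by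
  filter_upwards [ae_integrable_treeKernel_mul hs hκ hA β τ w T] with ξ hξ
  have hb : ((bracket ξ ^ s : ℝ) : ℂ) ≠ 0 :=
    Complex.ofReal_ne_zero.2 (Real.rpow_pos_of_pos (bracket_pos ξ) s).ne'
  refine (hξ.const_mul (((bracket ξ ^ s : ℝ) : ℂ)⁻¹)).congr (Filter.Eventually.of_forall fun η => ?_)
  simp only [leafDensity, leafProduct]
  field_simp

theorem eLpNorm_weight_mul_treeSum_le (hκ : ∀ T, Measurable (κ T))
    (hA : ∀ T ξ, ∫⁻ η, ‖κ T (ξ, η)‖ₑ ^ 2 ≤ ENNReal.ofReal A ^ 2) (β τ : ℝ)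
    (w : Lp ℂ 2 (volume : Measure ℝ)) :
    eLpNorm (fun ξ => ((bracket ξ ^ s : ℝ) : ℂ) * treeSum κ β τ w ξ) 2 volume ≤
      ∑ T : OrderedTree k, ENNReal.ofReal A *
        eLpNorm (leafDensity s β τ w T) 2 (volume.prod volume) := by
  have h : (fun ξ => ((bracket ξ ^ s : ℝ) : ℂ) * treeSum κ β τ w ξ) =
      -∑ T : OrderedTree k, fun ξ => ∫ η, κ T (ξ, η) * leafDensity s β τ w T (ξ, η) := by
    funext ξ
    rw [weight_mul_treeSum]; simp
  rw [h, eLpNorm_neg]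
  refine (eLpNorm_sum_le (fun T _ => (stronglyMeasurable_integral_kernel_mul (hκ T)
    (measurable_leafDensity s β τ w T)).aestronglyMeasurable) one_le_two).trans ?_
  exact Finset.sum_le_sum fun T _ =>
    eLpNorm_integral_kernel_mul_le (hκ T) (measurable_leafDensity s β τ w T) (hA T)

theorem isHsHat_treeSum (hs : 0 ≤ s) (hκ : ∀ T, Measurable (κ T))
    (hA : ∀ T ξ, ∫⁻ η, ‖κ T (ξ, η)‖ₑ ^ 2 ≤ ENNReal.ofReal A ^ 2) (β τ : ℝ) (w : Hs s) :
    IsHsHat s (treeSum κ β τ w.toL2) := by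
  refine isHsHat_of_memLp hs ⟨?_, ?_⟩
  · have h : (fun ξ => ((bracket ξ ^ s : ℝ) : ℂ) * treeSum κ β τ w.toL2 ξ) =
        fun ξ => -∑ T : OrderedTree k, ∫ η, κ T (ξ, η) * leafDensity s β τ w.toL2 T (ξ, η) :=
      funext fun ξ => weight_mul_treeSum β τ w.toL2 ξ
    rw [h]
    exact (Finset.stronglyMeasurable_fun_sum _ fun T _ => stronglyMeasurable_integral_kernel_mul
      (hκ T) (measurable_leafDensity s β τ w.toL2 T)).neg.aestronglyMeasurable
  · refine (eLpNorm_weight_mul_treeSum_le hκ hA β τ w.toL2).trans_lt ?_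
    exact ENNReal.sum_lt_top.2 fun T _ => ENNReal.mul_lt_top ENNReal.ofReal_lt_top
      ((eLpNorm_leafDensity_le hs β τ w T).trans_lt ENNReal.ofReal_lt_top)

theorem ofReal_norm_ofHat_treeSum_sub_le (hs : 0 ≤ s) (hκ : ∀ T, Measurable (κ T))
    (hA : ∀ T ξ, ∫⁻ η, ‖κ T (ξ, η)‖ₑ ^ 2 ≤ ENNReal.ofReal A ^ 2) (β τ σ : ℝ) (w z : Hs s) :
    ENNReal.ofReal ‖ofHat s (treeSum κ β τ w.toL2) - ofHat s (treeSum κ β σ z.toL2)‖ ≤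
      ∑ T : OrderedTree k, ENNReal.ofReal A *
        eLpNorm (leafDensity s β τ w.toL2 T - leafDensity s β σ z.toL2 T) 2
          (volume.prod volume) := by
  rw [ofReal_norm_ofHat_sub (isHsHat_treeSum hs hκ hA β τ w) (isHsHat_treeSum hs hκ hA β σ z)]
  have hm : ∀ T : OrderedTree k, Measurable (leafDensity s β τ w.toL2 T - leafDensity s β σ z.toL2 T) := fun T =>
    (measurable_leafDensity s β τ w.toL2 T).sub (measurable_leafDensity s β σ z.toL2 T)
  have h : (fun ξ => ((bracket ξ ^ s : ℝ) : ℂ) * treeSum κ β τ w.toL2 ξ -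
      ((bracket ξ ^ s : ℝ) : ℂ) * treeSum κ β σ z.toL2 ξ) =ᵐ[volume]
      -∑ T : OrderedTree k, fun ξ => ∫ η, κ T (ξ, η) *
        (leafDensity s β τ w.toL2 T - leafDensity s β σ z.toL2 T) (ξ, η) := by
    have h1 := ae_all_iff.2 fun T => ae_integrable_treeKernel_mul hs hκ hA β τ w T
    have h2 := ae_all_iff.2 fun T => ae_integrable_treeKernel_mul hs hκ hA β σ z T
    filter_upwards [h1, h2] with ξ k1 k2
    rw [weight_mul_treeSum, weight_mul_treeSum]
    simp only [Pi.neg_apply, Finset.sum_apply, Pi.sub_apply, mul_sub]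
    rw [neg_sub_neg, ← neg_sub, ← Finset.sum_sub_distrib]
    congr 1
    refine Finset.sum_congr rfl fun T _ => ?_
    rw [integral_sub (k1 T) (k2 T)]
  rw [eLpNorm_congr_ae h, eLpNorm_neg]
  refine (eLpNorm_sum_le (fun T _ => (stronglyMeasurable_integral_kernel_mul (hκ T)
    (hm T)).aestronglyMeasurable) one_le_two).trans ?_
  exact Finset.sum_le_sum fun T _ => eLpNorm_integral_kernel_mul_le (hκ T) (hm T) (hA T)

theorem norm_ofHat_treeSum_le (hs : 0 ≤ s) (hA0 : 0 ≤ A) (hκ : ∀ T, Measurable (κ T))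
    (hA : ∀ T ξ, ∫⁻ η, ‖κ T (ξ, η)‖ₑ ^ 2 ≤ ENNReal.ofReal A ^ 2) (β τ : ℝ) (w : Hs s) :
    ‖ofHat s (treeSum κ β τ w.toL2)‖ ≤ k.factorial * (A * ((2 ^ s) ^ k * ‖w‖ ^ (k + 1))) := by
  refine (ENNReal.ofReal_le_ofReal_iff (by positivity)).1 ?_
  rw [ofReal_norm_ofHat (isHsHat_treeSum hs hκ hA β τ w)]
  refine (eLpNorm_weight_mul_treeSum_le hκ hA β τ w.toL2).trans ?_
  refine (Finset.sum_le_sum fun T _ => mul_le_mul_right (eLpNorm_leafDensity_le hs β τ w T) _).trans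
    (le_of_eq ?_)
  rw [Finset.sum_const, Finset.card_univ, OrderedTree.card, nsmul_eq_mul,
    ← ENNReal.ofReal_mul hA0, ENNReal.ofReal_mul (p := (k.factorial : ℝ)) (by positivity),
    ENNReal.ofReal_natCast]

theorem norm_ofHat_treeSum_sub_le (hs : 0 ≤ s) (hA0 : 0 ≤ A) (hκ : ∀ T, Measurable (κ T))
    (hA : ∀ T ξ, ∫⁻ η, ‖κ T (ξ, η)‖ₑ ^ 2 ≤ ENNReal.ofReal A ^ 2) (β τ : ℝ) {w z : Hs s} {R : ℝ}
    (hw : ‖w‖ ≤ R) (hz : ‖z‖ ≤ R) :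
    ‖ofHat s (treeSum κ β τ w.toL2) - ofHat s (treeSum κ β τ z.toL2)‖ ≤
      k.factorial * (A * ((2 ^ s) ^ k * (((k : ℝ) + 1) * (2 * R) ^ k * ‖w - z‖))) := by
  have hR : 0 ≤ R := (norm_nonneg w).trans hw
  refine (ENNReal.ofReal_le_ofReal_iff (by positivity)).1 ?_
  refine (ofReal_norm_ofHat_treeSum_sub_le hs hκ hA β τ τ w z).trans ?_
  refine (Finset.sum_le_sum fun T _ =>
    mul_le_mul_right (eLpNorm_leafDensity_sub_le hs β τ hw hz T) _).trans (le_of_eq ?_)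
  rw [Finset.sum_const, Finset.card_univ, OrderedTree.card, nsmul_eq_mul,
    ← ENNReal.ofReal_mul hA0, ENNReal.ofReal_mul (p := (k.factorial : ℝ)) (by positivity),
    ENNReal.ofReal_natCast]

theorem continuous_ofHat_treeSum (hs : 0 ≤ s) (hκ : ∀ T, Measurable (κ T))
    (hA : ∀ T ξ, ∫⁻ η, ‖κ T (ξ, η)‖ₑ ^ 2 ≤ ENNReal.ofReal A ^ 2) (β : ℝ) (w : Hs s) :
    Continuous fun τ => ofHat s (treeSum κ β τ w.toL2) := by
  refine continuous_iff_continuousAt.2 fun τ₀ => ?_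
  rw [ContinuousAt, tendsto_iff_edist_tendsto_0]
  have h : Filter.Tendsto (fun τ => ∑ T : OrderedTree k, ENNReal.ofReal A *
      eLpNorm (leafDensity s β τ w.toL2 T - leafDensity s β τ₀ w.toL2 T) 2 (volume.prod volume))
      (nhds τ₀) (nhds (∑ T : OrderedTree k, ENNReal.ofReal A * 0)) :=
    tendsto_finsetSum _ fun T _ => ENNReal.Tendsto.const_mul
      (tendsto_eLpNorm_leafDensity_sub hs β τ₀ w T) (Or.inr ENNReal.ofReal_ne_top)
  simp only [mul_zero, Finset.sum_const_zero] at h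
  refine tendsto_of_tendsto_of_tendsto_of_le_of_le tendsto_const_nhds h (fun _ => zero_le)
    fun τ => ?_
  rw [edist_dist, dist_eq_norm]
  exact ofReal_norm_ofHat_treeSum_sub_le hs hκ hA β τ τ₀ w w

end TreeSum

/-! ### The terms of the normal form equation as maps of `H^s` -/

/-- The kernel of a tree in `N_0`. -/
def kernel0 (β δ N : ℝ) {k : ℕ} (T : OrderedTree k) (p : ℝ × (Fin k → ℝ)) : ℂ :=
  (region0 β δ N T p.1).indicator (treeKernel β k T p.1) p.2

/-- The kernel of a tree in `N_1`. -/
def kernel1 (β δ N : ℝ) {k : ℕ} (T : OrderedTree k) (p : ℝ × (Fin k → ℝ)) : ℂ :=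
  (region1 β δ N T p.1).indicator (treeKernel β (k - 1) T p.1) p.2

theorem measurable_kernel0 (β δ N : ℝ) {k : ℕ} (T : OrderedTree k) :
    Measurable (kernel0 β δ N T) :=
  (measurable_treeKernel β k T).indicator (measurableSet_region0 β δ N T)

theorem measurable_kernel1 (β δ N : ℝ) {k : ℕ} (T : OrderedTree k) :
    Measurable (kernel1 β δ N T) :=
  (measurable_treeKernel β (k - 1) T).indicator (measurableSet_region1 β δ N T)

theorem enorm_indicator_treeKernel_sq (β : ℝ) (m : ℕ) {k : ℕ} (T : OrderedTree k) (ξ : ℝ)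
    (S : Set (Fin k → ℝ)) (η : Fin k → ℝ) :
    ‖S.indicator (treeKernel β m T ξ) η‖ₑ ^ 2 =
      S.indicator (fun η => ENNReal.ofReal (kernelSq β m T ξ η)) η := by
  by_cases h : η ∈ S
  · rw [Set.indicator_of_mem h, Set.indicator_of_mem h, ← norm_treeKernel_sq,
      ENNReal.ofReal_pow (norm_nonneg _), ofReal_norm]
  · simp [Set.indicator_of_notMem h]

theorem treeIntegrand_eq (β : ℝ) (m : ℕ) (τ : ℝ) (w : Lp ℂ 2 (volume : Measure ℝ)) {k : ℕ}
    (T : OrderedTree k) (ξ : ℝ) (η : Fin k → ℝ) :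
    treeIntegrand β m τ w T ξ η = treeKernel β m T ξ η * leafProduct β τ w T (ξ, η) := by
  unfold treeIntegrand treeKernel leafProduct
  ring

theorem integrand0_eq (β δ N τ : ℝ) (w : Lp ℂ 2 (volume : Measure ℝ)) {k : ℕ}
    (T : OrderedTree k) (ξ : ℝ) :
    integrand0 β δ N τ w T ξ = fun η => kernel0 β δ N T (ξ, η) * leafProduct β τ w T (ξ, η) := by
  funext η
  by_cases h : η ∈ region0 β δ N T ξ
  · simp [integrand0, kernel0, h, treeIntegrand_eq]
  · simp [integrand0, kernel0, h]

theorem integrand1_eq (β δ N τ : ℝ) (w : Lp ℂ 2 (volume : Measure ℝ)) {k : ℕ}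
    (T : OrderedTree k) (ξ : ℝ) :
    integrand1 β δ N τ w T ξ = fun η => kernel1 β δ N T (ξ, η) * leafProduct β τ w T (ξ, η) := by
  funext η
  by_cases h : η ∈ region1 β δ N T ξ
  · simp [integrand1, kernel1, h, treeIntegrand_eq]
  · simp [integrand1, kernel1, h]

theorem N0hat_eq (β δ N : ℝ) (k : ℕ) (τ : ℝ) (w : Lp ℂ 2 (volume : Measure ℝ)) :
    N0hat β δ N (k + 2) τ w = treeSum (k := k + 1) (kernel0 β δ N) β τ w := by
  funext ξ
  simp only [N0hat, treeSum, integrand0_eq]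
  rfl

theorem N1hat_eq (β δ N : ℝ) (k : ℕ) (τ : ℝ) (w : Lp ℂ 2 (volume : Measure ℝ)) :
    N1hat β δ N (k + 1) τ w = treeSum (k := k + 1) (kernel1 β δ N) β τ w := by
  funext ξ
  simp only [N1hat, treeSum, integrand1_eq]

theorem two_pow_bound (k : ℕ) : (k : ℝ) + 1 ≤ 2 ^ k := by
  have : k + 1 ≤ 2 ^ k := Nat.lt_two_pow_self
  exact_mod_cast this

/-- All the estimates for the terms of the normal form equation on the ball of radius `R` of `H^s`:
they are geometrically small in the number of generations. -/
structure TermBounds (s β δ N R p K : ℝ) : Prop where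
  wellDefined0 : ∀ (k : ℕ) (τ : ℝ) (w : Hs s), N0WellDefined β δ N (k + 2) τ w
  wellDefined1 : ∀ (k : ℕ) (τ : ℝ) (w : Hs s), N1WellDefined β δ N (k + 1) τ w
  continuous0 : ∀ (k : ℕ) (w : Hs s), Continuous fun τ => N0 β δ N (k + 2) τ w
  continuous1 : ∀ (k : ℕ) (w : Hs s), Continuous fun τ => N1 β δ N (k + 1) τ w
  norm0_le : ∀ (k : ℕ) (τ : ℝ) (w : Hs s), ‖w‖ ≤ R →
    ‖N0 β δ N (k + 2) τ w‖ ≤ p ^ (k + 1) * ‖w‖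
  norm1_le : ∀ (k : ℕ) (τ : ℝ) (w : Hs s), ‖w‖ ≤ R →
    ‖N1 β δ N (k + 1) τ w‖ ≤ K * p ^ k * ‖w‖
  sub0_le : ∀ (k : ℕ) (τ : ℝ) (w z : Hs s), ‖w‖ ≤ R → ‖z‖ ≤ R →
    ‖N0 β δ N (k + 2) τ w - N0 β δ N (k + 2) τ z‖ ≤ p ^ (k + 1) * ‖w - z‖
  sub1_le : ∀ (k : ℕ) (τ : ℝ) (w z : Hs s), ‖w‖ ≤ R → ‖z‖ ≤ R →
    ‖N1 β δ N (k + 1) τ w - N1 β δ N (k + 1) τ z‖ ≤ K * p ^ k * ‖w - z‖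

/-- The factor `k!` from the number of trees cancels against the kernel bounds. What remains of
polynomial growth in `k` is absorbed by `8 ^ k`, one half of the constant `16`; the other factor is the
radius `2R` of the Lipschitz estimate. -/
theorem exists_termBounds (β : ℝ) {δ : ℝ} (hδ₀ : 0 < δ) (hδ : δ < 1) {s : ℝ} (hs : 0 ≤ s) :
    ∃ B : ℝ, 1 ≤ B ∧ ∀ N R : ℝ, 1 < N → 0 ≤ R → ∃ K, 0 ≤ K ∧
      TermBounds s β δ N R (16 * 2 ^ s * R * √(B * N ^ (-((1 - δ) / 8)))) K := by
  obtain ⟨B, hB1, hB⟩ := exists_kernel_bound β hδ₀ hδ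
  refine ⟨B, hB1, fun N R hN hR => ?_⟩
  have hN0 : 0 < N := by linarith
  set q := √(B * N ^ (-((1 - δ) / 8))) with hq
  have hq0 : 0 ≤ q := Real.sqrt_nonneg _
  have hq2 : q ^ 2 = B * N ^ (-((1 - δ) / 8)) := Real.sq_sqrt (by positivity)
  set h := √(B * N) with hh
  have hh0 : 0 ≤ h := Real.sqrt_nonneg _
  have hh2 : h ^ 2 = B * N := Real.sq_sqrt (by positivity)
  set A₀ : ℕ → ℝ := fun k => q ^ (k + 1) / ((k + 1).factorial : ℝ) with hA₀
  set A₁ : ℕ → ℝ := fun k => h * (2 * (k : ℝ) + 3) * q ^ k / (k.factorial : ℝ) with hA₁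
  have hA₀0 : ∀ k, 0 ≤ A₀ k := fun k => by positivity
  have hA₁0 : ∀ k, 0 ≤ A₁ k := fun k => by positivity
  have hκ₀ : ∀ (k : ℕ) (T : OrderedTree (k + 1)) (ξ : ℝ),
      ∫⁻ η, ‖kernel0 β δ N T (ξ, η)‖ₑ ^ 2 ≤ ENNReal.ofReal (A₀ k) ^ 2 := by
    intro k T ξ
    simp only [kernel0, enorm_indicator_treeKernel_sq]
    refine ((hB N hN k).1 T ξ).trans (le_of_eq ?_)
    rw [← ENNReal.ofReal_pow (hA₀0 k), hA₀, ← hq2, div_pow, ← pow_mul, ← pow_mul, mul_comm 2]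
  have hκ₁ : ∀ (k : ℕ) (T : OrderedTree (k + 1)) (ξ : ℝ),
      ∫⁻ η, ‖kernel1 β δ N T (ξ, η)‖ₑ ^ 2 ≤ ENNReal.ofReal (A₁ k) ^ 2 := by
    intro k T ξ
    simp only [kernel1, enorm_indicator_treeKernel_sq, Nat.add_sub_cancel]
    refine ((hB N hN k).2 T ξ).trans (le_of_eq ?_)
    rw [← ENNReal.ofReal_pow (hA₁0 k)]
    congr 1
    simp only [hA₁]
    rw [← hq2, show (h * (2 * (k : ℝ) + 3) * q ^ k / (k.factorial : ℝ)) ^ 2 =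
      h ^ 2 * (2 * (k : ℝ) + 3) ^ 2 * ((q ^ 2) ^ k / (k.factorial : ℝ) ^ 2) by ring, hh2]
    ring
  have hs2 : (0 : ℝ) < 2 ^ s := by positivity
  have hfac : ∀ k : ℕ, (0 : ℝ) < (k.factorial : ℝ) := fun k => by exact_mod_cast k.factorial_pos
  have e₀ : ∀ k : ℕ, ((k + 1).factorial : ℝ) * A₀ k = q ^ (k + 1) := fun k => by
    simp only [hA₀]
    exact mul_div_cancel₀ _ (hfac _).ne'
  have e₁ : ∀ k : ℕ, ((k + 1).factorial : ℝ) * A₁ k =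
      h * ((k : ℝ) + 1) * (2 * (k : ℝ) + 3) * q ^ k := fun k => by
    simp only [hA₁, Nat.factorial_succ]
    have := (hfac k).ne'
    push_cast
    field_simp
  refine ⟨6 * h * 2 ^ s * (2 * R), by positivity, ?_⟩
  have hp : ∀ n : ℕ, (16 * 2 ^ s * R * q) ^ n = 8 ^ n * (q ^ n * (2 ^ s) ^ n * (2 * R) ^ n) := by
    intro n
    rw [← mul_pow, ← mul_pow, ← mul_pow]; congr 1; ring
  have hRn : ∀ n : ℕ, R ^ n ≤ (2 * R) ^ n := fun n => by gcongr; linarith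
  have h28 : ∀ n : ℕ, (2 : ℝ) ^ n ≤ 8 ^ n := fun n => by gcongr; norm_num
  have h18 : ∀ n : ℕ, (1 : ℝ) ≤ 8 ^ n := fun n => one_le_pow₀ (by norm_num)
  have hpoly : ∀ k : ℕ, ((k : ℝ) + 1) * (2 * (k : ℝ) + 3) * ((k : ℝ) + 2) ≤ 6 * 8 ^ k := by
    intro k
    have h1 := two_pow_bound k
    have hk := Nat.cast_nonneg (α := ℝ) k
    calc ((k : ℝ) + 1) * (2 * (k : ℝ) + 3) * ((k : ℝ) + 2)
        ≤ 2 ^ k * (3 * 2 ^ k) * (2 * 2 ^ k) := by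
          gcongr
          · linarith
          · linarith
      _ = 6 * (2 * 2 * 2) ^ k := by rw [mul_pow, mul_pow]; ring
      _ = _ := by norm_num
  have hpoly' : ∀ k : ℕ, ((k : ℝ) + 1) * (2 * (k : ℝ) + 3) ≤ 6 * 8 ^ k := by
    intro k
    refine le_trans ?_ (hpoly k)
    have hk := Nat.cast_nonneg (α := ℝ) k
    exact le_mul_of_one_le_right (by positivity) (by linarith)
  constructor
  · intro k τ w
    refine ⟨fun T => ?_, ?_⟩
    · have := ae_integrable_treeKernel_mul_leafProduct hs (measurable_kernel0 β δ N) (hκ₀ k) β τ w T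
      simpa only [← integrand0_eq] using this
    · rw [N0hat_eq]
      exact isHsHat_treeSum hs (measurable_kernel0 β δ N) (hκ₀ k) β τ w
  · intro k τ w
    refine ⟨fun T => ?_, ?_⟩
    · have := ae_integrable_treeKernel_mul_leafProduct hs (measurable_kernel1 β δ N) (hκ₁ k) β τ w T
      simpa only [← integrand1_eq] using this
    · rw [N1hat_eq]
      exact isHsHat_treeSum hs (measurable_kernel1 β δ N) (hκ₁ k) β τ w
  · intro k w
    simp only [N0, N0hat_eq]
    exact continuous_ofHat_treeSum hs (measurable_kernel0 β δ N) (hκ₀ k) β w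
  · intro k w
    simp only [N1, N1hat_eq]
    exact continuous_ofHat_treeSum hs (measurable_kernel1 β δ N) (hκ₁ k) β w
  · intro k τ w hw
    rw [N0, N0hat_eq]
    refine (norm_ofHat_treeSum_le hs (hA₀0 k) (measurable_kernel0 β δ N) (hκ₀ k) β τ w).trans ?_
    rw [← mul_assoc, e₀, hp, pow_succ ‖w‖]
    calc q ^ (k + 1) * ((2 ^ s) ^ (k + 1) * (‖w‖ ^ (k + 1) * ‖w‖))
        ≤ q ^ (k + 1) * ((2 ^ s) ^ (k + 1) * ((2 * R) ^ (k + 1) * ‖w‖)) := by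
          gcongr
          linarith
      _ = 1 * (q ^ (k + 1) * (2 ^ s) ^ (k + 1) * (2 * R) ^ (k + 1)) * ‖w‖ := by ring
      _ ≤ _ := by gcongr; exact h18 _
  · intro k τ w hw
    rw [N1, N1hat_eq]
    refine (norm_ofHat_treeSum_le hs (hA₁0 k) (measurable_kernel1 β δ N) (hκ₁ k) β τ w).trans ?_
    rw [← mul_assoc, e₁, hp, pow_succ ‖w‖]
    calc h * ((k : ℝ) + 1) * (2 * (k : ℝ) + 3) * q ^ k * ((2 ^ s) ^ (k + 1) * (‖w‖ ^ (k + 1) * ‖w‖))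
        ≤ h * ((k : ℝ) + 1) * (2 * (k : ℝ) + 3) * q ^ k *
          ((2 ^ s) ^ (k + 1) * ((2 * R) ^ (k + 1) * ‖w‖)) := by
          gcongr
          linarith
      _ = (((k : ℝ) + 1) * (2 * (k : ℝ) + 3)) * (h * q ^ k *
          ((2 ^ s) ^ (k + 1) * ((2 * R) ^ (k + 1) * ‖w‖))) := by ring
      _ ≤ (6 * 8 ^ k) * (h * q ^ k * ((2 ^ s) ^ (k + 1) * ((2 * R) ^ (k + 1) * ‖w‖))) := by
          exact mul_le_mul_of_nonneg_right (hpoly' k) (by positivity)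
      _ = _ := by ring
  · intro k τ w z hw hz
    rw [N0, N0, N0hat_eq, N0hat_eq]
    refine (norm_ofHat_treeSum_sub_le hs (hA₀0 k) (measurable_kernel0 β δ N) (hκ₀ k) β τ
      hw hz).trans ?_
    rw [← mul_assoc, e₀, hp]
    have h1 := (two_pow_bound (k + 1)).trans (h28 (k + 1))
    calc q ^ (k + 1) * ((2 ^ s) ^ (k + 1) *
          ((((k + 1 : ℕ) : ℝ) + 1) * (2 * R) ^ (k + 1) * ‖w - z‖))
        ≤ q ^ (k + 1) * ((2 ^ s) ^ (k + 1) * (8 ^ (k + 1) * (2 * R) ^ (k + 1) * ‖w - z‖)) := by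
          gcongr
      _ = _ := by ring
  · intro k τ w z hw hz
    rw [N1, N1, N1hat_eq, N1hat_eq]
    refine (norm_ofHat_treeSum_sub_le hs (hA₁0 k) (measurable_kernel1 β δ N) (hκ₁ k) β τ
      hw hz).trans ?_
    rw [← mul_assoc, e₁, hp]
    calc h * ((k : ℝ) + 1) * (2 * (k : ℝ) + 3) * q ^ k * ((2 ^ s) ^ (k + 1) *
          ((((k + 1 : ℕ) : ℝ) + 1) * (2 * R) ^ (k + 1) * ‖w - z‖))
        = (((k : ℝ) + 1) * (2 * (k : ℝ) + 3) * ((k : ℝ) + 2)) * (h * q ^ k *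
          ((2 ^ s) ^ (k + 1) * ((2 * R) ^ (k + 1) * ‖w - z‖))) := by push_cast; ring
      _ ≤ (6 * 8 ^ k) * (h * q ^ k * ((2 ^ s) ^ (k + 1) * ((2 * R) ^ (k + 1) * ‖w - z‖))) := by
          exact mul_le_mul_of_nonneg_right (hpoly k) (by positivity)
      _ = _ := by ring

/-! ### A fixed point argument for integral equations with a boundary term -/

/-- If a continuous function starts below the level `c` and cannot reach it for the first time, then
it stays below. -/
theorem lt_of_bootstrap {f : ℝ → ℝ} (hf : Continuous f) {c T : ℝ} (h0 : f 0 < c)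
    (h : ∀ σ ∈ Set.Icc 0 T, (∀ ρ ∈ Set.Icc 0 σ, f ρ ≤ c) → f σ < c) :
    ∀ σ ∈ Set.Icc 0 T, f σ < c := by
  by_contra! hcon
  obtain ⟨σ₀, hσ₀, hfσ₀⟩ := hcon
  obtain ⟨σ₁, hσ₁, hfσ₁⟩ := intermediate_value_Icc hσ₀.1 hf.continuousOn ⟨h0.le, hfσ₀⟩
  have hcomp : IsCompact (Set.Icc 0 T ∩ f ⁻¹' {c}) :=
    isCompact_Icc.inter_right (isClosed_singleton.preimage hf)
  obtain ⟨m, hm⟩ := hcomp.exists_isLeast ⟨σ₁, ⟨hσ₁.1, hσ₁.2.trans hσ₀.2⟩, hfσ₁⟩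
  refine (h m hm.1.1 fun ρ hρ => ?_).ne hm.1.2
  by_contra! hcρ
  obtain ⟨ρ', hρ', hfρ'⟩ := intermediate_value_Icc hρ.1 hf.continuousOn ⟨h0.le, hcρ.le⟩
  have hle := hm.2 ⟨⟨hρ'.1, hρ'.2.trans (hρ.2.trans hm.1.1.2)⟩, hfρ'⟩
  have : ρ' = ρ := le_antisymm hρ'.2 (hρ.2.trans hle)
  rw [this] at hfρ'
  linarith

theorem continuous_of_lipschitz {E : Type*} [NormedAddCommGroup E] {A : ℝ → E → E} {R c : ℝ}
    (hsub : ∀ t w z, ‖w‖ ≤ R → ‖z‖ ≤ R → ‖A t w - A t z‖ ≤ c * ‖w - z‖)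
    (hcont : ∀ w, ‖w‖ ≤ R → Continuous fun t => A t w) {V : ℝ → E} (hV : Continuous V)
    (hVR : ∀ t, ‖V t‖ ≤ R) : Continuous fun t => A t (V t) := by
  refine continuous_iff_continuousAt.2 fun t₀ => ?_
  rw [ContinuousAt, tendsto_iff_norm_sub_tendsto_zero]
  have h1 : Filter.Tendsto (fun t => c * ‖V t - V t₀‖ + ‖A t (V t₀) - A t₀ (V t₀)‖) (nhds t₀)
      (nhds 0) := by
    have e : Continuous fun t => c * ‖V t - V t₀‖ + ‖A t (V t₀) - A t₀ (V t₀)‖ := by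
      have := hcont (V t₀) (hVR t₀)
      fun_prop
    simpa using e.tendsto t₀
  refine squeeze_zero (fun _ => norm_nonneg _) (fun t => ?_) h1
  calc ‖A t (V t) - A t₀ (V t₀)‖
      = ‖(A t (V t) - A t (V t₀)) + (A t (V t₀) - A t₀ (V t₀))‖ := by congr 1; abel
    _ ≤ _ := (norm_add_le _ _).trans (add_le_add_left (hsub _ _ _ (hVR t) (hVR t₀)) _)

/-- On the ball of radius `R`, the boundary term `A` is Lipschitz with a small constant, and the
integrand `B` is Lipschitz with some constant `K`; both vanish at `0` and are continuous in time. -/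
structure PicardBounds {E : Type*} [NormedAddCommGroup E] (A B : ℝ → E → E) (R K : ℝ) : Prop where
  A_sub : ∀ t w z, ‖w‖ ≤ R → ‖z‖ ≤ R → ‖A t w - A t z‖ ≤ 1 / 8 * ‖w - z‖
  A_le : ∀ t w, ‖w‖ ≤ R → ‖A t w‖ ≤ 1 / 8 * ‖w‖
  A_cont : ∀ w, ‖w‖ ≤ R → Continuous fun t => A t w
  B_sub : ∀ t w z, ‖w‖ ≤ R → ‖z‖ ≤ R → ‖B t w - B t z‖ ≤ K * ‖w - z‖
  B_le : ∀ t w, ‖w‖ ≤ R → ‖B t w‖ ≤ K * ‖w‖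
  B_cont : ∀ w, ‖w‖ ≤ R → Continuous fun t => B t w

theorem norm_IccExtend_le {E : Type*} [NormedAddCommGroup E] {T : ℝ} (hT : 0 < T)
    (v : C(Set.Icc (-T) T, E)) (t : ℝ) :
    ‖Set.IccExtend (neg_le_self hT.le) v t‖ ≤ ‖v‖ := v.norm_coe_le_norm _

theorem continuous_IccExtend {E : Type*} [NormedAddCommGroup E] {T : ℝ} (hT : 0 < T)
    (v : C(Set.Icc (-T) T, E)) :
    Continuous (Set.IccExtend (neg_le_self hT.le) v) := v.continuous.Icc_extend'

theorem IccExtend_coe {E : Type*} [NormedAddCommGroup E] {T : ℝ} (hT : 0 < T)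
    (v : C(Set.Icc (-T) T, E)) (t : Set.Icc (-T) T) :
    Set.IccExtend (neg_le_self hT.le) v t = v t := Set.IccExtend_val _ _ _

section Picard

variable {E : Type*} [NormedAddCommGroup E] [NormedSpace ℝ E] {A B : ℝ → E → E} {r K T : ℝ}

/-- The equation `V(t) = u₀ + A(τ, V(τ))|_{τ=0}^{τ=t} + ∫_0^t B(τ, V(τ)) dτ` on `[-T, T]`. -/
def IsMildSolution (A B : ℝ → E → E) (T : ℝ) (u₀ : E) (V : ℝ → E) : Prop :=
  ∀ t ∈ Set.Icc (-T) T, V t = u₀ + (A t (V t) - A 0 (V 0)) + ∫ τ in (0 : ℝ)..t, B τ (V τ)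

theorem abs_le_of_mem_uIoc {t τ : ℝ} (h : τ ∈ Set.uIoc 0 t) : |τ| ≤ |t| := by
  rcases Set.mem_uIoc.1 h with h | h
  · rw [abs_of_pos h.1, abs_of_pos (h.1.trans_le h.2)]; exact h.2
  · rw [abs_of_nonpos h.2, abs_of_neg (h.1.trans_le h.2)]; linarith [h.1]

/-- The a priori bound: a solution that has not left the ball of radius `2r` satisfies
`‖V t‖ ≤ r + 2 · (1/8) · 2r + r/4 = 7r/4`, so it cannot reach the boundary of the ball. Nothing is
assumed about the size of `V`. -/
theorem IsMildSolution.norm_le (hP : PicardBounds A B (2 * r) K) (hr : 0 < r) (hK : 0 ≤ K)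
    (hTK : T * K ≤ 1 / 8) {u₀ : E} (hu₀ : ‖u₀‖ ≤ r) {V : ℝ → E} (hV : Continuous V)
    (h : IsMildSolution A B T u₀ V) : ∀ t ∈ Set.Icc (-T) T, ‖V t‖ ≤ 2 * r := by
  intro t ht
  have hT : 0 ≤ T := by linarith [ht.1.trans ht.2]
  have hstep : ∀ t ∈ Set.Icc (-T) T, (∀ τ, |τ| ≤ |t| → ‖V τ‖ ≤ 2 * r) → ‖V t‖ < 2 * r := by
    intro t ht hτ
    have h1 := hP.A_le t (V t) (hτ t le_rfl)
    have h2 := hP.A_le 0 (V 0) (hτ 0 (by simp))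
    have h3 : ‖∫ τ in (0 : ℝ)..t, B τ (V τ)‖ ≤ K * (2 * r) * |t - 0| := by
      refine intervalIntegral.norm_integral_le_of_norm_le_const fun τ hτ' => ?_
      have h4 := hτ τ (abs_le_of_mem_uIoc hτ')
      exact (hP.B_le τ _ h4).trans (by gcongr)
    have h5 : K * (2 * r) * |t - 0| ≤ r / 4 := by
      rw [sub_zero]
      have : |t| ≤ T := abs_le.2 ht
      calc K * (2 * r) * |t| ≤ K * (2 * r) * T := by gcongr
        _ = T * K * (2 * r) := by ring
        _ ≤ 1 / 8 * (2 * r) := by gcongr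
        _ = r / 4 := by ring
    have h6 := hτ t le_rfl
    have h7 := hτ 0 (by simp)
    rw [h t ht]
    have h8 := norm_add₃_le (a := u₀) (b := A t (V t) - A 0 (V 0))
      (c := ∫ τ in (0 : ℝ)..t, B τ (V τ))
    have h9 := norm_sub_le (A t (V t)) (A 0 (V 0))
    linarith
  have h0 : V 0 = u₀ := by
    have := h 0 ⟨by linarith, hT⟩
    simpa using this
  -- The maximum treats positive and negative times simultaneously.
  have hf : Continuous fun ρ => max ‖V ρ‖ ‖V (-ρ)‖ := by fun_prop
  have key := lt_of_bootstrap hf (c := 2 * r) (T := T)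
    (by rw [neg_zero, max_self, h0]; linarith) fun σ hσ hρ => by
      have hb : ∀ τ, |τ| ≤ |σ| → ‖V τ‖ ≤ 2 * r := by
        intro τ hτ
        rw [abs_of_nonneg hσ.1] at hτ
        have := hρ |τ| ⟨abs_nonneg τ, hτ⟩
        rcases abs_cases τ with ⟨e, -⟩ | ⟨e, -⟩
        · rw [e] at this; exact (le_max_left _ _).trans this
        · rw [e, neg_neg] at this; exact (le_max_right _ _).trans this
      refine max_lt (hstep σ ⟨by linarith [hσ.1], hσ.2⟩ hb)
        (hstep (-σ) ⟨by linarith [hσ.2], by linarith [hσ.1]⟩ fun τ hτ => hb τ ?_)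
      rwa [abs_neg] at hτ
  have h1 := key |t| ⟨abs_nonneg t, abs_le.2 ht⟩
  rcases abs_cases t with ⟨e, -⟩ | ⟨e, -⟩
  · rw [e] at h1; exact (le_max_left _ _).trans h1.le
  · rw [e, neg_neg] at h1; exact (le_max_right _ _).trans h1.le

/-- The right-hand side of the equation is a contraction, up to the change of data. -/
theorem norm_picard_sub_le (hT : 0 < T) {R : ℝ} (hP : PicardBounds A B R K) (hK : 0 ≤ K)
    (hTK : T * K ≤ 1 / 8) (u₀ z₀ : E) {v w : C(Set.Icc (-T) T, E)} (hv : ‖v‖ ≤ R) (hw : ‖w‖ ≤ R)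
    {V W : ℝ → E} (hV : V = Set.IccExtend (neg_le_self hT.le) v)
    (hW : W = Set.IccExtend (neg_le_self hT.le) w) {t : ℝ} (ht : t ∈ Set.Icc (-T) T) :
    ‖(u₀ + (A t (V t) - A 0 (V 0)) + ∫ τ in (0 : ℝ)..t, B τ (V τ)) -
      (z₀ + (A t (W t) - A 0 (W 0)) + ∫ τ in (0 : ℝ)..t, B τ (W τ))‖ ≤
      ‖u₀ - z₀‖ + 1 / 2 * ‖v - w‖ := by
  have hVc : Continuous V := hV ▸ continuous_IccExtend hT v
  have hWc : Continuous W := hW ▸ continuous_IccExtend hT w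
  have hVR : ∀ t, ‖V t‖ ≤ R := fun t => by rw [hV]; exact (norm_IccExtend_le hT v t).trans hv
  have hWR : ∀ t, ‖W t‖ ≤ R := fun t => by rw [hW]; exact (norm_IccExtend_le hT w t).trans hw
  have hVW : ∀ t, ‖V t - W t‖ ≤ ‖v - w‖ := fun t => by
    rw [hV, hW]; exact norm_IccExtend_le hT (v - w) t
  have hBV := continuous_of_lipschitz hP.B_sub hP.B_cont hVc hVR
  have hBW := continuous_of_lipschitz hP.B_sub hP.B_cont hWc hWR
  have h1 : ‖A t (V t) - A t (W t)‖ ≤ 1 / 8 * ‖v - w‖ :=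
    (hP.A_sub t _ _ (hVR t) (hWR t)).trans (by gcongr; exact hVW t)
  have h2 : ‖A 0 (V 0) - A 0 (W 0)‖ ≤ 1 / 8 * ‖v - w‖ :=
    (hP.A_sub 0 _ _ (hVR 0) (hWR 0)).trans (by gcongr; exact hVW 0)
  have h3 : ‖∫ τ in (0 : ℝ)..t, (B τ (V τ) - B τ (W τ))‖ ≤ K * ‖v - w‖ * |t - 0| :=
    intervalIntegral.norm_integral_le_of_norm_le_const fun τ _ =>
      (hP.B_sub τ _ _ (hVR τ) (hWR τ)).trans (by gcongr; exact hVW τ)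
  have h4 : K * ‖v - w‖ * |t - 0| ≤ 1 / 8 * ‖v - w‖ := by
    rw [sub_zero]
    have : |t| ≤ T := abs_le.2 ht
    calc K * ‖v - w‖ * |t| ≤ K * ‖v - w‖ * T := by gcongr
      _ = T * K * ‖v - w‖ := by ring
      _ ≤ _ := by gcongr
  rw [show (u₀ + (A t (V t) - A 0 (V 0)) + ∫ τ in (0 : ℝ)..t, B τ (V τ)) -
      (z₀ + (A t (W t) - A 0 (W 0)) + ∫ τ in (0 : ℝ)..t, B τ (W τ)) =
      (u₀ - z₀) + ((A t (V t) - A t (W t)) - (A 0 (V 0) - A 0 (W 0))) +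
      ((∫ τ in (0 : ℝ)..t, B τ (V τ)) - ∫ τ in (0 : ℝ)..t, B τ (W τ)) by abel,
    ← intervalIntegral.integral_sub (hBV.intervalIntegrable _ _) (hBW.intervalIntegrable _ _)]
  refine (norm_add₃_le).trans ?_
  have h5 := norm_sub_le (A t (V t) - A t (W t)) (A 0 (V 0) - A 0 (W 0))
  have h6 := norm_nonneg (v - w)
  linarith

theorem IsMildSolution.norm_sub_le (hT : 0 < T) {R : ℝ} (hP : PicardBounds A B R K) (hK : 0 ≤ K)
    (hTK : T * K ≤ 1 / 8) {u₀ z₀ : E} {v w : C(Set.Icc (-T) T, E)} (hv : ‖v‖ ≤ R) (hw : ‖w‖ ≤ R)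
    (h1 : IsMildSolution A B T u₀ (Set.IccExtend (neg_le_self hT.le) v))
    (h2 : IsMildSolution A B T z₀ (Set.IccExtend (neg_le_self hT.le) w)) :
    ‖v - w‖ ≤ 2 * ‖u₀ - z₀‖ := by
  have h : ‖v - w‖ ≤ ‖u₀ - z₀‖ + 1 / 2 * ‖v - w‖ := by
    refine (ContinuousMap.norm_le _ (by positivity)).2 fun t => ?_
    rw [ContinuousMap.sub_apply, ← IccExtend_coe hT v t, ← IccExtend_coe hT w t, h1 t t.2, h2 t t.2]
    exact norm_picard_sub_le hT hP hK hTK u₀ z₀ hv hw rfl rfl t.2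
  linarith

/-- The right-hand side of the equation is a contraction of the ball of radius `2r`. -/
theorem exists_isMildSolution (hT : 0 < T) [CompleteSpace E] (hP : PicardBounds A B (2 * r) K)
    (hK : 0 ≤ K) (hTK : T * K ≤ 1 / 8) {u₀ : E} (hu₀ : ‖u₀‖ ≤ r) :
    ∃ v : C(Set.Icc (-T) T, E), ‖v‖ ≤ 2 * r ∧
      IsMildSolution A B T u₀ (Set.IccExtend (neg_le_self hT.le) v) := by
  have hr : 0 ≤ r := (norm_nonneg _).trans hu₀
  let X := Metric.closedBall (0 : C(Set.Icc (-T) T, E)) (2 * r)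
  have hX : ∀ v : X, ‖v.1‖ ≤ 2 * r := fun v => mem_closedBall_zero_iff.1 v.2
  let ext : X → ℝ → E := fun v => Set.IccExtend (neg_le_self hT.le) v.1
  have hec : ∀ v, Continuous (ext v) := fun v => continuous_IccExtend hT v.1
  have heR : ∀ v t, ‖ext v t‖ ≤ 2 * r := fun v t => (norm_IccExtend_le hT v.1 t).trans (hX v)
  have hB : ∀ v, Continuous fun τ => B τ (ext v τ) := fun v =>
    continuous_of_lipschitz hP.B_sub hP.B_cont (hec v) (heR v)
  have hA : ∀ v, Continuous fun τ => A τ (ext v τ) := fun v =>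
    continuous_of_lipschitz hP.A_sub hP.A_cont (hec v) (heR v)
  let Γ : X → C(Set.Icc (-T) T, E) := fun v =>
    ⟨fun t => u₀ + (A t (ext v t) - A 0 (ext v 0)) + ∫ τ in (0 : ℝ)..t, B τ (ext v τ), by
      have h1 := intervalIntegral.continuous_primitive (μ := volume)
        (fun a b => (hB v).intervalIntegrable a b) 0
      have h2 : Continuous fun t : ℝ =>
          u₀ + (A t (ext v t) - A 0 (ext v 0)) + ∫ τ in (0 : ℝ)..t, B τ (ext v τ) :=
        (continuous_const.add ((hA v).sub continuous_const)).add h1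
      exact h2.comp continuous_subtype_val⟩
  have hsub : ∀ v w, ‖Γ v - Γ w‖ ≤ 1 / 2 * ‖v.1 - w.1‖ := by
    intro v w
    refine (ContinuousMap.norm_le _ (by positivity)).2 fun t => ?_
    have := norm_picard_sub_le hT hP hK hTK u₀ u₀ (hX v) (hX w) rfl rfl t.2
    rwa [sub_self, norm_zero, zero_add] at this
  have hball : ∀ v, ‖Γ v‖ ≤ 2 * r := by
    intro v
    refine (ContinuousMap.norm_le _ (by positivity)).2 fun t => ?_
    have h1 := hP.A_le t (ext v t) (heR v t)
    have h2 := hP.A_le 0 (ext v 0) (heR v 0)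
    have h3 : ‖∫ τ in (0 : ℝ)..t, B τ (ext v τ)‖ ≤ K * (2 * r) * |(t : ℝ) - 0| :=
      intervalIntegral.norm_integral_le_of_norm_le_const fun τ _ =>
        (hP.B_le τ _ (heR v τ)).trans (by gcongr; exact heR v τ)
    have h4 : K * (2 * r) * |(t : ℝ) - 0| ≤ 1 / 8 * (2 * r) := by
      rw [sub_zero]
      have : |(t : ℝ)| ≤ T := abs_le.2 t.2
      calc K * (2 * r) * |(t : ℝ)| ≤ K * (2 * r) * T := by gcongr
        _ = T * K * (2 * r) := by ring
        _ ≤ _ := by gcongr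
    have h5 := norm_sub_le (A t (ext v t)) (A 0 (ext v 0))
    have h6 := heR v t
    have h7 := heR v 0
    refine (norm_add₃_le).trans ?_
    linarith
  let Γ' : X → X := fun v => ⟨Γ v, mem_closedBall_zero_iff.2 (hball v)⟩
  have hcontr : ContractingWith (1 / 2) Γ' := by
    refine ⟨by norm_num [← NNReal.coe_lt_coe], LipschitzWith.of_dist_le_mul fun v w => ?_⟩
    rw [Subtype.dist_eq, Subtype.dist_eq, dist_eq_norm, dist_eq_norm]
    simpa using hsub v w
  have : CompleteSpace X := Metric.isClosed_closedBall.completeSpace_coe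
  have : Nonempty X := ⟨⟨0, mem_closedBall_zero_iff.2 (by simpa using hr)⟩⟩
  have hfix : Γ' (hcontr.fixedPoint Γ') = hcontr.fixedPoint Γ' := hcontr.fixedPoint_isFixedPt
  set v := hcontr.fixedPoint Γ' with hv
  refine ⟨v.1, hX v, fun t ht => ?_⟩
  have h1 : Γ v = v.1 := congrArg Subtype.val hfix
  have h2 : Γ v ⟨t, ht⟩ = v.1 ⟨t, ht⟩ := by rw [h1]
  rw [← IccExtend_coe hT v.1 ⟨t, ht⟩] at h2
  exact h2.symm

/-- A symmetry of the equation that preserves the datum preserves the solution. -/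
theorem IsMildSolution.map_eq (hT : 0 < T) {R : ℝ} (hP : PicardBounds A B R K) (hK : 0 ≤ K)
    (hTK : T * K ≤ 1 / 8) [CompleteSpace E] (J : E →L[ℝ] E) (hJ : ∀ w, ‖J w‖ = ‖w‖)
    (hJA : ∀ t w, ‖w‖ ≤ R → A t (J w) = J (A t w)) (hJB : ∀ t w, ‖w‖ ≤ R → B t (J w) = J (B t w))
    {u₀ : E} (hu₀ : J u₀ = u₀) {v : C(Set.Icc (-T) T, E)} (hv : ‖v‖ ≤ R)
    (h : IsMildSolution A B T u₀ (Set.IccExtend (neg_le_self hT.le) v)) (t : Set.Icc (-T) T) :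
    J (v t) = v t := by
  let w : C(Set.Icc (-T) T, E) := ⟨fun t => J (v t), J.continuous.comp v.continuous⟩
  have hR : 0 ≤ R := (norm_nonneg _).trans hv
  have hw : ‖w‖ ≤ R := (ContinuousMap.norm_le _ hR).2 fun t => by
    change ‖J (v t)‖ ≤ R
    rw [hJ]; exact (v.norm_coe_le_norm t).trans hv
  have hVR : ∀ t, ‖Set.IccExtend (neg_le_self hT.le) v t‖ ≤ R := fun t =>
    (norm_IccExtend_le hT v t).trans hv
  have hB := continuous_of_lipschitz hP.B_sub hP.B_cont (continuous_IccExtend hT v) hVR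
  have hext : ∀ t, Set.IccExtend (neg_le_self hT.le) w t =
      J (Set.IccExtend (neg_le_self hT.le) v t) := fun t => rfl
  have hmild : IsMildSolution A B T u₀ (Set.IccExtend (neg_le_self hT.le) w) := by
    intro t ht
    simp only [hext]
    rw [hJA t _ (hVR t), hJA 0 _ (hVR 0), intervalIntegral.integral_congr
      (g := fun τ => J (B τ (Set.IccExtend (neg_le_self hT.le) v τ))) fun τ _ => hJB τ _ (hVR τ),
      J.intervalIntegral_comp_comm (hB.intervalIntegrable _ _)]
    conv_lhs => rw [h t ht]
    rw [map_add, map_add, map_sub, hu₀]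
  have h0 := IsMildSolution.norm_sub_le hT hP hK hTK hw hv hmild h
  rw [sub_self, norm_zero, mul_zero] at h0
  have h1 : w = v := sub_eq_zero.1 (norm_le_zero_iff.1 h0)
  exact congrArg (fun f : C(Set.Icc (-T) T, E) => f t) h1

end Picard

/-! ### Complex conjugation -/

/-- Complex conjugation on `L²(ℝ; ℂ)`. -/
def conjL2 : Lp ℂ 2 (volume : Measure ℝ) →L[ℝ] Lp ℂ 2 (volume : Measure ℝ) :=
  (Complex.conjCLE : ℂ →L[ℝ] ℂ).compLpL 2 volume

theorem coeFn_conjL2 (w : Lp ℂ 2 (volume : Measure ℝ)) :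
    conjL2 w =ᵐ[volume] fun x => (starRingEnd ℂ) (w x) :=
  ContinuousLinearMap.coeFn_compLpL _ _

theorem fourier_conj (f : ℝ → ℂ) (ξ : ℝ) :
    𝓕 (fun x => (starRingEnd ℂ) (f x)) ξ = (starRingEnd ℂ) (𝓕 f (-ξ)) := by
  rw [Real.fourier_eq', Real.fourier_eq', ← integral_conj]
  refine integral_congr_ae (Filter.Eventually.of_forall fun x => ?_)
  simp only [smul_eq_mul, map_mul, ← Complex.exp_conj]
  congr 2
  simp only [Complex.conj_ofReal, Complex.conj_I]
  simp

theorem measurePreserving_neg_real : MeasurePreserving (fun x : ℝ => -x) volume volume :=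
  Measure.measurePreserving_neg volume

/-- The Fourier transform of `w̄` is the reflected conjugate of that of `w`. On Schwartz functions this
is a computation with the integral; both sides are continuous on `L²`. -/
theorem fourier_conjL2 (w : Lp ℂ 2 (volume : Measure ℝ)) :
    𝓕 (conjL2 w) = Lp.compMeasurePreservingₗᵢ ℝ (fun x : ℝ => -x) measurePreserving_neg_real
      (conjL2 (𝓕 w)) := by
  refine DenseRange.induction_on (p := fun w : Lp ℂ 2 (volume : Measure ℝ) =>
    𝓕 (conjL2 w) = Lp.compMeasurePreservingₗᵢ ℝ (fun x : ℝ => -x) measurePreserving_neg_real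
      (conjL2 (𝓕 w))) (SchwartzMap.denseRange_toLpCLM (E := ℝ) (F := ℂ) (p := 2)
        ENNReal.ofNat_ne_top) w ?_ fun f => ?_
  · refine isClosed_eq ?_ ?_
    · exact (Lp.fourierTransformₗᵢ ℝ ℂ).continuous.comp conjL2.continuous
    · exact (LinearIsometry.continuous _).comp
        (conjL2.continuous.comp (Lp.fourierTransformₗᵢ ℝ ℂ).continuous)
  · set g : SchwartzMap ℝ ℂ := SchwartzMap.postcompCLM (Complex.conjCLE : ℂ →L[ℝ] ℂ) f with hg
    have h1 : conjL2 (f.toLp 2) = g.toLp 2 := by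
      refine Lp.ext ?_
      filter_upwards [coeFn_conjL2 (f.toLp 2), f.coeFn_toLp 2 volume, g.coeFn_toLp 2 volume]
        with x e1 e2 e3
      rw [e1, e2, e3]; rfl
    simp only [SchwartzMap.toLpCLM_apply]
    rw [h1, SchwartzMap.toLp_fourier_eq, SchwartzMap.toLp_fourier_eq]
    refine Lp.ext ?_
    have e4 : ∀ᵐ x : ℝ, conjL2 ((𝓕 f).toLp 2) (-x) =
        (starRingEnd ℂ) ((𝓕 f).toLp 2 volume (-x)) :=
      measurePreserving_neg_real.quasiMeasurePreserving.ae (coeFn_conjL2 _)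
    have e5 : ∀ᵐ x : ℝ, (𝓕 f).toLp 2 volume (-x) = (𝓕 f) (-x) :=
      measurePreserving_neg_real.quasiMeasurePreserving.ae ((𝓕 f).coeFn_toLp 2 volume)
    filter_upwards [(𝓕 g).coeFn_toLp 2 volume, e4, e5,
      Lp.coeFn_compMeasurePreserving (conjL2 ((𝓕 f).toLp 2)) measurePreserving_neg_real]
      with x k1 k2 k3 k4
    refine k1.trans (Eq.trans ?_ k4.symm)
    rw [Function.comp_apply, k2, k3, SchwartzMap.fourier_coe, SchwartzMap.fourier_coe]
    exact fourier_conj f x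

theorem hat_conjL2 (w : Lp ℂ 2 (volume : Measure ℝ)) :
    hat (conjL2 w) =ᵐ[volume] fun ξ => (starRingEnd ℂ) (hat w (-ξ)) := by
  have h : ∀ᵐ ξ : ℝ, (𝓕 (conjL2 w) : Lp ℂ 2 (volume : Measure ℝ)) ξ =
      (starRingEnd ℂ) ((𝓕 w : Lp ℂ 2 (volume : Measure ℝ)) (-ξ)) := by
    rw [fourier_conjL2]
    have e : ∀ᵐ x : ℝ, conjL2 (𝓕 w) (-x) = (starRingEnd ℂ)
        ((𝓕 w : Lp ℂ 2 (volume : Measure ℝ)) (-x)) :=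
      measurePreserving_neg_real.quasiMeasurePreserving.ae (coeFn_conjL2 _)
    filter_upwards [Lp.coeFn_compMeasurePreserving (conjL2 (𝓕 w)) measurePreserving_neg_real, e]
      with x k1 k2
    refine Eq.trans k1 ?_
    rw [Function.comp_apply, k2]
  filter_upwards [ae_scale h] with ξ hξ
  rw [hat, hξ, hat, neg_div]

theorem bracket_neg (ξ : ℝ) : bracket (-ξ) = bracket ξ := by simp [bracket]

theorem weightedHat_conjL2 (s : ℝ) (w : Lp ℂ 2 (volume : Measure ℝ)) :
    weightedHat s (conjL2 w) =ᵐ[volume] fun ξ => (starRingEnd ℂ) (weightedHat s w (-ξ)) := by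
  filter_upwards [hat_conjL2 w] with ξ hξ
  rw [weightedHat, weightedHat, hξ, map_mul, Complex.conj_ofReal, bracket_neg]

theorem eLpNorm_weightedHat_conjL2 (s : ℝ) (w : Lp ℂ 2 (volume : Measure ℝ)) :
    eLpNorm (weightedHat s (conjL2 w)) 2 volume = eLpNorm (weightedHat s w) 2 volume := by
  rw [eLpNorm_congr_ae (weightedHat_conjL2 s w), ← eLpNorm_comp_measurePreserving
    (measurable_weightedHat s w).aestronglyMeasurable measurePreserving_neg_real]
  exact eLpNorm_congr_norm_ae (Filter.Eventually.of_forall fun ξ => by simp)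

/-- Complex conjugation on `H^s`. -/
def conjHs (s : ℝ) : Hs s →L[ℝ] Hs s :=
  LinearMap.mkContinuous
    { toFun := fun w => ⟨conjL2 w.toL2, (measurable_weightedHat s _).aestronglyMeasurable, by
        rw [eLpNorm_weightedHat_conjL2]; exact w.memLp.2⟩
      map_add' := fun w z => Subtype.ext (conjL2.map_add w.toL2 z.toL2)
      map_smul' := fun c w => Subtype.ext (conjL2.map_smul c w.toL2) } 1 fun w => by
    rw [one_mul, Hs.norm_eq, Hs.norm_eq]
    exact (congrArg ENNReal.toReal (eLpNorm_weightedHat_conjL2 s w.toL2)).le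

theorem toL2_conjHs {s : ℝ} (w : Hs s) : (conjHs s w).toL2 = conjL2 w.toL2 := rfl

theorem norm_conjHs {s : ℝ} (w : Hs s) : ‖conjHs s w‖ = ‖w‖ := by
  rw [Hs.norm_eq, Hs.norm_eq, toL2_conjHs, eLpNorm_weightedHat_conjL2]

theorem isReal_iff {s : ℝ} (w : Hs s) : w.IsReal ↔ conjHs s w = w := by
  constructor
  · intro h
    refine Subtype.ext (Lp.ext ?_)
    filter_upwards [coeFn_conjL2 w.toL2, h] with x h1 h2
    refine Eq.trans h1 ?_
    exact Complex.conj_eq_iff_im.2 h2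
  · intro h
    have h1 := coeFn_conjL2 w.toL2
    rw [← toL2_conjHs, h] at h1
    filter_upwards [h1] with x hx
    exact Complex.conj_eq_iff_im.1 hx.symm

theorem leafFreq_neg : ∀ (k : ℕ) (T : OrderedTree k) (ξ : ℝ) (η : Fin k → ℝ) (b : Fin (k + 1)),
    leafFreq k T (-ξ) (-η) b = -leafFreq k T ξ η b
  | 0, _, _, _, _ => rfl
  | k + 1, (T, a), ξ, η, b => by
    have hi : Fin.init (-η) = -(Fin.init η : Fin k → ℝ) := rfl
    refine Fin.lastCases ?_ (fun b => ?_) b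
    · simp only [leafFreq, Fin.snoc_last, hi, leafFreq_neg k T, Pi.neg_apply]; ring
    · simp only [leafFreq, Fin.snoc_castSucc, hi, Pi.neg_apply]
      rcases eq_or_ne b a with rfl | h
      · simp only [Function.update_self]
      · simp only [Function.update_of_ne h, leafFreq_neg k T]

theorem genFreq_neg : ∀ (k : ℕ) (T : OrderedTree k) (ξ : ℝ) (η : Fin k → ℝ) (j : Fin k),
    genFreq k T (-ξ) (-η) j = -genFreq k T ξ η j
  | 0, _, _, _, j => j.elim0
  | k + 1, (T, a), ξ, η, j => by
    have hi : Fin.init (-η) = -(Fin.init η : Fin k → ℝ) := rfl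
    refine Fin.lastCases ?_ (fun b => ?_) j
    · simp only [genFreq, Fin.snoc_last, hi, leafFreq_neg k T, Pi.neg_apply, Prod.neg_mk]
      congr 2; ring
    · simp only [genFreq, Fin.snoc_castSucc, hi, genFreq_neg k T]

theorem Phi_neg (β ξ x y : ℝ) : Phi β (-ξ) (-x) (-y) = -Phi β ξ x y := by
  unfold Phi; ring

theorem muTilde_neg (β : ℝ) {k : ℕ} (T : OrderedTree k) (ξ : ℝ) (η : Fin k → ℝ) (j : ℕ) :
    muTilde β T (-ξ) (-η) j = -muTilde β T ξ η j := by
  unfold muTilde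
  rw [← Finset.sum_neg_distrib]
  refine Finset.sum_congr rfl fun i _ => ?_
  rw [genFreq_neg]
  split_ifs
  · exact Phi_neg _ _ _ _
  · simp

theorem condC_neg (β δ N : ℝ) {k : ℕ} (T : OrderedTree k) (ξ : ℝ) (η : Fin k → ℝ) (j : ℕ) :
    CondC β δ N T (-ξ) (-η) j ↔ CondC β δ N T ξ η j := by
  unfold CondC
  simp only [muTilde_neg, abs_neg]

theorem mem_region0_neg (β δ N : ℝ) {k : ℕ} (T : OrderedTree k) (ξ : ℝ) (η : Fin k → ℝ) :
    -η ∈ region0 β δ N T (-ξ) ↔ η ∈ region0 β δ N T ξ := by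
  unfold region0
  simp only [Set.mem_ofPred_eq, condC_neg]

theorem mem_region1_neg (β δ N : ℝ) {k : ℕ} (T : OrderedTree k) (ξ : ℝ) (η : Fin k → ℝ) :
    -η ∈ region1 β δ N T (-ξ) ↔ η ∈ region1 β δ N T ξ := by
  unfold region1
  split_ifs <;> simp only [Set.mem_ofPred_eq, condC_neg]

theorem treeKernel_neg (β : ℝ) (m : ℕ) {k : ℕ} (T : OrderedTree k) (ξ : ℝ) (η : Fin k → ℝ) :
    treeKernel β m T (-ξ) (-η) = (starRingEnd ℂ) (treeKernel β m T ξ η) := by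
  unfold treeKernel
  rw [map_div₀, map_prod, map_prod]
  simp [muTilde_neg, genFreq_neg]

theorem kernel0_neg (β δ N : ℝ) {k : ℕ} (T : OrderedTree k) (ξ : ℝ) (η : Fin k → ℝ) :
    kernel0 β δ N T (-ξ, -η) = (starRingEnd ℂ) (kernel0 β δ N T (ξ, η)) := by
  unfold kernel0
  by_cases h : η ∈ region0 β δ N T ξ
  · rw [Set.indicator_of_mem ((mem_region0_neg β δ N T ξ η).2 h), Set.indicator_of_mem h,
      treeKernel_neg]
  · rw [Set.indicator_of_notMem (mt (mem_region0_neg β δ N T ξ η).1 h), Set.indicator_of_notMem h,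
      map_zero]

theorem kernel1_neg (β δ N : ℝ) {k : ℕ} (T : OrderedTree k) (ξ : ℝ) (η : Fin k → ℝ) :
    kernel1 β δ N T (-ξ, -η) = (starRingEnd ℂ) (kernel1 β δ N T (ξ, η)) := by
  unfold kernel1
  by_cases h : η ∈ region1 β δ N T ξ
  · rw [Set.indicator_of_mem ((mem_region1_neg β δ N T ξ η).2 h), Set.indicator_of_mem h,
      treeKernel_neg]
  · rw [Set.indicator_of_notMem (mt (mem_region1_neg β δ N T ξ η).1 h), Set.indicator_of_notMem h,
      map_zero]

/-- Functions that agree almost everywhere agree at the terminal nodes of almost every index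
function. -/
theorem ae_ae_leafFreq {f g : ℝ → ℂ} (hf : Measurable f) (hg : Measurable g) (h : f =ᵐ[volume] g)
    {k : ℕ} (T : OrderedTree k) :
    ∀ᵐ ξ : ℝ, ∀ᵐ η : Fin k → ℝ, ∀ b, f (leafFreq k T ξ η b) = g (leafFreq k T ξ η b) := by
  have hZ : MeasurableSet {x | f x ≠ g x} := (measurableSet_eq_fun hf hg).compl
  have hb : ∀ b, ∀ᵐ ξ : ℝ, ∀ᵐ η : Fin k → ℝ, f (leafFreq k T ξ η b) = g (leafFreq k T ξ η b) := by
    intro b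
    -- The factor at `b` has integral zero, which outweighs the infinite integrals of the others.
    have h0 := lintegral_prod_leafFreq k T
      (fun c => if c = b then {x | f x ≠ g x}.indicator 1 else 1) fun c => by
        split_ifs
        · exact measurable_one.indicator hZ
        · exact measurable_one
    rw [Finset.prod_eq_zero (Finset.mem_univ b) (by
      simp only [if_true]
      rw [lintegral_indicator_one hZ]; exact h)] at h0
    have hm : Measurable fun p : ℝ × (Fin k → ℝ) =>
        {x | f x ≠ g x}.indicator (1 : ℝ → ℝ≥0∞) (leafFreq k T p.1 p.2 b) :=
      (measurable_one.indicator hZ).comp (continuous_leafFreq k T b).measurable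
    have h1 : ∀ ξ η, ∏ c, (if c = b then {x | f x ≠ g x}.indicator 1 else 1 : ℝ → ℝ≥0∞)
        (leafFreq k T ξ η c) = {x | f x ≠ g x}.indicator (1 : ℝ → ℝ≥0∞) (leafFreq k T ξ η b) := by
      intro ξ η
      rw [Finset.prod_eq_single b (fun c _ hc => by simp [hc]) (by simp), if_pos rfl]
    simp_rw [h1] at h0
    filter_upwards [(lintegral_eq_zero_iff hm.lintegral_prod_right').1 h0] with ξ hξ
    filter_upwards [(lintegral_eq_zero_iff (hm.comp measurable_prodMk_left)).1 hξ] with η hη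
    by_contra hne
    have : {x | f x ≠ g x}.indicator (1 : ℝ → ℝ≥0∞) (leafFreq k T ξ η b) = 0 := hη
    rw [Set.indicator_of_mem (by exact hne)] at this
    exact one_ne_zero this
  filter_upwards [ae_all_iff.2 hb] with ξ hξ
  exact ae_all_iff.2 hξ

/-- If the kernels are Hermitian, the sum over trees commutes with complex conjugation of the datum,
as is seen from the substitution `η ↦ -η`. -/
theorem treeSum_conjL2 {k : ℕ} {κ : OrderedTree k → ℝ × (Fin k → ℝ) → ℂ}
    (hκ : ∀ T ξ η, κ T (-ξ, -η) = (starRingEnd ℂ) (κ T (ξ, η))) (β τ : ℝ)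
    (w : Lp ℂ 2 (volume : Measure ℝ)) :
    treeSum κ β τ (conjL2 w) =ᵐ[volume] fun ξ => (starRingEnd ℂ) (treeSum κ β τ w (-ξ)) := by
  have hm : Measurable fun ξ => (starRingEnd ℂ) (hat w (-ξ)) :=
    Complex.continuous_conj.measurable.comp ((measurable_hat w).comp measurable_neg)
  have h := ae_all_iff.2 fun T : OrderedTree k =>
    ae_ae_leafFreq (measurable_hat (conjL2 w)) hm (hat_conjL2 w) T
  filter_upwards [h] with ξ hξ
  rw [treeSum, treeSum, map_neg, map_sum]
  congr 1
  refine Finset.sum_congr rfl fun T _ => ?_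
  rw [← integral_conj, ← integral_neg_eq_self (μ := volume)
    (fun η => (starRingEnd ℂ) (κ T (-ξ, η) * leafProduct β τ w T (-ξ, η)))]
  refine integral_congr_ae ?_
  filter_upwards [hξ T] with η hη
  rw [hκ, map_mul, Complex.conj_conj, leafProduct, leafProduct]
  congr 1
  simp only [hη, leafFreq_neg, muTilde_neg, map_mul, map_prod, ← Complex.exp_conj]
  simp

theorem conjHs_ofHat {s : ℝ} {g h : ℝ → ℂ} (hg : IsHsHat s g) (hh : IsHsHat s h)
    (hgh : h =ᵐ[volume] fun ξ => (starRingEnd ℂ) (g (-ξ))) :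
    conjHs s (ofHat s g) = ofHat s h := by
  refine Subtype.ext (hat_injective ?_)
  have e : ∀ᵐ ξ : ℝ, hat (ofHat s g).toL2 (-ξ) = g (-ξ) :=
    measurePreserving_neg_real.quasiMeasurePreserving.ae (hat_ofHat hg)
  filter_upwards [hat_conjL2 (ofHat s g).toL2, hat_ofHat hh, hgh, e] with ξ h1 h2 h3 h4
  refine Eq.trans h1 (Eq.trans ?_ h2.symm)
  rw [h3, h4]

theorem TermBounds.N0_conj {s β δ N R p K : ℝ} (hB : TermBounds s β δ N R p K) (k : ℕ) (τ : ℝ)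
    (w : Hs s) : N0 β δ N (k + 2) τ (conjHs s w) = conjHs s (N0 β δ N (k + 2) τ w) := by
  refine (conjHs_ofHat (hB.wellDefined0 k τ w).2 (hB.wellDefined0 k τ (conjHs s w)).2 ?_).symm
  rw [N0hat_eq, N0hat_eq]
  exact treeSum_conjL2 (kernel0_neg β δ N) β τ w.toL2

theorem TermBounds.N1_conj {s β δ N R p K : ℝ} (hB : TermBounds s β δ N R p K) (k : ℕ) (τ : ℝ)
    (w : Hs s) : N1 β δ N (k + 1) τ (conjHs s w) = conjHs s (N1 β δ N (k + 1) τ w) := by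
  refine (conjHs_ofHat (hB.wellDefined1 k τ w).2 (hB.wellDefined1 k τ (conjHs s w)).2 ?_).symm
  rw [N1hat_eq, N1hat_eq]
  exact treeSum_conjL2 (kernel1_neg β δ N) β τ w.toL2

/-! ### The normal form equation as a fixed point problem -/

/-- The sum of all boundary terms of the normal form equation. -/
def boundaryTerm {s : ℝ} (β δ N t : ℝ) (w : Hs s) : Hs s := ∑' k : ℕ, N0 β δ N (k + 2) t w

/-- The sum of all terms of the normal form equation that are integrated in time. -/
def bulkTerm {s : ℝ} (β δ N t : ℝ) (w : Hs s) : Hs s := ∑' k : ℕ, N1 β δ N (k + 1) t w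

theorem hasSum_geometric_succ {p : ℝ} (h0 : 0 ≤ p) (h1 : p < 1) (c : ℝ) :
    HasSum (fun k : ℕ => p ^ (k + 1) * c) (p * (1 - p)⁻¹ * c) := by
  have := ((hasSum_geometric_of_lt_one h0 h1).mul_left p).mul_right c
  simpa only [pow_succ'] using this

theorem hasSum_const_mul_geometric {p : ℝ} (h0 : 0 ≤ p) (h1 : p < 1) (K c : ℝ) :
    HasSum (fun k : ℕ => K * p ^ k * c) (K * (1 - p)⁻¹ * c) :=
  ((hasSum_geometric_of_lt_one h0 h1).mul_left K).mul_right c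

namespace TermBounds

variable {s β δ N R p K : ℝ}

theorem summable0 (hs : 0 ≤ s) (hB : TermBounds s β δ N R p K) (h0 : 0 ≤ p) (h1 : p < 1) (t : ℝ)
    {w : Hs s} (hw : ‖w‖ ≤ R) : Summable fun k : ℕ => N0 β δ N (k + 2) t w :=
  have := Hs.completeSpace hs
  .of_norm_bounded (hasSum_geometric_succ h0 h1 ‖w‖).summable fun k => hB.norm0_le k t w hw

theorem summable1 (hs : 0 ≤ s) (hB : TermBounds s β δ N R p K) (h0 : 0 ≤ p) (h1 : p < 1) (t : ℝ)
    {w : Hs s} (hw : ‖w‖ ≤ R) : Summable fun k : ℕ => N1 β δ N (k + 1) t w :=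
  have := Hs.completeSpace hs
  .of_norm_bounded (hasSum_const_mul_geometric h0 h1 K ‖w‖).summable fun k => hB.norm1_le k t w hw

theorem picardBounds (hs : 0 ≤ s) (hB : TermBounds s β δ N R p K) (hK : 0 ≤ K) (h0 : 0 ≤ p)
    (hp : p ≤ 1 / 9) :
    PicardBounds (boundaryTerm (s := s) β δ N) (bulkTerm β δ N) R (2 * K) := by
  have := Hs.completeSpace hs
  have h1 : p < 1 := by linarith
  have hinv : (1 - p)⁻¹ ≤ 9 / 8 := by
    rw [inv_le_comm₀ (by linarith) (by norm_num)]; linarith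
  have hinv0 : 0 ≤ (1 - p)⁻¹ := inv_nonneg.2 (by linarith)
  have e0 : p * (1 - p)⁻¹ ≤ 1 / 8 := by nlinarith
  have e1 : K * (1 - p)⁻¹ ≤ 2 * K := by nlinarith
  constructor
  · intro t w z hw hz
    rw [boundaryTerm, boundaryTerm, ← (hB.summable0 hs h0 h1 t hw).tsum_sub
      (hB.summable0 hs h0 h1 t hz)]
    refine (tsum_of_norm_bounded (hasSum_geometric_succ h0 h1 ‖w - z‖)
      fun k => hB.sub0_le k t w z hw hz).trans ?_
    gcongr
  · intro t w hw
    refine (tsum_of_norm_bounded (hasSum_geometric_succ h0 h1 ‖w‖)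
      fun k => hB.norm0_le k t w hw).trans ?_
    gcongr
  · intro w hw
    exact continuous_tsum (fun k => hB.continuous0 k w) (hasSum_geometric_succ h0 h1 ‖w‖).summable
      fun k t => hB.norm0_le k t w hw
  · intro t w z hw hz
    rw [bulkTerm, bulkTerm, ← (hB.summable1 hs h0 h1 t hw).tsum_sub (hB.summable1 hs h0 h1 t hz)]
    refine (tsum_of_norm_bounded (hasSum_const_mul_geometric h0 h1 K ‖w - z‖)
      fun k => hB.sub1_le k t w z hw hz).trans ?_
    gcongr
  · intro t w hw
    refine (tsum_of_norm_bounded (hasSum_const_mul_geometric h0 h1 K ‖w‖)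
      fun k => hB.norm1_le k t w hw).trans ?_
    gcongr
  · intro w hw
    exact continuous_tsum (fun k => hB.continuous1 k w)
      (hasSum_const_mul_geometric h0 h1 K ‖w‖).summable fun k t => hB.norm1_le k t w hw

theorem boundaryTerm_conj (hs : 0 ≤ s) (hB : TermBounds s β δ N R p K) (h0 : 0 ≤ p) (h1 : p < 1)
    (t : ℝ) (w : Hs s) (hw : ‖w‖ ≤ R) :
    boundaryTerm β δ N t (conjHs s w) = conjHs s (boundaryTerm β δ N t w) := by
  rw [boundaryTerm, boundaryTerm, (conjHs s).map_tsum (hB.summable0 hs h0 h1 t hw)]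
  simp only [hB.N0_conj]

theorem bulkTerm_conj (hs : 0 ≤ s) (hB : TermBounds s β δ N R p K) (h0 : 0 ≤ p) (h1 : p < 1)
    (t : ℝ) (w : Hs s) (hw : ‖w‖ ≤ R) :
    bulkTerm β δ N t (conjHs s w) = conjHs s (bulkTerm β δ N t w) := by
  rw [bulkTerm, bulkTerm, (conjHs s).map_tsum (hB.summable1 hs h0 h1 t hw)]
  simp only [hB.N1_conj]

end TermBounds

theorem SolvesNFE.isMildSolution {s β δ N T : ℝ} (hT : 0 < T) {u₀ : Hs s} {V : ℝ → Hs s}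
    (h : SolvesNFE β δ N T u₀ V) :
    IsMildSolution (boundaryTerm β δ N) (bulkTerm β δ N) T u₀ V := by
  intro t ht
  have h0 : (0 : ℝ) ∈ Set.Icc (-T) T := ⟨by linarith, hT.le⟩
  rw [boundaryTerm, boundaryTerm, ← (h.summable0 t ht).tsum_sub (h.summable0 0 h0)]
  exact h.equation t ht

/-- For functions with values in the ball, the qualitative requirements in the definition of a solution
hold automatically. -/
theorem TermBounds.solvesNFE {s β δ N R p K T : ℝ} (hs : 0 ≤ s) (hB : TermBounds s β δ N R p K)
    (hK : 0 ≤ K) (hp0 : 0 ≤ p) (hp : p ≤ 1 / 9) {u₀ : Hs s} {V : ℝ → Hs s}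
    (hV : Continuous V) (hVR : ∀ t, ‖V t‖ ≤ R)
    (h : IsMildSolution (boundaryTerm β δ N) (bulkTerm β δ N) T u₀ V) :
    SolvesNFE β δ N T u₀ V := by
  have hp1 : p < 1 := by linarith
  have hP := hB.picardBounds hs hK hp0 hp
  refine ⟨fun k hk t _ => ?_, fun k hk t _ => ?_, fun t _ => hB.summable0 hs hp0 hp1 t (hVR t),
    fun t _ => hB.summable1 hs hp0 hp1 t (hVR t), fun t _ => ?_, fun t ht => ?_⟩
  · obtain ⟨k, rfl⟩ := Nat.exists_eq_add_of_le' hk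
    exact hB.wellDefined0 k t (V t)
  · obtain ⟨k, rfl⟩ := Nat.exists_eq_add_of_le' hk
    exact hB.wellDefined1 k t (V t)
  · exact (continuous_of_lipschitz hP.B_sub hP.B_cont hV hVR).intervalIntegrable _ _
  · rw [(hB.summable0 hs hp0 hp1 t (hVR t)).tsum_sub (hB.summable0 hs hp0 hp1 0 (hVR 0))]
    exact h t ht

theorem exists_two_pow_small {δ : ℝ} (hδ : δ < 1) (B c : ℝ) :
    ∃ m : ℕ, 1 ≤ m ∧ c * √(B * ((2 : ℝ) ^ m) ^ (-((1 - δ) / 8))) ≤ 1 / 9 := by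
  have h1 : Filter.Tendsto (fun m : ℕ => ((2 : ℝ) ^ m) ^ (-((1 - δ) / 8))) Filter.atTop (nhds 0) :=
    (tendsto_rpow_neg_atTop (by linarith)).comp (tendsto_pow_atTop_atTop_of_one_lt one_lt_two)
  have h2 : Filter.Tendsto (fun m : ℕ => c * √(B * ((2 : ℝ) ^ m) ^ (-((1 - δ) / 8))))
      Filter.atTop (nhds 0) := by
    simpa using ((h1.const_mul B).sqrt).const_mul c
  obtain ⟨m, hm1, hm2⟩ := ((h2.eventually_le_const (show (0 : ℝ) < 1 / 9 by norm_num)).and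
    (Filter.eventually_ge_atTop 1)).exists
  exact ⟨m, hm2, hm1⟩

end Kawahara

end

theorem mainTheorem2 (β δ : ℝ) (hδ₀ : 0 < δ) (hδ₁ : δ < 1) (s : ℝ) (hs : 0 ≤ s)
    (r : ℝ) (hr : 1 ≤ r) :
    ∃ (T N : ℝ) (hT : 0 < T), 1 < N ∧ (∃ m : ℕ, N = 2 ^ m) ∧
      (∀ u₀ : Kawahara.Hs s, ‖u₀‖ ≤ r →
        ∃! v : Kawahara.SolutionSpace s T,
          Kawahara.SolvesNFE β δ N T u₀ (Set.IccExtend (neg_le_self hT.le) v)) ∧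
      (∀ (u₀ : Kawahara.Hs s) (v : Kawahara.SolutionSpace s T), ‖u₀‖ ≤ r →
        Kawahara.SolvesNFE β δ N T u₀ (Set.IccExtend (neg_le_self hT.le) v) → ‖v‖ ≤ 2 * r) ∧
      (∃ K : ℝ, ∀ (u₀ z₀ : Kawahara.Hs s) (v w : Kawahara.SolutionSpace s T),
        ‖u₀‖ ≤ r → ‖z₀‖ ≤ r →
        Kawahara.SolvesNFE β δ N T u₀ (Set.IccExtend (neg_le_self hT.le) v) →
        Kawahara.SolvesNFE β δ N T z₀ (Set.IccExtend (neg_le_self hT.le) w) →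
        ‖v - w‖ ≤ K * ‖u₀ - z₀‖) ∧
      (∀ (u₀ : Kawahara.Hs s) (v : Kawahara.SolutionSpace s T), ‖u₀‖ ≤ r →
        Kawahara.SolvesNFE β δ N T u₀ (Set.IccExtend (neg_le_self hT.le) v) →
        u₀.IsReal → ∀ t, (v t).IsReal) := by
  obtain ⟨B, -, hB⟩ := Kawahara.exists_termBounds β hδ₀ hδ₁ hs
  obtain ⟨m, hm1, hp⟩ := Kawahara.exists_two_pow_small hδ₁ B (16 * 2 ^ s * (2 * r))
  have hN : (1 : ℝ) < 2 ^ m := one_lt_pow₀ one_lt_two (by omega)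
  obtain ⟨K, hK, hTB⟩ := hB (2 ^ m) (2 * r) hN (by linarith)
  set p := 16 * 2 ^ s * (2 * r) * √(B * ((2 : ℝ) ^ m) ^ (-((1 - δ) / 8)))
  have hp0 : 0 ≤ p := by positivity
  have hP := hTB.picardBounds hs hK hp0 hp
  have hcomplete := Kawahara.Hs.completeSpace hs
  -- The summed integrated terms have Lipschitz constant `2K`; the `+ 1` covers the case `K = 0`.
  have hT : 0 < 1 / (8 * (2 * K + 1)) := by positivity
  have hK2 : 0 ≤ 2 * K := by linarith
  have hTK : 1 / (8 * (2 * K + 1)) * (2 * K) ≤ 1 / 8 := by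
    rw [div_mul_eq_mul_div, div_le_div_iff₀ (by positivity) (by norm_num)]; linarith
  have hbound : ∀ (u₀ : Kawahara.Hs s) (v : Kawahara.SolutionSpace s (1 / (8 * (2 * K + 1)))),
      ‖u₀‖ ≤ r → Kawahara.SolvesNFE β δ (2 ^ m) (1 / (8 * (2 * K + 1))) u₀
        (Set.IccExtend (neg_le_self hT.le) v) → ‖v‖ ≤ 2 * r := by
    intro u₀ v hu₀ hv
    refine (ContinuousMap.norm_le _ (by linarith)).2 fun t => ?_
    rw [← Kawahara.IccExtend_coe hT v t]
    exact (hv.isMildSolution hT).norm_le hP (by linarith) hK2 hTK hu₀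
      (Kawahara.continuous_IccExtend hT v) t t.2
  have hlip : ∀ (u₀ z₀ : Kawahara.Hs s)
      (v w : Kawahara.SolutionSpace s (1 / (8 * (2 * K + 1)))), ‖u₀‖ ≤ r → ‖z₀‖ ≤ r →
      Kawahara.SolvesNFE β δ (2 ^ m) (1 / (8 * (2 * K + 1))) u₀
        (Set.IccExtend (neg_le_self hT.le) v) →
      Kawahara.SolvesNFE β δ (2 ^ m) (1 / (8 * (2 * K + 1))) z₀
        (Set.IccExtend (neg_le_self hT.le) w) → ‖v - w‖ ≤ 2 * ‖u₀ - z₀‖ :=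
    fun u₀ z₀ v w hu hz hv hw => Kawahara.IsMildSolution.norm_sub_le hT hP hK2 hTK
      (hbound u₀ v hu hv) (hbound z₀ w hz hw) (hv.isMildSolution hT) (hw.isMildSolution hT)
  refine ⟨1 / (8 * (2 * K + 1)), 2 ^ m, hT, hN, ⟨m, rfl⟩, fun u₀ hu₀ => ?_, hbound, ⟨2, hlip⟩,
    fun u₀ v hu₀ hv hreal t => ?_⟩
  · obtain ⟨v, hvR, hv⟩ := Kawahara.exists_isMildSolution hT hP hK2 hTK hu₀
    have hsol := hTB.solvesNFE hs hK hp0 hp (Kawahara.continuous_IccExtend hT v)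
      (fun t => (Kawahara.norm_IccExtend_le hT v t).trans hvR) hv
    refine ⟨v, hsol, fun w hw => ?_⟩
    have h := hlip u₀ u₀ w v hu₀ hu₀ hw hsol
    rw [sub_self, norm_zero, mul_zero] at h
    exact sub_eq_zero.1 (norm_le_zero_iff.1 h)
  · rw [Kawahara.isReal_iff] at hreal ⊢
    exact (hv.isMildSolution hT).map_eq hT hP hK2 hTK (Kawahara.conjHs s) Kawahara.norm_conjHs
      (hTB.boundaryTerm_conj hs hp0 (by linarith)) (hTB.bulkTerm_conj hs hp0 (by linarith))
      hreal (hbound u₀ v hu₀ hv) t
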